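/- Let $C = C^{\perp} \le \mathbb{F}_3^{48}$ be an extremal self-dual ternary code of length 48, i.e. a code that equals its dual with respect to $(x,y)=\sum_i x_i y_i$ and has minimum distance $15$. Let $\mathrm{Mon}_{48}(\mathbb{F}_3) = \mathbb{F}_3^* \wr S_{48}$ be the monomial group acting on $\mathbb{F}_3^{48}$, let $\mathrm{Mon}(C)=\{\sigma\in \mathrm{Mon}_{48}(\mathbb{F}_3) : \sigma(C)=C\}$, and suppose that $\sigma \in \mathrm{Mon}(C)$ has order $11$. Then: (1) $C$ is monomially equivalent to the Pless code $P_{48}$, the code with generator matrix $(I_{24} \mid S)$, where the rows and columns of $S$ are indexed by $\{\infty\}\cup\mathbb{F}_{23}$ and $S_{\infty\infty}=0$, $S_{\infty j}=1$, $S_{i\infty}=\chi(-1)$, $S_{ij}=\chi(j-i)$ for $i,j\in\mathbb{F}_{23}$, with $\chi$ the quadratic character of $\mathbb{F}_{23}$ ($\chi(0)=0$). (2) The fixed code $C(\sigma)=\{c\in C : \sigma c=c\}$ has dimension $4$, and it is determined up to equivalence: there is $\tau\in \mathrm{Mon}_{48}(\mathbb{F}_3)$ such that $\tau\sigma\tau^{-1}$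 is the coordinate permutation $(1,\dots,11)(12,\dots,22)(23,\dots,33)(34,\dots,44)$ (with fixed points $45,\dots,48$), and the fixed code of $\tau\sigma\tau^{-1}$ in $\tau(C)$ is generated by the rows of $$\left(\begin{array}{cccc|cccc} 1^{11} & 0^{11} & 0^{11} & 0^{11} & 1 & 1 & 1 & 1 \\ 0^{11} & 1^{11} & 0^{11} & 0^{11} & 1 & 1 & -1 & -1 \\ 0^{11} & 0^{11} & 1^{11} & 0^{11} & 1 & -1 & 1 & -1 \\ 0^{11} & 0^{11} & 0^{11} & 1^{11} & 1 & -1 & -1 & 1 \end{array}\right).$$ (3) Let $X^{11}-1=(X-1)\,g\,h$ with $g,h\in\mathbb{F}_3[X]$ irreducible (of degree $5$), choose $a_0,a_1,a_2\in\mathbb{F}_3[X]$ with $1=a_0\,gh+(X-1)(a_1h+a_2g)$, and put $\tilde e_1=a_0gh$, $\tilde e_2=a_1h(X-1)$, $\tilde e_3=a_2g(X-1)$ and $e_i=\tilde e_i(\sigma)$. Then $Ce_1=C(\sigma)$; the component $Ce_2$ is a $2$-dimensional vector space over $\mathbb{F}_3[X]/(g)\cong\mathbb{F}_{3^5}$,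 and $Ce_3$ is a $2$-dimensional vector space over $\mathbb{F}_3[X]/(h)\cong\mathbb{F}_{3^5}$, where in both cases $X$ acts as $\sigma$. Moreover $Ce_2$ and $Ce_3$ are dual to each other: with $V=\mathbb{F}_3^{48}$, $Ce_2=Ve_2\cap (Ce_3)^{\perp}$ and $Ce_3=Ve_3\cap (Ce_2)^{\perp}$. -/

import Mathlib

open Polynomial

noncomputable section

/-- The monomial group `F^* ≀ S_n`, as a group of linear automorphisms of `F^n`: its elements are
the maps `diag(α₁, …, αₙ) π` with `αᵢ ∈ F^*` and `π` a permutation of the coordinates. -/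
def monomialGroup (F : Type*) [Field F] (n : ℕ) :
    Subgroup ((Fin n → F) ≃ₗ[F] (Fin n → F)) where
  carrier := {σ | ∃ (α : Fin n → Fˣ) (π : Equiv.Perm (Fin n)),
    ∀ v i, σ v i = (α i : F) * v (π⁻¹ i)}
  one_mem' := ⟨1, 1, fun v i => by simp⟩
  mul_mem' := by
    rintro σ τ ⟨α, π, h⟩ ⟨β, ρ, k⟩
    refine ⟨fun i => α i * β (π⁻¹ i), π * ρ, fun v i => ?_⟩
    rw [LinearEquiv.mul_apply, h, k]
    simp [mul_assoc]
  inv_mem' := by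
    rintro σ ⟨α, π, h⟩
    refine ⟨fun i => (α (π i))⁻¹, π⁻¹, fun v i => ?_⟩
    have hv : σ (σ⁻¹ v) = v := by
      rw [← LinearEquiv.mul_apply, mul_inv_cancel]; rfl
    have := h (σ⁻¹ v) (π i)
    rw [hv] at this
    simp [this]

/-- The monomial automorphism group `Mon(C)` of a code `C ≤ F^n`. -/
def monomialAut {F : Type*} [Field F] {n : ℕ} (C : Submodule F (Fin n → F)) :
    Subgroup ((Fin n → F) ≃ₗ[F] (Fin n → F)) where
  carrier := {σ | σ ∈ monomialGroup F n ∧ C.map (σ : (Fin n → F) →ₗ[F] (Fin n → F)) = C}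
  one_mem' := ⟨one_mem _, Submodule.map_id C⟩
  mul_mem' := by
    rintro σ τ ⟨hσ, h⟩ ⟨hτ, k⟩
    refine ⟨mul_mem hσ hτ, ?_⟩
    have := Submodule.map_comp (τ : (Fin n → F) →ₗ[F] (Fin n → F))
      (σ : (Fin n → F) →ₗ[F] (Fin n → F)) C
    rw [k, h] at this
    exact this
  inv_mem' := by
    rintro σ ⟨hσ, h⟩
    refine ⟨inv_mem hσ, ?_⟩
    have := Submodule.map_comp (σ : (Fin n → F) →ₗ[F] (Fin n → F))
      ((σ⁻¹ : (Fin n → F) ≃ₗ[F] (Fin n → F)) : (Fin n → F) →ₗ[F] (Fin n → F)) C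
    rw [h] at this
    rw [← this]
    convert Submodule.map_id C
    ext v
    simp [← LinearEquiv.mul_apply]

/-- Monomial equivalence of codes of length `n`. -/
def CodeEquivalent {F : Type*} [Field F] {n : ℕ} (C D : Submodule F (Fin n → F)) : Prop :=
  ∃ τ ∈ monomialGroup F n, C.map (τ : (Fin n → F) →ₗ[F] (Fin n → F)) = D

/-- The dual code with respect to the standard inner product `∑ i, x i * y i`. -/
def dualCode {F : Type*} [Field F] {n : ℕ} (C : Submodule F (Fin n → F)) :
    Submodule F (Fin n → F) where
  carrier := {v | ∀ c ∈ C, c ⬝ᵥ v = 0}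
  zero_mem' := fun c _ => dotProduct_zero c
  add_mem' := fun {v w} hv hw c hc => by rw [dotProduct_add, hv c hc, hw c hc, add_zero]
  smul_mem' := fun a v hv c hc => by rw [dotProduct_smul, hv c hc, smul_zero]

/-- The minimum distance `min {wt(c) | 0 ≠ c ∈ C}`. -/
def minDistance {F : Type*} [Field F] [DecidableEq F] {n : ℕ} (C : Submodule F (Fin n → F)) : ℕ :=
  sInf {w | ∃ c ∈ C, c ≠ 0 ∧ w = hammingNorm c}

/-- Extremal ternary codes: self-dual codes of length `n` and minimum distance `3⌊n/12⌋ + 3`. -/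
def IsExtremalTernary {n : ℕ} (C : Submodule (ZMod 3) (Fin n → ZMod 3)) : Prop :=
  C = dualCode C ∧ minDistance C = 3 * (n / 12) + 3

/-- The bordered Paley (Jacobsthal) matrix over `𝔽₃`. Index `0` stands for the point `∞`, and index
`k ≥ 1` for the element `k - 1` of `𝔽_p`. -/
def plessMatrix (p : ℕ) [Fact p.Prime] : Matrix (Fin (p + 1)) (Fin (p + 1)) (ZMod 3) :=
  Matrix.of fun i j =>
    if i = 0 then (if j = 0 then 0 else 1)
    else if j = 0 then ((legendreSym p (-1) : ℤ) : ZMod 3)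
    else ((legendreSym p ((j : ℤ) - (i : ℤ)) : ℤ) : ZMod 3)

/-- The Pless symmetry code of length `2(p+1)`, with generator matrix `(I | S_p)`. -/
def plessCode (p : ℕ) [Fact p.Prime] :
    Submodule (ZMod 3) (Fin ((p + 1) + (p + 1)) → ZMod 3) :=
  Submodule.span (ZMod 3) (Set.range fun i : Fin (p + 1) =>
    Fin.append ((1 : Matrix (Fin (p + 1)) (Fin (p + 1)) (ZMod 3)) i) (plessMatrix p i))

instance fact_prime_twentyThree : Fact (Nat.Prime 23) := ⟨by norm_num⟩

/-- The Pless code `P₄₈`. -/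
def P48 : Submodule (ZMod 3) (Fin 48 → ZMod 3) := plessCode 23

/-- The fixed code `C(σ)`. -/
def fixedCode {F : Type*} [Field F] {n : ℕ} (C : Submodule F (Fin n → F))
    (σ : (Fin n → F) ≃ₗ[F] (Fin n → F)) : Submodule F (Fin n → F) :=
  C ⊓ LinearMap.eqLocus (σ : (Fin n → F) →ₗ[F] (Fin n → F)) LinearMap.id

/-- The permutation of the 48 coordinates with four consecutive 11-cycles
`(0 1 … 10)(11 12 … 21)(22 … 32)(33 … 43)` and the fixed points `44, 45, 46, 47`. -/
def blockCycle : Equiv.Perm (Fin 48) where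
  toFun i := if i.val < 44 then Fin.ofNat 48 (11 * (i.val / 11) + (i.val % 11 + 1) % 11) else i
  invFun i := if i.val < 44 then Fin.ofNat 48 (11 * (i.val / 11) + (i.val % 11 + 10) % 11) else i
  left_inv := by decide
  right_inv := by decide

/-- The right half of the generator matrix `fixedGenerator`. -/
def fixedRight : Matrix (Fin 4) (Fin 4) (ZMod 3) :=
  !![1, 1, 1, 1; 1, 1, -1, -1; 1, -1, 1, -1; 1, -1, -1, 1]

/-- The `4 × 48` matrix whose row `r` is `1` on the `r`-th block of 11 coordinates, `0` on the
other three blocks, and row `r` of `fixedRight` on the last four coordinates. -/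
def fixedGenerator : Matrix (Fin 4) (Fin 48) (ZMod 3) :=
  Matrix.of fun r k =>
    if h : k.val < 44 then (if k.val / 11 = r.val then 1 else 0)
    else fixedRight r ⟨k.val - 44, by omega⟩

/-- The component `C e`, the image of the code `C` under the element `e(σ)` of `F[σ]`. -/
def component {F : Type*} [Field F] {n : ℕ} (C : Submodule F (Fin n → F))
    (σ : (Fin n → F) ≃ₗ[F] (Fin n → F)) (e : F[X]) : Submodule F (Fin n → F) :=
  C.map (aeval (σ : (Fin n → F) →ₗ[F] (Fin n → F)) e)

/-- For a component `M` on which `σ` satisfies the irreducible polynomial `g`: the space `M`, as a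
vector space over the field `F[X]/(g)` whose generator `X` acts as `σ`, has dimension `d`. It is
expressed by an additive isomorphism from `(F[X]/(g))^d` onto `M` that turns multiplication by the
class of `X` into `σ`. -/
def HasEigenDimension {F : Type*} [Field F] {n : ℕ} (M : Submodule F (Fin n → F))
    (σ : (Fin n → F) ≃ₗ[F] (Fin n → F)) (g : F[X]) (d : ℕ) : Prop :=
  ∃ φ : (Fin d → AdjoinRoot g) ≃ₗ[F] M,
    ∀ x, (φ (AdjoinRoot.root g • x) : Fin n → F) = σ (φ x)

end

/-!
Extremal self-dual ternary codes of length 48 with a monomial automorphism of order 11.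

*Normal form.* A monomial map of order 11 over `𝔽₃` fixes the product of the images of the all-ones
vector under its powers, a vector without zeros; rescaling by it turns the map into a permutation of
the coordinates with `t ≤ 4` cycles of length 11 (`exists_conj_monomialMap`). If `T` is this
permutation and `D` the code, then `24 = dim (T - 1) D + dim ker (T - 1)`, and the minimum distance
15 bounds both summands so strongly that `t = 4` (`eq_four_of_map_cyclePerm`). The fixed code
consists of the words constant on the four cycles. Its generators have the form `(J in block i; hᵢ)`
with `hᵢ ∈ 𝔽₃⁴`; weight 15 forces all entries of `hᵢ` to be nonzero, self-duality makes the `hᵢ`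
orthogonal, and a `4 × 4` matrix of signs with orthogonal rows is unique up to equivalence
(`exists_eq_fixedRight`). This is `exists_normalCode`, and it contains the claims about the fixed
code.

*Generator matrices over the circulant ring.* Let `R = 𝔽₃[ℤ/11]`, with the involution `*` that
inverts the group elements. By the Plotkin bound no nonzero word is supported in two of the four
blocks (`NormalCode.two_blocks`). Hence the code is generated over `R` by the fixed code and two
rows `(1, 0, u, v)` and `(0, 1, w, z)`, where `u, v, w, z` lie in the ideal of coordinate sum zero.
The identity of this ideal is `idem`. Self-duality says `u u* + v v* = -idem` and
`(w, z) = (κ v*, -κ u*)` with `κ κ* = idem` (`NormalCode.exists_second_eq`). The ideal is a product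
of two fields of order `3⁵` exchanged by `*`, so `u` is determined by its norm `n = u u*` up to an
element of norm 1, and so is `v`, whose norm is `-idem - n` (`NormalCode.exists_first_eq`).

*Enumeration.* Up to sign and multiplication by group elements there are 11 elements of norm 1
(`exists_eq_normOneCode`); signs and group elements are absorbed into monomial maps, except for the
sign of `κ`. Up to the automorphisms `g ↦ gʳ` of the group and up to exchanging the last two blocks
there are 25 norms (`exists_normCode`). This leaves `25 · 11 · 11 · 22` generator matrices. For each
of them, with three exceptions, a table lists coefficients of a word of weight less than 15, and the
kernel computes its weight (`firstRowCheck_eq_true`, `index_mem_remainingIndices`). Vectors are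
packed into natural numbers with digits in base 256, so that a product in `R` is one multiplication
modulo `256¹¹ - 1`. The multiplier `x ↦ 2 x` of `𝔽₂₃`, of order 11, brings the Pless code into the
same block form, and explicit monomial maps carry the three remaining generator matrices into it
(`NormalCode.codeEquivalent_P48_of_remainingIndex`).

*Components.* For a factor `g` of `1 + X + ⋯ + X¹⁰` of degree 5, the component `C e₂` is the kernel
of `g(σ)` in `C` (`component_eq`). Such a word satisfies a linear recurrence of order 5 on each
block and vanishes at the fixed points, and two blocks determine it, so that `dim C e₂ ≤ 10`
(`NormalCode.finrank_inf_ker_le`). As `24 = 4 + 10 + 10`, equality holds for both factors. The two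
factors are reciprocal to each other (`exists_aeval_pow_ten_mul`), hence `ker g(σ)` is isotropic
(`dotProduct_eq_zero_of_mem_ker`). So a word of `V e₂` is automatically orthogonal to `C e₁` and
`C e₂`, and it lies in `C = C^⊥` as soon as it is orthogonal to `C e₃`.
-/

noncomputable section

/-! ### The ring of circulants of order 11 over `𝔽₃` -/

/-- The group algebra `𝔽₃[ℤ/11]`, as the ring of functions `ℤ/11 → 𝔽₃` under convolution: the ring
in which the entries of a code invariant under four 11-cycles live. -/
structure Circ : Type where
  /-- The coefficient function. -/
  coeff : ZMod 11 → ZMod 3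

namespace Circ

instance : CoeFun Circ fun _ => ZMod 11 → ZMod 3 := ⟨coeff⟩

/-- The underlying equivalence with the space of functions. -/
def equivFun : Circ ≃ (ZMod 11 → ZMod 3) := ⟨coeff, mk, fun _ => rfl, fun _ => rfl⟩

instance : AddCommGroup Circ := equivFun.addCommGroup
instance : Module (ZMod 3) Circ := equivFun.module (ZMod 3)
instance : DecidableEq Circ := equivFun.decidableEq

@[ext] protected theorem ext {a b : Circ} (h : ∀ i, a i = b i) : a = b := congrArg mk (funext h)

instance : Mul Circ := ⟨fun a b => ⟨fun i => ∑ j, a j * b (i - j)⟩⟩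
instance : One Circ := ⟨⟨fun i => if i = 0 then 1 else 0⟩⟩

theorem mul_apply (a b : Circ) (i : ZMod 11) : (a * b) i = ∑ j, a j * b (i - j) := rfl
theorem one_apply (i : ZMod 11) : (1 : Circ) i = if i = 0 then 1 else 0 := rfl
@[simp] theorem add_apply (a b : Circ) (i : ZMod 11) : (a + b) i = a i + b i := rfl
@[simp] theorem sub_apply (a b : Circ) (i : ZMod 11) : (a - b) i = a i - b i := rfl
@[simp] theorem neg_apply (a : Circ) (i : ZMod 11) : (-a) i = -a i := rfl
@[simp] theorem zero_apply (i : ZMod 11) : (0 : Circ) i = 0 := rfl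
@[simp] theorem smul_apply (s : ZMod 3) (a : Circ) (i : ZMod 11) : (s • a) i = s * a i := rfl

protected theorem mul_comm' (a b : Circ) : a * b = b * a := by
  refine Circ.ext fun i => ?_
  rw [mul_apply, mul_apply, ← (Equiv.subLeft i).sum_comp]
  exact Finset.sum_congr rfl fun j _ => by simp [mul_comm]

protected theorem mul_assoc' (a b c : Circ) : a * b * c = a * (b * c) := by
  refine Circ.ext fun i => ?_
  simp only [mul_apply, Finset.sum_mul, Finset.mul_sum]
  rw [Finset.sum_comm]
  refine Finset.sum_congr rfl fun j _ => ?_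
  rw [← Equiv.sum_comp (Equiv.addRight j)]
  refine Finset.sum_congr rfl fun k _ => ?_
  rw [Equiv.coe_addRight, mul_assoc, add_sub_cancel_right, sub_sub]
  exact congrArg (fun x => a j * (b k * c (i - x))) (add_comm k j)

protected theorem one_mul' (a : Circ) : 1 * a = a := by
  refine Circ.ext fun i => ?_
  simp [mul_apply, one_apply]

protected theorem left_distrib' (a b c : Circ) : a * (b + c) = a * b + a * c := by
  refine Circ.ext fun i => ?_
  simp [mul_apply, mul_add, Finset.sum_add_distrib]

protected theorem zero_mul' (a : Circ) : 0 * a = 0 := by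
  refine Circ.ext fun i => ?_
  simp [mul_apply]

instance : CommRing Circ :=
  { (inferInstance : AddCommGroup Circ) with
    mul_assoc := Circ.mul_assoc'
    mul_comm := Circ.mul_comm'
    one_mul := Circ.one_mul'
    mul_one := fun a => by rw [Circ.mul_comm', Circ.one_mul']
    left_distrib := Circ.left_distrib'
    right_distrib := fun a b c => by
      rw [Circ.mul_comm', Circ.left_distrib', Circ.mul_comm' c a, Circ.mul_comm' c b]
    zero_mul := Circ.zero_mul'
    mul_zero := fun a => by rw [Circ.mul_comm', Circ.zero_mul'] }

instance : Algebra (ZMod 3) Circ :=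
  Algebra.ofModule
    (fun r a b => by refine Circ.ext fun i => ?_; simp [mul_apply, Finset.mul_sum, mul_assoc])
    (fun r a b => by refine Circ.ext fun i => ?_; simp [mul_apply, Finset.mul_sum, mul_left_comm])

theorem sum_apply {ι : Type*} (s : Finset ι) (f : ι → Circ) (i : ZMod 11) :
    (∑ k ∈ s, f k) i = ∑ k ∈ s, f k i :=
  map_sum (AddMonoidHom.mk' (fun a : Circ => a i) fun _ _ => rfl) f s

instance : Nontrivial Circ := ⟨0, 1, fun h => by
  have := congrArg (fun a : Circ => a 0) h
  revert this
  decide⟩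

instance : CharP Circ 3 := charP_of_injective_algebraMap' (ZMod 3) 3

/-- The generator of the cyclic group of order 11 (more precisely, its `k`-th power). -/
def shift (k : ZMod 11) : Circ := ⟨fun i => if i = k then 1 else 0⟩

theorem shift_apply (k i : ZMod 11) : shift k i = if i = k then 1 else 0 := rfl

theorem shift_mul_apply (k : ZMod 11) (a : Circ) (i : ZMod 11) : (shift k * a) i = a (i - k) := by
  simp [mul_apply, shift_apply]

theorem shift_zero : shift 0 = 1 := rfl

theorem shift_mul_shift (k l : ZMod 11) : shift k * shift l = shift (k + l) := by
  refine Circ.ext fun i => ?_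
  rw [shift_mul_apply, shift_apply, shift_apply]
  simp [sub_eq_iff_eq_add, add_comm]

theorem shift_pow (k : ZMod 11) (m : ℕ) : shift k ^ m = shift (m * k) := by
  induction m with
  | zero => simp [shift_zero]
  | succ m ih => rw [pow_succ, ih, shift_mul_shift]; congr 1; push_cast; ring

theorem eq_sum_smul_shift (a : Circ) : a = ∑ k, a k • shift k := by
  refine Circ.ext fun i => ?_
  simp [sum_apply, shift_apply]

/-- The sum of the group elements, the all-ones vector. -/
def J : Circ := ⟨fun _ => 1⟩

@[simp] theorem J_apply (i : ZMod 11) : J i = 1 := rfl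

/-- The augmentation `∑ aₖ gᵏ ↦ ∑ aₖ`. -/
def aug (a : Circ) : ZMod 3 := ∑ i, a i

@[simp] theorem aug_add (a b : Circ) : aug (a + b) = aug a + aug b := Finset.sum_add_distrib
@[simp] theorem aug_sub (a b : Circ) : aug (a - b) = aug a - aug b := Finset.sum_sub_distrib ..
@[simp] theorem aug_neg (a : Circ) : aug (-a) = -aug a := Finset.sum_neg_distrib ..
@[simp] theorem aug_zero : aug 0 = 0 := Finset.sum_const_zero
@[simp] theorem aug_smul (s : ZMod 3) (a : Circ) : aug (s • a) = s * aug a :=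
  (Finset.mul_sum ..).symm
@[simp] theorem aug_one : aug 1 = 1 := by decide
@[simp] theorem aug_J : aug J = -1 := by decide
@[simp] theorem aug_shift (k : ZMod 11) : aug (shift k) = 1 := by simp [aug, shift_apply]

theorem mul_J (a : Circ) : a * J = aug a • J := by
  refine Circ.ext fun i => ?_
  simp [mul_apply, aug]

@[simp] theorem aug_mul (a b : Circ) : aug (a * b) = aug a * aug b := by
  have h : a * b * J = (aug a * aug b) • J := by
    rw [mul_assoc, mul_J b, mul_smul_comm, mul_J, smul_smul, mul_comm]
  rw [mul_J] at h
  simpa using congrArg (fun a : Circ => a 0) h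

/-- The involution `g ↦ g⁻¹`. -/
def star (a : Circ) : Circ := ⟨fun i => a (-i)⟩

@[simp] theorem star_apply (a : Circ) (i : ZMod 11) : star a i = a (-i) := rfl

/-- The ring automorphism `g ↦ gʳ`, for a unit `r` modulo 11. -/
def mult (r : (ZMod 11)ˣ) (a : Circ) : Circ := ⟨fun i => a (↑r⁻¹ * i)⟩

@[simp] theorem mult_apply (r : (ZMod 11)ˣ) (a : Circ) (i : ZMod 11) :
    mult r a i = a (↑r⁻¹ * i) := rfl

theorem mult_mul (r : (ZMod 11)ˣ) (a b : Circ) : mult r (a * b) = mult r a * mult r b := by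
  refine Circ.ext fun i => ?_
  rw [mult_apply, mul_apply, mul_apply, ← Equiv.sum_comp (Units.mulLeft r⁻¹)]
  exact Finset.sum_congr rfl fun j _ => by simp [mul_sub]

theorem mult_one (r : (ZMod 11)ˣ) : mult r 1 = 1 := by
  refine Circ.ext fun i => ?_
  simp [one_apply]

theorem aug_mult (r : (ZMod 11)ˣ) (a : Circ) : aug (mult r a) = aug a :=
  Equiv.sum_comp (Units.mulLeft r⁻¹) a

theorem star_eq_mult (a : Circ) : star a = mult (-1) a := by
  refine Circ.ext fun i => ?_
  simp

theorem star_mul (a b : Circ) : star (a * b) = star a * star b := by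
  simp only [star_eq_mult, mult_mul]

@[simp] theorem star_star (a : Circ) : star (star a) = a := by
  refine Circ.ext fun i => ?_
  simp

@[simp] theorem star_add (a b : Circ) : star (a + b) = star a + star b := rfl
@[simp] theorem star_neg (a : Circ) : star (-a) = -star a := rfl
@[simp] theorem star_sub (a b : Circ) : star (a - b) = star a - star b := rfl
@[simp] theorem star_zero : star 0 = 0 := rfl
@[simp] theorem star_one : star 1 = 1 := by rw [star_eq_mult, mult_one]
@[simp] theorem aug_star (a : Circ) : aug (star a) = aug a := by rw [star_eq_mult, aug_mult]

theorem star_pow (a : Circ) (m : ℕ) : star (a ^ m) = star a ^ m := by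
  induction m with
  | zero => simp
  | succ m ih => rw [pow_succ, star_mul, ih, pow_succ]

theorem mult_star (r : (ZMod 11)ˣ) (a : Circ) : mult r (star a) = star (mult r a) := by
  refine Circ.ext fun i => ?_
  simp

/-- Convolution with the involution computes the correlations of two vectors. -/
theorem mul_star_apply (a b : Circ) (k : ZMod 11) :
    (a * star b) k = ∑ j, a j * (shift k * b) j := by
  rw [mul_apply]
  exact Finset.sum_congr rfl fun j _ => by rw [shift_mul_apply, star_apply, neg_sub]

theorem pow_three_pow (a : Circ) (m : ℕ) : a ^ 3 ^ m = ∑ k, a k • shift (3 ^ m * k) := by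
  conv_lhs => rw [eq_sum_smul_shift a]
  rw [← iterateFrobenius_def, map_sum]
  refine Finset.sum_congr rfl fun k _ => ?_
  rw [iterateFrobenius_def, _root_.smul_pow, ZMod.pow_card_pow, shift_pow]
  push_cast
  rfl

/-- Every element is fixed by the fifth power of the Frobenius, as `3⁵ ≡ 1` modulo 11. -/
theorem pow_card_eq (a : Circ) : a ^ 243 = a := by
  have h := pow_three_pow a 5
  have h5 : (3 : ZMod 11) ^ 5 = 1 := by decide
  rw [h5] at h
  simp only [one_mul] at h
  rw [← eq_sum_smul_shift a] at h
  exact h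

/-- The identity of the ideal of vectors with coordinate sum zero. -/
def idem : Circ := 1 + J

@[simp] theorem aug_idem : aug idem = 0 := by simp [idem]

theorem mul_idem {a : Circ} (h : aug a = 0) : a * idem = a := by
  rw [idem, mul_add, mul_one, mul_J, h, zero_smul, add_zero]

end Circ

/-! ### Monomial maps, self-dual codes and weights -/

/-- The monomial map `v ↦ (αᵢ v(π⁻¹ i))ᵢ`. -/
def monomialMap {F : Type*} [Field F] {n : ℕ} (α : Fin n → Fˣ) (π : Equiv.Perm (Fin n)) :
    (Fin n → F) ≃ₗ[F] (Fin n → F) where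
  toFun v i := (α i : F) * v (π⁻¹ i)
  invFun v i := ((α (π i))⁻¹ : Fˣ) * v (π i)
  map_add' v w := by ext i; simp [mul_add]
  map_smul' s v := by ext i; simp [mul_left_comm]
  left_inv v := by ext i; simp
  right_inv v := by ext i; simp

theorem monomialMap_apply {F : Type*} [Field F] {n : ℕ} (α : Fin n → Fˣ)
    (π : Equiv.Perm (Fin n)) (v : Fin n → F) (i : Fin n) :
    monomialMap α π v i = (α i : F) * v (π⁻¹ i) := rfl

theorem monomialMap_mem {F : Type*} [Field F] {n : ℕ} (α : Fin n → Fˣ)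
    (π : Equiv.Perm (Fin n)) : monomialMap α π ∈ monomialGroup F n :=
  ⟨α, π, fun _ _ => rfl⟩

theorem exists_eq_monomialMap {F : Type*} [Field F] {n : ℕ}
    {σ : (Fin n → F) ≃ₗ[F] (Fin n → F)} (hσ : σ ∈ monomialGroup F n) :
    ∃ α π, σ = monomialMap α π := by
  obtain ⟨α, π, h⟩ := hσ
  exact ⟨α, π, by ext1 v; ext i; exact h v i⟩

theorem CodeEquivalent.trans {F : Type*} [Field F] {n : ℕ} {C D E : Submodule F (Fin n → F)}
    (h : CodeEquivalent C D) (k : CodeEquivalent D E) : CodeEquivalent C E := by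
  obtain ⟨τ, hτ, rfl⟩ := h
  obtain ⟨ρ, hρ, rfl⟩ := k
  refine ⟨ρ * τ, mul_mem hρ hτ, ?_⟩
  rw [← Submodule.map_comp]
  rfl

theorem hammingNorm_monomialMap {F : Type*} [Field F] [DecidableEq F] {n : ℕ}
    {σ : (Fin n → F) ≃ₗ[F] (Fin n → F)} (hσ : σ ∈ monomialGroup F n) (v : Fin n → F) :
    hammingNorm (σ v) = hammingNorm v := by
  obtain ⟨α, π, rfl⟩ := exists_eq_monomialMap hσ
  rw [hammingNorm, hammingNorm]
  refine Finset.card_bij' (fun i _ => π⁻¹ i) (fun i _ => π i) ?_ ?_ ?_ ?_ <;>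
    simp [monomialMap_apply]

/-- Over `𝔽₃` the monomial maps are isometries, as `α² = 1` for all units `α`. -/
theorem dotProduct_monomialMap {n : ℕ} {σ : (Fin n → ZMod 3) ≃ₗ[ZMod 3] (Fin n → ZMod 3)}
    (hσ : σ ∈ monomialGroup (ZMod 3) n) (v w : Fin n → ZMod 3) : σ v ⬝ᵥ σ w = v ⬝ᵥ w := by
  obtain ⟨α, π, rfl⟩ := exists_eq_monomialMap hσ
  have h : ∀ a : (ZMod 3)ˣ, (a : ZMod 3) * a = 1 := by decide
  rw [dotProduct, dotProduct, ← Equiv.sum_comp π]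
  refine Finset.sum_congr rfl fun i _ => ?_
  have e : π⁻¹ (π i) = i := by simp
  simp only [monomialMap_apply, e]
  linear_combination v i * w i * h (α (π i))

theorem dualCode_map {n : ℕ} {σ : (Fin n → ZMod 3) ≃ₗ[ZMod 3] (Fin n → ZMod 3)}
    (hσ : σ ∈ monomialGroup (ZMod 3) n) (C : Submodule (ZMod 3) (Fin n → ZMod 3)) :
    dualCode (C.map (σ : (Fin n → ZMod 3) →ₗ[ZMod 3] (Fin n → ZMod 3))) =
      (dualCode C).map (σ : (Fin n → ZMod 3) →ₗ[ZMod 3] (Fin n → ZMod 3)) := by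
  ext v
  obtain ⟨w, rfl⟩ := σ.surjective v
  rw [← LinearEquiv.coe_coe, Submodule.map_equiv_eq_comap_symm]
  simp only [Submodule.map_equiv_eq_comap_symm, Submodule.mem_comap, LinearEquiv.coe_coe,
    LinearEquiv.symm_apply_apply]
  constructor
  · intro h c hc
    rw [← dotProduct_monomialMap hσ]
    exact h _ (by simpa using hc)
  · intro h c hc
    have := h (σ.symm c) (by simpa using hc)
    rw [← dotProduct_monomialMap hσ] at this
    simpa using this

theorem weight_ge_of_minDistance {F : Type*} [Field F] [DecidableEq F] {n : ℕ}
    {C : Submodule F (Fin n → F)} {d : ℕ} (h : minDistance C = d) {c : Fin n → F} (hc : c ∈ C)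
    (h0 : c ≠ 0) : d ≤ hammingNorm c :=
  h ▸ Nat.sInf_le ⟨c, hc, h0, rfl⟩

theorem dotProduct_eq_zero_of_mem {F : Type*} [Field F] {n : ℕ} {C : Submodule F (Fin n → F)}
    (hC : C = dualCode C) {c d : Fin n → F} (hc : c ∈ C) (hd : d ∈ C) : c ⬝ᵥ d = 0 := by
  rw [hC] at hd
  exact hd c hc

theorem mem_of_forall_dotProduct {F : Type*} [Field F] {n : ℕ} {C : Submodule F (Fin n → F)}
    (hC : C = dualCode C) {v : Fin n → F} (h : ∀ c ∈ C, c ⬝ᵥ v = 0) : v ∈ C := by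
  rw [hC]
  exact h

/-- A self-dual code without nonzero words supported in `S` takes arbitrary values on `S`. -/
theorem exists_mem_eqOn {F : Type*} [Field F] {n : ℕ} {C : Submodule F (Fin n → F)}
    (hC : C = dualCode C) (S : Set (Fin n)) (hS : ∀ c ∈ C, (∀ i ∉ S, c i = 0) → c = 0)
    (t : Fin n → F) : ∃ c ∈ C, ∀ i ∈ S, c i = t i := by
  classical
  let P : (Fin n → F) →ₗ[F] (S → F) := LinearMap.funLeft F F Subtype.val
  suffices h : C.map P = ⊤ by
    have : P t ∈ C.map P := by rw [h]; trivial
    obtain ⟨c, hc, hct⟩ := this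
    exact ⟨c, hc, fun i hi => congrFun hct ⟨i, hi⟩⟩
  by_contra h
  obtain ⟨f, hf, hfC⟩ := Submodule.exists_le_ker_of_lt_top _ (lt_top_iff_ne_top.mpr h)
  apply hf
  let z : Fin n → F := fun i => if hi : i ∈ S then f (Pi.single ⟨i, hi⟩ 1) else 0
  have hz : ∀ v, v ⬝ᵥ z = f (P v) := by
    intro v
    have e : P v = ∑ i : S, v i • Pi.single (M := fun _ : S => F) i 1 := by
      ext i
      simp [P, LinearMap.funLeft_apply, Finset.sum_apply, Pi.single_apply]
    rw [e, map_sum, dotProduct]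
    rw [← Finset.sum_subset (Finset.subset_univ (Finset.univ.filter (· ∈ S)))]
    · rw [Finset.sum_subtype (p := (· ∈ S)) _ (by simp)]
      refine Finset.sum_congr rfl fun i _ => ?_
      rw [map_smul, smul_eq_mul]
      simp [z]
    · intro i _ hi
      have : i ∉ S := by simpa using hi
      simp [z, this]
  have h0 : z = 0 := by
    refine hS z (mem_of_forall_dotProduct hC fun c hc => ?_) fun i hi => by simp [z, hi]
    rw [hz]
    exact hfC ⟨c, hc, rfl⟩
  refine LinearMap.pi_ext' fun i => ?_
  ext
  have := congrFun h0 i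
  simpa [z] using this

theorem finrank_of_eq_dualCode {F : Type*} [Field F] {n : ℕ} {C : Submodule F (Fin n → F)}
    (hC : C = dualCode C) : 2 * Module.finrank F C = n := by
  have e : dualCode C = C.dualAnnihilator.map ((dotProductEquiv F (Fin n)).symm :
      Module.Dual F (Fin n → F) →ₗ[F] (Fin n → F)) := by
    ext v
    rw [Submodule.map_equiv_eq_comap_symm, Submodule.mem_comap, Submodule.mem_dualAnnihilator]
    refine forall₂_congr fun c _ => ?_
    rw [dotProduct_comm]
    rfl
  have h := Subspace.finrank_add_finrank_dualAnnihilator_eq C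
  rw [← LinearEquiv.finrank_map_eq (dotProductEquiv F (Fin n)).symm, ← e, ← hC,
    Module.finrank_fin_fun] at h
  omega

/-! ### Words made of four circulant blocks and four further coordinates -/

namespace Circ

/-- The Hamming weight. -/
def weight (a : Circ) : ℕ := (Finset.univ.filter fun i => a i ≠ 0).card

end Circ

/-- The numbering of the 48 coordinates: block `p`, position `i` has number `11 p + i`, and the four
further coordinates come last. -/
def coordEquiv : (Fin 4 × ZMod 11) ⊕ Fin 4 ≃ Fin 48 :=
  (Equiv.sumCongr (finProdFinEquiv : Fin 4 × Fin 11 ≃ Fin (4 * 11)) (Equiv.refl (Fin 4))).trans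
    finSumFinEquiv

/-- The word of length 48 with blocks `b 0, …, b 3` and last four coordinates `r`. -/
def word (b : Fin 4 → Circ) (r : Fin 4 → ZMod 3) : Fin 48 → ZMod 3 := fun k =>
  Sum.elim (fun p : Fin 4 × ZMod 11 => b p.1 p.2) r (coordEquiv.symm k)

@[simp] theorem word_inl (b : Fin 4 → Circ) (r : Fin 4 → ZMod 3) (p : Fin 4) (i : ZMod 11) :
    word b r (coordEquiv (.inl (p, i))) = b p i := by
  simp [word]

@[simp] theorem word_inr (b : Fin 4 → Circ) (r : Fin 4 → ZMod 3) (j : Fin 4) :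
    word b r (coordEquiv (.inr j)) = r j := by
  simp [word]

theorem coord_cases {P : Fin 48 → Prop} (h1 : ∀ p i, P (coordEquiv (.inl (p, i))))
    (h2 : ∀ j, P (coordEquiv (.inr j))) (k : Fin 48) : P k := by
  obtain ⟨x, rfl⟩ := coordEquiv.surjective k
  rcases x with ⟨p, i⟩ | j
  · exact h1 p i
  · exact h2 j

theorem eq_word_iff (v : Fin 48 → ZMod 3) (b : Fin 4 → Circ) (r : Fin 4 → ZMod 3) :
    v = word b r ↔ (∀ p i, v (coordEquiv (.inl (p, i))) = b p i) ∧
      ∀ j, v (coordEquiv (.inr j)) = r j := by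
  constructor
  · rintro rfl
    simp
  · rintro ⟨h1, h2⟩
    funext k
    refine coord_cases (P := fun k => v k = word b r k) ?_ ?_ k
    · simpa using h1
    · simpa using h2

theorem exists_eq_word (v : Fin 48 → ZMod 3) : ∃ b r, v = word b r :=
  ⟨fun p => ⟨fun i => v (coordEquiv (.inl (p, i)))⟩, fun j => v (coordEquiv (.inr j)),
    (eq_word_iff ..).mpr ⟨fun _ _ => rfl, fun _ => rfl⟩⟩

theorem word_inj {b b' : Fin 4 → Circ} {r r' : Fin 4 → ZMod 3} :
    word b r = word b' r' ↔ b = b' ∧ r = r' := by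
  rw [eq_word_iff]
  constructor
  · rintro ⟨h1, h2⟩
    exact ⟨funext fun p => Circ.ext fun i => by simpa using h1 p i, funext fun j => by
      simpa using h2 j⟩
  · rintro ⟨rfl, rfl⟩
    simp

theorem word_zero : word 0 0 = 0 := by
  rw [eq_comm, eq_word_iff]
  simp

theorem word_eq_zero {b : Fin 4 → Circ} {r : Fin 4 → ZMod 3} :
    word b r = 0 ↔ b = 0 ∧ r = 0 := by
  rw [← word_zero, word_inj]

theorem word_add (b b' : Fin 4 → Circ) (r r' : Fin 4 → ZMod 3) :
    word b r + word b' r' = word (b + b') (r + r') := by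
  rw [eq_word_iff]
  simp

theorem word_sub (b b' : Fin 4 → Circ) (r r' : Fin 4 → ZMod 3) :
    word b r - word b' r' = word (b - b') (r - r') := by
  rw [eq_word_iff]
  simp

theorem word_smul (s : ZMod 3) (b : Fin 4 → Circ) (r : Fin 4 → ZMod 3) :
    s • word b r = word (s • b) (s • r) := by
  rw [eq_word_iff]
  simp

theorem sum_coord {M : Type*} [AddCommMonoid M] (f : Fin 48 → M) :
    ∑ k, f k = ∑ p, ∑ i, f (coordEquiv (.inl (p, i))) + ∑ j, f (coordEquiv (.inr j)) := by
  rw [← Equiv.sum_comp coordEquiv, Fintype.sum_sum_type, Fintype.sum_prod_type]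

theorem hammingNorm_word (b : Fin 4 → Circ) (r : Fin 4 → ZMod 3) :
    hammingNorm (word b r) = ∑ p, (b p).weight + hammingNorm r := by
  simp only [hammingNorm, Finset.card_filter, sum_coord, word_inl, word_inr, Circ.weight]

theorem word_dotProduct_word (b b' : Fin 4 → Circ) (r r' : Fin 4 → ZMod 3) :
    word b r ⬝ᵥ word b' r' = ∑ p, ∑ i, b p i * b' p i + r ⬝ᵥ r' := by
  simp only [dotProduct, sum_coord, word_inl, word_inr]

/-! ### Irreducible factors of `X¹¹ - 1` over `𝔽₃` -/

/-- The nontrivial irreducible factors of `X¹¹ - 1` over `𝔽₃` have degree 5, the order of 3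
modulo 11. -/
theorem natDegree_of_dvd_cyclotomic_eleven {p : (ZMod 3)[X]} (hp : Irreducible p)
    (h : p ∣ cyclotomic 11 (ZMod 3)) : p.natDegree = 5 := by
  have hc : Nat.Coprime 3 11 := by norm_num
  rw [natDegree_of_dvd_cyclotomic_of_irreducible (f := 1) (by simp) hc h hp]
  have : Fact (Nat.Prime 5) := ⟨by norm_num⟩
  apply orderOf_eq_prime
  · ext
    simp only [Units.val_pow_eq_pow_val, ZMod.coe_unitOfCoprime, Units.val_one]
    decide
  · intro h
    have := congrArg Units.val h
    rw [ZMod.coe_unitOfCoprime, Units.val_one] at this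
    revert this
    decide

theorem isCoprime_cyclotomic_eleven {p : (ZMod 3)[X]} (hp : p ≠ 0) (h : p.natDegree < 5) :
    IsCoprime p (cyclotomic 11 (ZMod 3)) := by
  refine EuclideanDomain.isCoprime_of_dvd (fun h0 => hp h0.1) fun z hz hz0 hzp hzc => ?_
  obtain ⟨q, hq, hqz⟩ := WfDvdMonoid.exists_irreducible_factor hz hz0
  have h5 := natDegree_of_dvd_cyclotomic_eleven hq (hqz.trans hzc)
  have := natDegree_le_of_dvd (hqz.trans hzp) hp
  omega

namespace Circ

/-- The polynomial `∑ fₖ Xᵏ` of degree at most 3, evaluated at the generator of the group. -/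
def ofCoeffs (f : Fin 4 → ZMod 3) : Circ := ∑ k : Fin 4, f k • shift (k : ℕ)

theorem aeval_cyclotomic : aeval (shift 1) (cyclotomic 11 (ZMod 3)) = J := by
  have : Fact (Nat.Prime 11) := ⟨by norm_num⟩
  rw [cyclotomic_prime, map_sum]
  simp only [map_pow, aeval_X, shift_pow, mul_one]
  decide

/-- A nonzero polynomial of degree at most 3 acts invertibly on the vectors of coordinate sum 0. -/
theorem exists_mul_ofCoeffs_mul {f : Fin 4 → ZMod 3} (hf : f ≠ 0) :
    ∃ a : Circ, ∀ d, aug d = 0 → a * (ofCoeffs f * d) = d := by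
  let p : (ZMod 3)[X] := ∑ k : Fin 4, C (f k) * X ^ (k : ℕ)
  have hcoeff : ∀ k : Fin 4, p.coeff k = f k := by
    intro k
    simp only [p, finsetSum_coeff, coeff_C_mul, coeff_X_pow]
    rw [Finset.sum_eq_single k] <;> simp +contextual [Fin.val_inj, eq_comm]
  have hp : p ≠ 0 := by
    intro h
    apply hf
    funext k
    rw [← hcoeff, h, coeff_zero]
    rfl
  have hdeg : p.natDegree < 5 := by
    refine lt_of_le_of_lt (natDegree_sum_le_of_forall_le (n := 3) _ _ fun k _ => ?_) (by norm_num)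
    exact (natDegree_C_mul_X_pow_le _ _).trans (by omega)
  obtain ⟨a, b, hab⟩ := isCoprime_cyclotomic_eleven hp hdeg
  have h := congrArg (aeval (shift 1)) hab
  have hpe : aeval (shift 1) p = ofCoeffs f := by
    simp [p, ofCoeffs, map_sum, shift_pow, Algebra.smul_def]
  rw [map_add, map_mul, map_mul, map_one, aeval_cyclotomic, hpe] at h
  refine ⟨aeval (shift 1) a, fun d hd => ?_⟩
  have hJ : J * d = 0 := by rw [mul_comm, mul_J, hd, zero_smul]
  calc aeval (shift 1) a * (ofCoeffs f * d)
      = (aeval (shift 1) a * ofCoeffs f + aeval (shift 1) b * J) * d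
          - aeval (shift 1) b * (J * d) := by ring
    _ = d := by rw [h, hJ, one_mul, mul_zero, sub_zero]

theorem ofCoeffs_mul_apply (f : Fin 4 → ZMod 3) (d : Circ) (i : ZMod 11) :
    (ofCoeffs f * d) i = ∑ k : Fin 4, f k * d (i - (k : ℕ)) := by
  simp [ofCoeffs, Finset.sum_mul, sum_apply, shift_mul_apply]

/-- A linear form on `𝔽₃⁴` takes nonzero values at no more than 54 points. -/
theorem card_linearForm_ne_zero_le : ∀ x : Fin 4 → ZMod 3,
    (Finset.univ.filter fun f : Fin 4 → ZMod 3 => ∑ k, f k * x k ≠ 0).card ≤ 54 := by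
  decide +kernel

/-- Each of the 11 coordinates is nonzero in at most 54 of the `3⁴` multiples. -/
theorem sum_weight_ofCoeffs_mul_le (d : Circ) :
    ∑ f : Fin 4 → ZMod 3, (ofCoeffs f * d).weight ≤ 11 * 54 := by
  simp only [weight, Finset.card_filter]
  rw [Finset.sum_comm]
  refine (Finset.sum_le_card_nsmul _ _ 54 fun i _ => ?_).trans (by simp)
  rw [← Finset.card_filter]
  simpa only [ofCoeffs_mul_apply] using card_linearForm_ne_zero_le fun k => d (i - (k : ℕ))

theorem le_sum_of_forall_ne_zero (g : (Fin 4 → ZMod 3) → ℕ) (hg : ∀ f, f ≠ 0 → 15 ≤ g f) :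
    1200 ≤ ∑ f, g f := by
  have h1 := Finset.card_nsmul_le_sum (Finset.univ.erase 0) g 15
    fun f hf => hg f (Finset.ne_of_mem_erase hf)
  rw [Finset.card_erase_of_mem (Finset.mem_univ _), Finset.card_univ, Fintype.card_fun,
    ZMod.card, Fintype.card_fin, smul_eq_mul] at h1
  exact h1.trans (Finset.sum_le_sum_of_subset (Finset.erase_subset _ _))

theorem eq_smul_J_of_shift {a : Circ} (h : shift 1 * a = a) : a = a 0 • J := by
  have key : ∀ k : ℕ, a (k : ℕ) = a 0 := by
    intro k
    induction k with
    | zero => simp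
    | succ k ih =>
      rw [← ih]
      conv_lhs => rw [← h, shift_mul_apply]
      push_cast
      simp
  ext i
  simpa using key i.val

end Circ

open Circ

/-! ### Extremal codes invariant under four 11-cycles -/

/-- Extremal self-dual codes of length 48 in the coordinates adapted to an automorphism of order 11:
the simultaneous cyclic shift of the four blocks is an automorphism, and its fixed code is generated
by the rows of `fixedGenerator`. -/
structure NormalCode (C : Submodule (ZMod 3) (Fin 48 → ZMod 3)) : Prop where
  selfDual : C = dualCode C
  weight : ∀ c ∈ C, c ≠ 0 → 15 ≤ hammingNorm c
  shift_mem : ∀ b r, word b r ∈ C → word (fun p => shift 1 * b p) r ∈ C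
  fixed_mem : ∀ i, word (Pi.single i J) (fixedRight i) ∈ C

/-- A shift invariant code is a module over the circulant ring, which acts on the last four
coordinates through the coordinate sum. -/
theorem word_mul_mem {C : Submodule (ZMod 3) (Fin 48 → ZMod 3)}
    (hC : ∀ b r, word b r ∈ C → word (fun p => shift 1 * b p) r ∈ C) {b : Fin 4 → Circ} {r : Fin 4 → ZMod 3} (h : word b r ∈ C) (a : Circ) :
    word (fun p => a * b p) (aug a • r) ∈ C := by
  have hs : ∀ k : ℕ, word (fun p => shift k * b p) r ∈ C := by
    intro k
    induction k with
    | zero => simpa [shift_zero] using h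
    | succ k ih =>
      have := hC _ _ ih
      simpa only [← mul_assoc, shift_mul_shift, add_comm (1 : ZMod 11), Nat.cast_succ] using this
  have e : word (fun p => a * b p) (aug a • r) =
      ∑ k : ZMod 11, a k • word (fun p => shift k * b p) r := by
    simp only [word_smul]
    have hsum : ∀ (s : Finset (ZMod 11)) (B : ZMod 11 → Fin 4 → Circ)
        (R : ZMod 11 → Fin 4 → ZMod 3),
        ∑ k ∈ s, word (B k) (R k) = word (∑ k ∈ s, B k) (∑ k ∈ s, R k) := by
      intro s B R
      induction s using Finset.induction_on with
      | empty => simp [word_zero]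
      | insert x s hx ih => rw [Finset.sum_insert hx, ih, Finset.sum_insert hx,
          Finset.sum_insert hx, word_add]
    rw [hsum, word_inj]
    constructor
    · funext p
      rw [Finset.sum_apply]
      conv_lhs => rw [eq_sum_smul_shift a, Finset.sum_mul]
      exact Finset.sum_congr rfl fun k _ => by rw [smul_mul_assoc]; rfl
    · rw [← Finset.sum_smul, aug]
  rw [e]
  refine Submodule.sum_mem _ fun k _ => Submodule.smul_mem _ _ ?_
  have := hs k.val
  rwa [ZMod.natCast_zmod_val] at this

namespace NormalCode

variable {C : Submodule (ZMod 3) (Fin 48 → ZMod 3)} (hC : NormalCode C)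
include hC

theorem mul_mem {b : Fin 4 → Circ} {r : Fin 4 → ZMod 3} (h : word b r ∈ C) (a : Circ) :
    word (fun p => a * b p) (aug a • r) ∈ C := word_mul_mem hC.shift_mem h a

theorem right_eq_zero {r : Fin 4 → ZMod 3} (h : word 0 r ∈ C) : r = 0 := by
  by_contra h0
  have h1 := hC.weight _ h fun h2 => h0 (word_eq_zero.mp h2).2
  rw [hammingNorm_word] at h1
  have h2 : hammingNorm r ≤ 4 := by simpa using hammingNorm_le_card_fintype (x := r)
  have h3 : ∀ p : Fin 4, ((0 : Fin 4 → Circ) p).weight = 0 := fun p => by simp [Circ.weight]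
  simp only [h3, Finset.sum_const_zero] at h1
  omega

/-- A nonzero word of the code is not supported in two of the blocks. After passing to block sums
zero, such a word generates at least `3⁴` words of length 22, which violates the Plotkin bound. -/
theorem two_blocks {p q : Fin 4} (hpq : p ≠ q) {b : Fin 4 → Circ} (h : word b 0 ∈ C)
    (hb : ∀ i, i ≠ p → i ≠ q → b i = 0) : b = 0 := by
  have hsum : ∀ g : Fin 4 → ℕ, (∀ i, i ≠ p → i ≠ q → g i = 0) → ∑ i, g i = g p + g q := by
    intro g hg
    rw [← Finset.sum_pair hpq]
    refine (Finset.sum_subset (Finset.subset_univ _) fun i _ hi => hg i ?_ ?_).symm <;>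
      · rintro rfl
        simp at hi
  -- If the shift fixes the word, it is constant on both blocks; `-1` is not a square modulo 3, so
  -- such a word is not orthogonal to itself.
  by_cases hd : (shift 1 - 1) * b p = 0 ∧ (shift 1 - 1) * b q = 0
  · have hc : ∀ x : Circ, (shift 1 - 1) * x = 0 → x = x 0 • J := fun x hx =>
      eq_smul_J_of_shift (by rw [sub_mul, one_mul, sub_eq_zero] at hx; exact hx)
    have h0 := dotProduct_eq_zero_of_mem hC.selfDual h h
    rw [word_dotProduct_word, ← Finset.sum_subset (Finset.subset_univ {p, q}),
      Finset.sum_pair hpq, hc _ hd.1, hc _ hd.2] at h0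
    · have key : ∀ x y : ZMod 3, 11 * (x * x) + 11 * (y * y) = 0 → x = 0 ∧ y = 0 := by decide
      have h1 := key (b p 0) (b q 0) (by simpa using h0)
      funext i
      by_cases hip : i = p
      · rw [hip, hc _ hd.1, h1.1, zero_smul]; rfl
      by_cases hiq : i = q
      · rw [hiq, hc _ hd.2, h1.2, zero_smul]; rfl
      exact hb i hip hiq
    · intro i _ hi
      have : b i = 0 := by
        apply hb <;>
        · rintro rfl
          simp at hi
      simp [this]
  · exfalso
    have hw : ∀ f : Fin 4 → ZMod 3, f ≠ 0 →
        15 ≤ (ofCoeffs f * ((shift 1 - 1) * b p)).weight +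
          (ofCoeffs f * ((shift 1 - 1) * b q)).weight := by
      intro f hf
      have hm := hC.mul_mem h (ofCoeffs f * (shift 1 - 1))
      rw [smul_zero] at hm
      have hne : word (fun p => ofCoeffs f * (shift 1 - 1) * b p) 0 ≠ 0 := by
        intro h0
        have h1 := (word_eq_zero.mp h0).1
        obtain ⟨a, ha⟩ := exists_mul_ofCoeffs_mul hf
        apply hd
        have h2 : ∀ p, (shift 1 - 1) * b p = 0 := by
          intro p
          have h3 := congrFun h1 p
          simp only [Pi.zero_apply, mul_assoc] at h3
          rw [← ha ((shift 1 - 1) * b p) (by simp), h3, mul_zero]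
        exact ⟨h2 p, h2 q⟩
      have := hC.weight _ hm hne
      rw [hammingNorm_word, hsum, hammingNorm_zero] at this
      · simpa only [mul_assoc, add_zero] using this
      · intro i h1 h2
        simp [hb i h1 h2, Circ.weight]
    have h1 := le_sum_of_forall_ne_zero _ hw
    rw [Finset.sum_add_distrib] at h1
    have h2 := sum_weight_ofCoeffs_mul_le ((shift 1 - 1) * b p)
    have h3 := sum_weight_ofCoeffs_mul_le ((shift 1 - 1) * b q)
    omega

end NormalCode

namespace Circ

/-! ### Norms in the circulant ring -/

/-- One of the two primitive idempotents of coordinate sum zero; its nonzero coefficients sit at `0`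
and at the nonresidues. -/
def idemN : Circ := ⟨![1, 0, 1, 0, 0, 0, 1, 1, 1, 0, 1]⟩

/-- The other primitive idempotent of coordinate sum zero; its nonzero coefficients sit at `0` and
at the squares. -/
def idemQ : Circ := ⟨![1, 1, 0, 1, 1, 1, 0, 0, 0, 1, 0]⟩

theorem star_idemN : star idemN = idemQ := by decide
theorem star_idemQ : star idemQ = idemN := by decide
theorem idemN_add_idemQ : idemN + idemQ = idem := by decide
theorem idemN_mul_self : idemN * idemN = idemN := by decide +kernel
theorem idemQ_mul_self : idemQ * idemQ = idemQ := by decide +kernel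
theorem idemN_mul_idemQ : idemN * idemQ = 0 := by decide +kernel
theorem aug_idemN : aug idemN = 0 := by decide
theorem idem_mul_self : idem * idem = idem := mul_idem aug_idem

theorem pow_eq_idem {n : Circ} (hn : aug n = 0) (h : ∀ m, aug m = 0 → n * m = 0 → m = 0) :
    n ^ 242 = idem := by
  have := h (n ^ 242 - idem) (by
    rw [aug_sub, aug_idem, sub_zero, pow_succ, aug_mul, hn, mul_zero])
  rw [← sub_eq_zero]
  apply this
  rw [mul_sub, ← pow_succ', pow_card_eq, mul_idem hn, sub_self]

/-- In terms of the two components of the ideal of coordinate sum zero, which are exchanged by the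
involution, an element `(s, t)` with norm `n = s t` is the product of `(t⁻¹, t)`, which has norm 1,
and `(n, 1)`. -/
theorem exists_eq_mul_of_norm {y n : Circ} (hy : aug y = 0) (hn : y * star y = n)
    (h : n ^ 242 = idem) :
    ∃ κ, aug κ = 0 ∧ κ * star κ = idem ∧ y = κ * (n * idemN + idemQ) := by
  have hs : star n = n := by rw [← hn, star_mul, star_star, mul_comm]
  set m := n ^ 241 with hm
  have hms : star m = m := by rw [hm, star_pow, hs]
  have hnm : n * m = idem := by rw [hm, ← pow_succ', h]
  have i1 := idemN_mul_self
  have i2 := idemQ_mul_self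
  have i3 := idemN_mul_idemQ
  have i4 := idemN_add_idemQ
  have i5 := mul_idem aug_idemN
  refine ⟨y * (m * idemN + idemQ), by rw [aug_mul, hy, zero_mul], ?_, ?_⟩
  · simp only [star_mul, star_add, hms, star_idemN, star_idemQ]
    calc y * (m * idemN + idemQ) * (star y * (m * idemQ + idemN))
        = (y * star y) * m * (idemN * idemN + idemQ * idemQ)
          + (y * star y) * (m ^ 2 + 1) * (idemN * idemQ) := by ring
      _ = idem := by rw [hn, i1, i2, i3, i4, hnm, mul_zero, add_zero, idem_mul_self]
  · calc y = y * idem := (mul_idem hy).symm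
      _ = y * (n * m * (idemN * idemN) + idemQ * idemQ + (m + n) * (idemN * idemQ)) := by
        rw [i1, i2, i3, hnm, mul_zero, add_zero, mul_comm idem, i5, i4]
      _ = _ := by ring

end Circ

namespace NormalCode

variable {C : Submodule (ZMod 3) (Fin 48 → ZMod 3)} (hC : NormalCode C)
include hC

/-! ### The first two rows of the code over the circulant ring -/

theorem sum_mul_star {b b' : Fin 4 → Circ} {r r' : Fin 4 → ZMod 3} (h : word b r ∈ C)
    (h' : word b' r' ∈ C) : ∑ p, b p * star (b' p) = -(r ⬝ᵥ r') • J := by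
  ext k
  have h1 := dotProduct_eq_zero_of_mem hC.selfDual h (hC.mul_mem h' (shift k))
  rw [word_dotProduct_word, aug_shift, one_smul] at h1
  rw [sum_apply]
  simp only [mul_star_apply, smul_apply, J_apply, mul_one]
  exact eq_neg_of_add_eq_zero_left h1

theorem aug_add_dotProduct {b : Fin 4 → Circ} {r : Fin 4 → ZMod 3} (h : word b r ∈ C) (i : Fin 4) :
    aug (b i) + fixedRight i ⬝ᵥ r = 0 := by
  have h1 := dotProduct_eq_zero_of_mem hC.selfDual (hC.fixed_mem i) h
  rw [word_dotProduct_word] at h1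
  rw [← h1, Finset.sum_eq_single i]
  · simp [aug]
  · intro p _ hp
    simp [hp]
  · simp

/-- The last four coordinates of a word are determined by the sums of the blocks. -/
theorem right_eq {b : Fin 4 → Circ} {r : Fin 4 → ZMod 3} (h : word b r ∈ C) :
    r = -∑ i, aug (b i) • fixedRight i := by
  have hH : fixedRight.transpose * fixedRight = 1 := by decide
  have h1 : fixedRight.mulVec r = -fun i => aug (b i) :=
    funext fun i => eq_neg_of_add_eq_zero_right (hC.aug_add_dotProduct h i)
  calc r = (fixedRight.transpose * fixedRight).mulVec r := by rw [hH, Matrix.one_mulVec]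
    _ = _ := by
      rw [← Matrix.mulVec_mulVec, h1, Matrix.mulVec_neg, Matrix.mulVec_transpose]
      congr 1

/-- A word of the code is prescribed on the first two blocks, and its last two blocks are brought to
coordinate sum zero by words of the fixed code. -/
theorem exists_row (v w : Circ) : ∃ x y, aug x = 0 ∧ aug y = 0 ∧
    word ![v, w, x, y] (-(aug v • fixedRight 0 + aug w • fixedRight 1)) ∈ C := by
  obtain ⟨c, hc, hcS⟩ := exists_mem_eqOn hC.selfDual
    {k | ∃ p i, k = coordEquiv (.inl (p, i)) ∧ p ≤ 1} (fun c hc h => by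
      obtain ⟨b, r, rfl⟩ := exists_eq_word c
      have hr : r = 0 := by
        funext j
        have := h (coordEquiv (.inr j)) (by simp)
        simpa using this
      subst hr
      have hb := hC.two_blocks (p := 0) (q := 1) (by decide) hc fun i h0 h1 => by
        ext k
        have hi : ¬ i ≤ 1 := by omega
        have := h (coordEquiv (.inl (i, k))) (by simp [hi])
        simpa using this
      rw [hb, word_zero]) (word ![v, w, 0, 0] 0)
  obtain ⟨b, r, rfl⟩ := exists_eq_word c
  have h0 : b 0 = v := by
    ext k
    have := hcS (coordEquiv (.inl (0, k))) ⟨0, k, rfl, by decide⟩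
    simpa using this
  have h1 : b 1 = w := by
    ext k
    have := hcS (coordEquiv (.inl (1, k))) ⟨1, k, rfl, by decide⟩
    simpa using this
  have h2 := C.add_mem (C.add_mem hc (C.smul_mem (aug (b 2)) (hC.fixed_mem 2)))
    (C.smul_mem (aug (b 3)) (hC.fixed_mem 3))
  rw [word_smul, word_smul, word_add, word_add] at h2
  have hr := hC.right_eq h2
  rw [hr] at h2
  refine ⟨b 2 + aug (b 2) • J, b 3 + aug (b 3) • J, by simp, by simp, ?_⟩
  convert h2 using 2
  · funext p
    fin_cases p <;> simp [h0, h1]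
  · simp [Fin.sum_univ_four, h0, h1]

end NormalCode

/-- `(1, 0, u, v)` is the first row of a generator matrix over the circulant ring. -/
structure HasFirstRow (C : Submodule (ZMod 3) (Fin 48 → ZMod 3)) (u v : Circ) : Prop where
  aug_left : aug u = 0
  aug_right : aug v = 0
  mem : word ![1, 0, u, v] (-fixedRight 0) ∈ C

/-- `(0, 1, u, v)` is the second row of a generator matrix over the circulant ring. -/
structure HasSecondRow (C : Submodule (ZMod 3) (Fin 48 → ZMod 3)) (u v : Circ) : Prop where
  aug_left : aug u = 0
  aug_right : aug v = 0
  mem : word ![0, 1, u, v] (-fixedRight 1) ∈ C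

namespace NormalCode

variable {C : Submodule (ZMod 3) (Fin 48 → ZMod 3)} (hC : NormalCode C)
include hC

theorem exists_firstRow : ∃ u v, HasFirstRow C u v := by
  obtain ⟨u, v, hu, hv, h⟩ := hC.exists_row 1 0
  exact ⟨u, v, hu, hv, by simpa using h⟩

theorem exists_secondRow : ∃ u v, HasSecondRow C u v := by
  obtain ⟨u, v, hu, hv, h⟩ := hC.exists_row 0 1
  exact ⟨u, v, hu, hv, by simpa using h⟩

/-- The first row is orthogonal to all its cyclic shifts. -/
theorem norm_add_norm {u v : Circ} (h : HasFirstRow C u v) :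
    u * star u + v * star v = -idem := by
  have h1 := hC.sum_mul_star h.mem h.mem
  have h2 : (-fixedRight 0 ⬝ᵥ -fixedRight 0 : ZMod 3) = 1 := by decide
  rw [h2] at h1
  simp [Fin.sum_univ_four] at h1
  rw [idem]
  linear_combination h1

/-- The second row is the first one multiplied by an element `κ` of norm 1, as in a quaternion
algebra. -/
theorem exists_second_eq {u v w z : Circ} (h : HasFirstRow C u v) (h' : HasSecondRow C w z) :
    ∃ κ, aug κ = 0 ∧ κ * star κ = idem ∧ w = κ * star v ∧ z = -(κ * star u) := by
  have h1 := hC.norm_add_norm h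
  have h2 : w * star w + z * star z = -idem := by
    have h1 := hC.sum_mul_star h'.mem h'.mem
    have h2 : (-fixedRight 1 ⬝ᵥ -fixedRight 1 : ZMod 3) = 1 := by decide
    rw [h2] at h1
    simp [Fin.sum_univ_four] at h1
    rw [idem]
    linear_combination h1
  have h3 : w * star u + z * star v = 0 := by
    have h1 := hC.sum_mul_star h'.mem h.mem
    have h2 : (-fixedRight 1 ⬝ᵥ -fixedRight 0 : ZMod 3) = 0 := by decide
    rw [h2] at h1
    simpa [Fin.sum_univ_four] using h1
  have hw := mul_idem h'.aug_left
  have hz := mul_idem h'.aug_right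
  have e1 : w = -(w * v - z * u) * star v := by
    linear_combination (-1 : Circ) * hw + w * h1 - u * h3
  have e2 : z = -(-(w * v - z * u) * star u) := by
    linear_combination (-1 : Circ) * hz + z * h1 - v * h3
  refine ⟨-(w * v - z * u), by simp [h.aug_left, h.aug_right], ?_, e1, e2⟩
  set κ := -(w * v - z * u)
  have hκ : aug κ = 0 := by simp [κ, h.aug_left, h.aug_right]
  have h4 : star w = star κ * v := by rw [e1, star_mul, star_star]
  have h5 : star z = -(star κ * u) := by rw [e2, star_neg, star_mul, star_star]
  have h6 := mul_idem hκ
  rw [h4, h5] at h2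
  have e1' : w = κ * star v := e1
  have e2' : z = -(κ * star u) := e2
  rw [e1', e2'] at h2
  linear_combination (-1 : Circ) * h2 + κ * star κ * h1 - star κ * h6

/-- The norm of `u` is a unit of the ideal of coordinate sum zero, since no nonzero multiple of the
first row is supported in two blocks. -/
theorem first_norm_cancel {u v : Circ} (h : HasFirstRow C u v) {m : Circ} (hm : aug m = 0)
    (h0 : u * star u * m = 0) : m = 0 := by
  have key : ∀ a : Circ, aug a = 0 → u * a = 0 → a = 0 := by
    intro a ha hu
    have h1 := hC.mul_mem h.mem a
    rw [ha, zero_smul] at h1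
    have h2 := hC.two_blocks (p := 0) (q := 3) (by decide) h1 fun i h0 h3 => by
      fin_cases i <;> simp_all [mul_comm a]
    simpa using congrFun h2 0
  have h1 := key (star u * m) (by simp [hm]) (by rw [← mul_assoc, h0])
  have h2 := key (star m) (by simp [hm]) (by
    rw [← star_star u, ← star_mul, h1, Circ.star_zero])
  rw [← star_star m, h2, Circ.star_zero]

/-- The norm of `v` is a unit of the ideal of coordinate sum zero, for the same reason as in
`first_norm_cancel`. -/
theorem second_norm_cancel {u v : Circ} (h : HasFirstRow C u v) {m : Circ} (hm : aug m = 0)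
    (h0 : v * star v * m = 0) : m = 0 := by
  have key : ∀ a : Circ, aug a = 0 → v * a = 0 → a = 0 := by
    intro a ha hu
    have h1 := hC.mul_mem h.mem a
    rw [ha, zero_smul] at h1
    have h2 := hC.two_blocks (p := 0) (q := 2) (by decide) h1 fun i h0 h3 => by
      fin_cases i <;> simp_all [mul_comm a]
    simpa using congrFun h2 0
  have h1 := key (star v * m) (by simp [hm]) (by rw [← mul_assoc, h0])
  have h2 := key (star m) (by simp [hm]) (by
    rw [← star_star v, ← star_mul, h1, Circ.star_zero])
  rw [← star_star m, h2, Circ.star_zero]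

/-- Both entries of the first row have the shape `κ (n, 1)` with `κ` of norm 1. -/
theorem exists_first_eq {u v n : Circ} (h : HasFirstRow C u v) (hn : u * star u = n) :
    ∃ κ μ, aug κ = 0 ∧ κ * star κ = idem ∧ aug μ = 0 ∧ μ * star μ = idem ∧
      u = κ * (n * idemN + idemQ) ∧ v = μ * ((-idem - n) * idemN + idemQ) := by
  have hn' : v * star v = -idem - n := by rw [← hC.norm_add_norm h, ← hn]; ring
  obtain ⟨κ, k1, k2, k3⟩ := exists_eq_mul_of_norm h.aug_left hn
    (pow_eq_idem (by simp [← hn, h.aug_left]) fun m hm h0 =>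
      hC.first_norm_cancel h hm (by rw [hn, h0]))
  obtain ⟨μ, m1, m2, m3⟩ := exists_eq_mul_of_norm h.aug_right hn'
    (pow_eq_idem (by simp [← hn', h.aug_right]) fun m hm h0 =>
      hC.second_norm_cancel h hm (by rw [hn', h0]))
  exact ⟨κ, μ, k1, k2, m1, m2, k3, m3⟩

end NormalCode

/-! ### Monomial maps compatible with the block structure -/

/-- The monomial map that sends block `p` to block `f p`, permuting the positions by
`i ↦ m i + c p` and multiplying by the sign `ε p`, and sends the `j`-th of the last four coordinates
to the `g j`-th with sign `δ j`. -/
def blockMonomial (m : (ZMod 11)ˣ) (c : Fin 4 → ZMod 11) (ε δ : Fin 4 → (ZMod 3)ˣ)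
    (f g : Equiv.Perm (Fin 4)) : (Fin 48 → ZMod 3) ≃ₗ[ZMod 3] (Fin 48 → ZMod 3) :=
  let π : Equiv.Perm (Fin 48) := coordEquiv.permCongr (Equiv.sumCongr
    (Equiv.prodShear f fun p => (Units.mulLeft m).trans (Equiv.addRight (c p))) g)
  monomialMap (fun k => Sum.elim (fun x => ε x.1) δ (coordEquiv.symm (π⁻¹ k))) π

theorem blockMonomial_mem (m : (ZMod 11)ˣ) (c : Fin 4 → ZMod 11) (ε δ : Fin 4 → (ZMod 3)ˣ)
    (f g : Equiv.Perm (Fin 4)) : blockMonomial m c ε δ f g ∈ monomialGroup (ZMod 3) 48 :=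
  monomialMap_mem _ _

theorem blockMonomial_word (m : (ZMod 11)ˣ) (c : Fin 4 → ZMod 11) (ε δ : Fin 4 → (ZMod 3)ˣ)
    (f g : Equiv.Perm (Fin 4)) (b : Fin 4 → Circ) (r : Fin 4 → ZMod 3) :
    blockMonomial m c ε δ f g (word b r) =
      word (fun p => (ε (f⁻¹ p) : ZMod 3) • (shift (c (f⁻¹ p)) * mult m (b (f⁻¹ p))))
        fun j => δ (g⁻¹ j) * r (g⁻¹ j) := by
  rw [eq_word_iff]
  refine ⟨fun p i => ?_, fun j => ?_⟩
  · have e : (coordEquiv.permCongr (Equiv.sumCongr (Equiv.prodShear f fun p =>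
        (Units.mulLeft m).trans (Equiv.addRight (c p))) g))⁻¹ (coordEquiv (.inl (p, i))) =
        coordEquiv (.inl (f⁻¹ p, ↑m⁻¹ * (i - c (f⁻¹ p)))) := by
      rw [Equiv.Perm.inv_eq_iff_eq]
      simp [Equiv.permCongr_apply, Equiv.prodShear]
    rw [blockMonomial, monomialMap_apply, e]
    simp [shift_mul_apply]
  · have e : (coordEquiv.permCongr (Equiv.sumCongr (Equiv.prodShear f fun p =>
        (Units.mulLeft m).trans (Equiv.addRight (c p))) g))⁻¹ (coordEquiv (.inr j)) =
        coordEquiv (.inr (g⁻¹ j)) := by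
      rw [Equiv.Perm.inv_eq_iff_eq]
      simp [Equiv.permCongr_apply]
    rw [blockMonomial, monomialMap_apply, e]
    simp

theorem mult_shift (m : (ZMod 11)ˣ) (k : ZMod 11) : mult m (shift k) = shift (m * k) := by
  ext i
  simp [shift_apply, Units.inv_mul_eq_iff_eq_mul]

theorem mult_J (m : (ZMod 11)ˣ) : mult m J = J := rfl

theorem shift_mul_J (k : ZMod 11) : shift k * J = J := by rw [mul_J, aug_shift, one_smul]

namespace NormalCode

variable {C : Submodule (ZMod 3) (Fin 48 → ZMod 3)} (hC : NormalCode C)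
include hC

theorem map_blockMonomial {m : (ZMod 11)ˣ} {c : Fin 4 → ZMod 11} {ε δ : Fin 4 → (ZMod 3)ˣ}
    {f g : Equiv.Perm (Fin 4)}
    (h : ∀ i j, (δ j : ZMod 3) * fixedRight i j = ε i * fixedRight (f i) (g j)) :
    NormalCode (C.map (blockMonomial m c ε δ f g :
      (Fin 48 → ZMod 3) →ₗ[ZMod 3] (Fin 48 → ZMod 3))) where
  selfDual := by rw [dualCode_map (blockMonomial_mem ..), ← hC.selfDual]
  weight := by
    rintro _ ⟨v, hv, rfl⟩ h0
    rw [LinearEquiv.coe_coe, hammingNorm_monomialMap (blockMonomial_mem ..)]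
    exact hC.weight v hv fun h1 => h0 (by rw [h1, map_zero])
  shift_mem := by
    rintro b r ⟨v, hv, e⟩
    obtain ⟨b', r', rfl⟩ := exists_eq_word v
    rw [LinearEquiv.coe_coe, blockMonomial_word, word_inj] at e
    obtain ⟨rfl, rfl⟩ := e
    refine ⟨_, hC.mul_mem hv (shift (↑m⁻¹)), ?_⟩
    rw [LinearEquiv.coe_coe, blockMonomial_word, word_inj]
    constructor
    · funext p
      rw [mult_mul, mult_shift, Units.mul_inv, mul_smul_comm, ← mul_assoc, ← mul_assoc,
        mul_comm (shift 1)]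
    · simp
  fixed_mem := by
    intro i
    have hf : (ε (f⁻¹ i) : ZMod 3) * ε (f⁻¹ i) = 1 := by
      generalize ε (f⁻¹ i) = a
      revert a
      decide
    refine ⟨_, C.smul_mem (ε (f⁻¹ i) : ZMod 3) (hC.fixed_mem (f⁻¹ i)), ?_⟩
    rw [LinearEquiv.coe_coe, map_smul, blockMonomial_word, word_smul, word_inj]
    constructor
    · funext p
      by_cases hp : p = i
      · subst hp
        simp only [Pi.smul_apply, Pi.single_eq_same, mult_J, shift_mul_J, smul_smul, hf, one_smul]
      · have : f⁻¹ p ≠ f⁻¹ i := fun h => hp (f⁻¹.injective h)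
        simp only [Pi.smul_apply, Pi.single_eq_of_ne hp, Pi.single_eq_of_ne this]
        ext k
        simp [shift_mul_apply]
    · funext j
      have := h (f⁻¹ i) (g⁻¹ j)
      have e1 : f (f⁻¹ i) = i := by simp
      have e2 : g (g⁻¹ j) = j := by simp
      rw [e1, e2] at this
      rw [Pi.smul_apply, this, smul_eq_mul, ← mul_assoc, hf, one_mul]

end NormalCode

/-- `C` is equivalent to a code with the given property, again in normal form. -/
def EquivNormal (C : Submodule (ZMod 3) (Fin 48 → ZMod 3))
    (P : Submodule (ZMod 3) (Fin 48 → ZMod 3) → Prop) : Prop :=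
  ∃ D, CodeEquivalent C D ∧ NormalCode D ∧ P D

theorem EquivNormal.bind {C : Submodule (ZMod 3) (Fin 48 → ZMod 3)}
    {P Q : Submodule (ZMod 3) (Fin 48 → ZMod 3) → Prop} (h : EquivNormal C P)
    (hPQ : ∀ D, NormalCode D → P D → EquivNormal D Q) : EquivNormal C Q := by
  obtain ⟨D, h1, h2, h3⟩ := h
  obtain ⟨E, k1, k2, k3⟩ := hPQ D h2 h3
  exact ⟨E, h1.trans k1, k2, k3⟩

theorem NormalCode.equivNormal {C : Submodule (ZMod 3) (Fin 48 → ZMod 3)} (hC : NormalCode C)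
    {m : (ZMod 11)ˣ} {c : Fin 4 → ZMod 11} {ε δ : Fin 4 → (ZMod 3)ˣ} {f g : Equiv.Perm (Fin 4)}
    (h : ∀ i j, (δ j : ZMod 3) * fixedRight i j = ε i * fixedRight (f i) (g j))
    {P : Submodule (ZMod 3) (Fin 48 → ZMod 3) → Prop}
    (hP : P (C.map (blockMonomial m c ε δ f g :
      (Fin 48 → ZMod 3) →ₗ[ZMod 3] (Fin 48 → ZMod 3)))) : EquivNormal C P :=
  ⟨_, ⟨_, blockMonomial_mem .., rfl⟩, hC.map_blockMonomial h, hP⟩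

namespace HasFirstRow

variable {C : Submodule (ZMod 3) (Fin 48 → ZMod 3)} {u v : Circ}

theorem map_mult (hC : NormalCode C) (h : HasFirstRow C u v) (m : (ZMod 11)ˣ) :
    EquivNormal C fun D => HasFirstRow D (mult m u) (mult m v) := by
  refine hC.equivNormal (m := m) (c := 0) (ε := 1) (δ := 1) (f := 1) (g := 1) (by simp)
    ⟨by rw [aug_mult, h.aug_left], by rw [aug_mult, h.aug_right], _, h.mem, ?_⟩
  rw [LinearEquiv.coe_coe, blockMonomial_word, word_inj]
  refine ⟨funext fun p => ?_, funext fun j => by simp⟩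
  have h0 : mult m 0 = 0 := rfl
  fin_cases p <;> simp [shift_zero, mult_one, h0]

theorem map_swap (hC : NormalCode C) (h : HasFirstRow C u v) :
    EquivNormal C fun D => HasFirstRow D v u := by
  refine hC.equivNormal (m := 1) (c := 0) (ε := 1) (δ := 1) (f := Equiv.swap 2 3)
    (g := Equiv.swap 2 3) (by decide) ⟨h.aug_right, h.aug_left, _, h.mem, ?_⟩
  rw [LinearEquiv.coe_coe, blockMonomial_word, word_inj]
  have h1 : ∀ x, mult 1 x = x := fun x => by ext i; simp
  refine ⟨funext fun p => ?_, by decide⟩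
  fin_cases p <;> simp [shift_zero, h1, Equiv.swap_apply_def]

theorem map_left (hC : NormalCode C) (s : (ZMod 3)ˣ) (k : ZMod 11) (h : HasFirstRow C u v) :
    EquivNormal C fun D => HasFirstRow D ((s : ZMod 3) • (shift k * u)) v := by
  have h1 : ∀ x, mult 1 x = x := fun x => by ext i; simp
  have hs : s = 1 ∨ s = -1 := by revert s; decide
  rcases hs with rfl | rfl
  · refine hC.equivNormal (m := 1) (c := ![0, 0, k, 0]) (ε := 1) (δ := 1) (f := 1) (g := 1)
      (by simp) ⟨by simp [h.aug_left], h.aug_right, _, h.mem, ?_⟩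
    rw [LinearEquiv.coe_coe, blockMonomial_word, word_inj]
    refine ⟨funext fun p => ?_, funext fun j => by simp⟩
    fin_cases p <;> simp [shift_zero, h1]
  · refine hC.equivNormal (m := 1) (c := ![0, 0, k, 0]) (ε := ![1, -1, -1, 1]) (δ := 1) (f := 1)
      (g := Equiv.swap 0 3 * Equiv.swap 1 2) (by decide)
      ⟨by simp [h.aug_left], h.aug_right, _, h.mem, ?_⟩
    rw [LinearEquiv.coe_coe, blockMonomial_word, word_inj]
    refine ⟨funext fun p => ?_, by decide⟩
    fin_cases p <;> simp [shift_zero, h1]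

theorem map_right (hC : NormalCode C) (s : (ZMod 3)ˣ) (k : ZMod 11) (h : HasFirstRow C u v) :
    EquivNormal C fun D => HasFirstRow D u ((s : ZMod 3) • (shift k * v)) :=
  (h.map_swap hC).bind fun _ hD h1 => (h1.map_left hD s k).bind fun _ hE h2 => h2.map_swap hE

end HasFirstRow

/-- A cyclic shift of the second block multiplies the second row by a group element, without
affecting the first row. -/
theorem HasSecondRow.map_shift {C : Submodule (ZMod 3) (Fin 48 → ZMod 3)} {u v w z : Circ}
    (hC : NormalCode C) (h : HasFirstRow C u v) (h' : HasSecondRow C w z) (k : ZMod 11) :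
    EquivNormal C fun D => HasFirstRow D u v ∧ HasSecondRow D (shift k * w) (shift k * z) := by
  have h1 : ∀ x, mult 1 x = x := fun x => by ext i; simp
  refine hC.equivNormal (m := 1) (c := ![0, -k, 0, 0]) (ε := 1) (δ := 1) (f := 1) (g := 1)
    (by simp) ⟨⟨h.aug_left, h.aug_right, _, h.mem, ?_⟩, by simp [h'.aug_left],
      by simp [h'.aug_right], _, hC.mul_mem h'.mem (shift k), ?_⟩
  · rw [LinearEquiv.coe_coe, blockMonomial_word, word_inj]
    refine ⟨funext fun p => ?_, funext fun j => by simp⟩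
    fin_cases p <;> simp [shift_zero, h1]
  · rw [LinearEquiv.coe_coe, blockMonomial_word, word_inj]
    refine ⟨funext fun p => ?_, funext fun j => by simp⟩
    fin_cases p <;> simp [shift_zero, h1, shift_mul_shift]

/-! ### Circulant arithmetic in packed natural numbers -/

/-- `256¹¹ - 1`, so that reduction modulo this number folds a product of two packed vectors to a
cyclic convolution. -/
def packMod : ℕ := 309485009821345068724781055

/-- The number `∑ gᵢ 256ⁱ` that packs the digits `g 0, …, g (k - 1)`. -/
def pack (k : ℕ) (g : ℕ → ℕ) : ℕ := ∑ i ∈ Finset.range k, g i * 256 ^ i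

theorem pack_succ (k : ℕ) (g : ℕ → ℕ) : pack (k + 1) g = g 0 + 256 * pack k fun i => g (i + 1) := by
  simp only [pack, Finset.sum_range_succ', pow_zero, mul_one, Finset.mul_sum]
  rw [add_comm]
  congr 1
  exact Finset.sum_congr rfl fun i _ => by ring

/-- The lowest `k` digits are reduced modulo 3. It is written with the recursor and the binary
functions of `Nat` so that the kernel evaluates it quickly. -/
def reduceDigits (k n : ℕ) : ℕ := Nat.rec (motive := fun _ => ℕ → ℕ) (fun _ => 0)
  (fun _ ih n => Nat.add (Nat.mod (Nat.mod n 256) 3) (Nat.mul 256 (ih (Nat.div n 256)))) k n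

/-- The number of digits, among the lowest `k`, that are nonzero modulo 3. -/
def countDigits (k n : ℕ) : ℕ := Nat.rec (motive := fun _ => ℕ → ℕ) (fun _ => 0)
  (fun _ ih n => Nat.add (Nat.div (Nat.add (Nat.mod (Nat.mod n 256) 3) 1) 2) (ih (Nat.div n 256)))
  k n

/-- The digits of `n` in base 3, repacked in base 256. -/
def spreadDigits (k n : ℕ) : ℕ := Nat.rec (motive := fun _ => ℕ → ℕ) (fun _ => 0)
  (fun _ ih n => Nat.add (Nat.mod n 3) (Nat.mul 256 (ih (Nat.div n 3)))) k n

theorem reduceDigits_succ (k n : ℕ) :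
    reduceDigits (k + 1) n = n % 256 % 3 + 256 * reduceDigits k (n / 256) := rfl

theorem countDigits_succ (k n : ℕ) :
    countDigits (k + 1) n = (n % 256 % 3 + 1) / 2 + countDigits k (n / 256) := rfl

theorem spreadDigits_succ (k n : ℕ) :
    spreadDigits (k + 1) n = n % 3 + 256 * spreadDigits k (n / 3) := rfl

theorem reduceDigits_pack (k : ℕ) : ∀ g : ℕ → ℕ, (∀ i, g i < 256) →
    reduceDigits k (pack k g) = pack k fun i => g i % 3 := by
  induction k with
  | zero => intro g _; rfl
  | succ k ih =>
    intro g hg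
    have h1 : pack (k + 1) g % 256 = g 0 := by
      rw [pack_succ, Nat.add_mul_mod_self_left, Nat.mod_eq_of_lt (hg 0)]
    have h2 : pack (k + 1) g / 256 = pack k fun i => g (i + 1) := by
      rw [pack_succ, Nat.add_mul_div_left _ _ (by norm_num), Nat.div_eq_of_lt (hg 0), zero_add]
    rw [reduceDigits_succ, h1, h2, ih _ fun i => hg (i + 1), ← pack_succ k fun i => g i % 3]

theorem countDigits_pack (k : ℕ) : ∀ g : ℕ → ℕ, (∀ i, g i < 256) →
    countDigits k (pack k g) = ((Finset.range k).filter fun i => g i % 3 ≠ 0).card := by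
  induction k with
  | zero => intro g _; rfl
  | succ k ih =>
    intro g hg
    have h1 : pack (k + 1) g % 256 = g 0 := by
      rw [pack_succ, Nat.add_mul_mod_self_left, Nat.mod_eq_of_lt (hg 0)]
    have h2 : pack (k + 1) g / 256 = pack k fun i => g (i + 1) := by
      rw [pack_succ, Nat.add_mul_div_left _ _ (by norm_num), Nat.div_eq_of_lt (hg 0), zero_add]
    rw [countDigits_succ, h1, h2, ih _ fun i => hg (i + 1), Finset.card_filter,
      Finset.card_filter, Finset.sum_range_succ', add_comm]
    congr 1
    split_ifs <;> omega

theorem spreadDigits_eq_pack (k : ℕ) : ∀ n, spreadDigits k n = pack k fun i => n / 3 ^ i % 3 := by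
  induction k with
  | zero => intro n; rfl
  | succ k ih =>
    intro n
    rw [spreadDigits_succ, ih, pack_succ, pow_zero, Nat.div_one]
    congr 2
    refine Finset.sum_congr rfl fun i _ => ?_
    dsimp only
    rw [Nat.div_div_eq_div_mul, pow_succ']

/-- `n` packs the vector `x`, possibly before folding modulo `packMod`, with digits at most `k`. -/
def Packs (n k : ℕ) (x : Circ) : Prop :=
  ∃ g : ZMod 11 → ℕ, (∀ i, g i ≤ k) ∧ (∀ i, (g i : ZMod 3) = x i) ∧
    n ≡ ∑ i, g i * 256 ^ i.val [MOD packMod]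

theorem sum_zmod_eq_sum_range {M : Type*} [AddCommMonoid M] (f : ZMod 11 → M) :
    ∑ i, f i = ∑ i ∈ Finset.range 11, f (i : ZMod 11) :=
  Finset.sum_nbij' ZMod.val Nat.cast (fun i _ => Finset.mem_range.mpr i.val_lt)
    (fun _ _ => Finset.mem_univ _) (fun i _ => ZMod.natCast_zmod_val i)
    (fun _ hi => ZMod.val_cast_of_lt (Finset.mem_range.mp hi))
    fun i _ => by rw [ZMod.natCast_zmod_val]

theorem sum_eq_pack (g : ZMod 11 → ℕ) :
    ∑ i, g i * 256 ^ i.val = pack 11 fun i => g (i : ZMod 11) := by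
  rw [pack, sum_zmod_eq_sum_range]
  refine Finset.sum_congr rfl fun i hi => ?_
  rw [ZMod.val_cast_of_lt (Finset.mem_range.mp hi)]

namespace Packs

variable {n n' k k' : ℕ} {x y : Circ}

theorem add (h : Packs n k x) (h' : Packs n' k' y) : Packs (n + n') (k + k') (x + y) := by
  obtain ⟨g, h1, h2, h3⟩ := h
  obtain ⟨g', k1, k2, k3⟩ := h'
  refine ⟨fun i => g i + g' i, fun i => add_le_add (h1 i) (k1 i), fun i => ?_, ?_⟩
  · rw [Nat.cast_add, h2, k2]; rfl
  · simp only [add_mul, Finset.sum_add_distrib]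
    exact h3.add k3

theorem mono (h : Packs n k x) (hk : k ≤ k') : Packs n k' x := by
  obtain ⟨g, h1, h2, h3⟩ := h
  exact ⟨g, fun i => (h1 i).trans hk, h2, h3⟩

theorem pow_val_add (i j : ZMod 11) :
    256 ^ i.val * 256 ^ j.val ≡ 256 ^ (i + j).val [MOD packMod] := by
  have h11 : 256 ^ 11 ≡ 1 [MOD packMod] := by decide +kernel
  rw [ZMod.val_add, ← pow_add]
  conv_lhs => rw [← Nat.div_add_mod (i.val + j.val) 11, pow_add, pow_mul]
  simpa using (h11.pow ((i.val + j.val) / 11)).mul_right (256 ^ ((i.val + j.val) % 11))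

theorem mul (h : Packs n k x) (h' : Packs n' k' y) : Packs (n * n') (11 * (k * k')) (x * y) := by
  obtain ⟨g, h1, h2, h3⟩ := h
  obtain ⟨g', k1, k2, k3⟩ := h'
  refine ⟨fun i => ∑ j, g j * g' (i - j), fun i => ?_, fun i => ?_, ?_⟩
  · refine (Finset.sum_le_card_nsmul _ _ (k * k') fun j _ => Nat.mul_le_mul (h1 _) (k1 _)).trans ?_
    simp
  · push_cast
    rw [Circ.mul_apply]
    exact Finset.sum_congr rfl fun j _ => by rw [h2, k2]
  · refine (h3.mul k3).trans ?_
    have e1 : (∑ i, g i * 256 ^ i.val) * ∑ i, g' i * 256 ^ i.val =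
        ∑ j, ∑ i, g j * g' (i - j) * (256 ^ j.val * 256 ^ (i - j).val) := by
      rw [Finset.sum_mul]
      refine Finset.sum_congr rfl fun j _ => ?_
      rw [Finset.mul_sum, ← Equiv.sum_comp (Equiv.subRight j)]
      exact Finset.sum_congr rfl fun i _ => by simp only [Equiv.subRight_apply]; ring
    have e2 : ∑ i, (∑ j, g j * g' (i - j)) * 256 ^ i.val =
        ∑ j, ∑ i, g j * g' (i - j) * 256 ^ i.val := by
      rw [Finset.sum_comm]
      exact Finset.sum_congr rfl fun i _ => Finset.sum_mul ..
    rw [e1, e2]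
    have hmod : ∀ (s : Finset (ZMod 11)) (a b : ZMod 11 → ℕ),
        (∀ i, a i ≡ b i [MOD packMod]) → ∑ i ∈ s, a i ≡ ∑ i ∈ s, b i [MOD packMod] := by
      intro s a b hab
      induction s using Finset.induction_on with
      | empty => rfl
      | insert i s hi ih => rw [Finset.sum_insert hi, Finset.sum_insert hi]; exact (hab i).add ih
    refine hmod _ _ _ fun j => hmod _ _ _ fun i => ?_
    have := pow_val_add j (i - j)
    rw [add_sub_cancel] at this
    exact this.mul_left _

theorem mod_eq {g : ZMod 11 → ℕ} (hg : ∀ i, g i ≤ 254)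
    (h : n ≡ ∑ i, g i * 256 ^ i.val [MOD packMod]) :
    n % packMod = pack 11 fun i => g (i : ZMod 11) := by
  rw [← sum_eq_pack]
  refine Eq.trans h (Nat.mod_eq_of_lt ?_)
  calc ∑ i, g i * 256 ^ i.val ≤ ∑ i : ZMod 11, 254 * 256 ^ i.val :=
        Finset.sum_le_sum fun i _ => Nat.mul_le_mul_right _ (hg i)
    _ < packMod := by decide +kernel

theorem reduce (h : Packs n 254 x) : Packs (reduceDigits 11 (n % packMod)) 2 x := by
  obtain ⟨g, h1, h2, h3⟩ := h
  rw [mod_eq h1 h3, reduceDigits_pack _ _ fun i => (h1 _).trans_lt (by norm_num)]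
  refine ⟨fun i => g i % 3, fun i => Nat.le_of_lt_succ (Nat.mod_lt _ (by norm_num)),
    fun i => by rw [ZMod.natCast_mod, h2], ?_⟩
  rw [sum_eq_pack]

theorem reduceDigits_eq (h : Packs n 254 x) :
    reduceDigits 11 (n % packMod) = pack 11 fun i => (x (i : ZMod 11)).val := by
  obtain ⟨g, h1, h2, h3⟩ := h
  rw [mod_eq h1 h3, reduceDigits_pack _ _ fun i => (h1 _).trans_lt (by norm_num)]
  refine Finset.sum_congr rfl fun i _ => ?_
  dsimp only
  rw [← h2, ZMod.val_natCast]

theorem countDigits_eq (h : Packs n 254 x) : countDigits 11 (n % packMod) = x.weight := by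
  obtain ⟨g, h1, h2, h3⟩ := h
  rw [mod_eq h1 h3, countDigits_pack _ _ fun i => (h1 _).trans_lt (by norm_num), Circ.weight,
    Finset.card_filter, Finset.card_filter, sum_zmod_eq_sum_range]
  refine Finset.sum_congr rfl fun i _ => ?_
  rw [← h2]
  have : g i % 3 ≠ 0 ↔ ((g i : ℕ) : ZMod 3) ≠ 0 := by
    rw [Ne, Ne, ZMod.natCast_eq_zero_iff, Nat.dvd_iff_mod_eq_zero]
  exact if_congr this rfl rfl

theorem unique (h : Packs n 254 x) (h' : Packs n 254 y) : x = y := by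
  obtain ⟨g, h1, h2, h3⟩ := h
  obtain ⟨g', k1, k2, k3⟩ := h'
  have e := (mod_eq h1 h3).symm.trans (mod_eq k1 k3)
  have key : ∀ (k : ℕ) (a b : ℕ → ℕ), (∀ i, a i < 256) → (∀ i, b i < 256) →
      pack k a = pack k b → ∀ i < k, a i = b i := by
    intro k
    induction k with
    | zero => intro a b _ _ _ i hi; omega
    | succ k ih =>
      intro a b ha hb hab i hi
      rw [pack_succ, pack_succ] at hab
      have ha0 := ha 0
      have hb0 := hb 0
      rcases i with _ | i
      · omega
      · exact ih (fun i => a (i + 1)) (fun i => b (i + 1)) (fun i => ha _) (fun i => hb _)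
          (by omega) i (by omega)
  ext i
  have := key 11 _ _ (fun i => (h1 _).trans_lt (by norm_num))
    (fun i => (k1 _).trans_lt (by norm_num)) e i.val (ZMod.val_lt i)
  simp only [ZMod.natCast_zmod_val] at this
  rw [← h2, ← k2, this]

/-- As `256 ≡ 1` modulo 3, the residue modulo 3 of a packed vector is its coordinate sum. -/
theorem natCast_eq_aug (h : Packs n k x) : (n : ZMod 3) = aug x := by
  obtain ⟨g, h1, h2, h3⟩ := h
  have h4 : n ≡ ∑ i, g i * 256 ^ i.val [MOD 3] := h3.of_dvd (by decide)
  rw [(ZMod.natCast_eq_natCast_iff _ _ _).mpr h4]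
  push_cast
  refine Finset.sum_congr rfl fun i _ => ?_
  have : (256 : ZMod 3) = 1 := by decide
  rw [h2, this, one_pow, mul_one]

theorem shift (i : ZMod 11) : Packs (256 ^ i.val) 1 (Circ.shift i) := by
  refine ⟨fun j => if j = i then 1 else 0, fun j => by dsimp only; split_ifs <;> simp, fun j => ?_, ?_⟩
  · rw [shift_apply]
    by_cases h : j = i <;> simp [h]
  · simp [Nat.ModEq]

theorem zero : Packs 0 0 0 := ⟨0, fun _ => le_rfl, fun _ => by simp, by simp [Nat.ModEq]⟩

end Packs

/-- The vector whose entries are the digits of `n` in base 3. -/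
def ofTernary (n : ℕ) : Circ := ⟨fun i => (n / 3 ^ i.val % 3 : ℕ)⟩

theorem packs_spreadDigits (n : ℕ) : Packs (spreadDigits 11 n) 2 (ofTernary n) := by
  refine ⟨fun i => n / 3 ^ i.val % 3, fun i => Nat.le_of_lt_succ (Nat.mod_lt _ (by norm_num)),
    fun i => rfl, ?_⟩
  · have h : spreadDigits 11 n = ∑ i : ZMod 11, n / 3 ^ i.val % 3 * 256 ^ i.val := by
      rw [spreadDigits_eq_pack, sum_eq_pack]
      refine Finset.sum_congr rfl fun i hi => ?_
      dsimp only
      rw [ZMod.val_cast_of_lt (Finset.mem_range.mp hi)]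
    rw [h]

/-! ### The elements of norm 1 -/

/-- Representatives of the elements `κ` with `κ κ* = idem` modulo `± gᵏ`, as ternary numbers. -/
def normOneCodes : List ℕ := [
  8636, 9386, 10636, 10646, 12350, 12604, 23138, 25172, 25718, 26104, 88574]

/-- The images of `normOneCodes` under the involution. -/
def normOneStarCodes : List ℕ := [
  109136, 154658, 163162, 130358, 32510, 110026, 165818, 134552, 90326, 102718, 88574]

/-- Whether `n` packs an element `± gᵏ κ` with `κ` in the list of representatives. -/
def isUnitMultiple (n : ℕ) : Bool :=
  normOneCodes.any fun a => (List.range 11).any fun k =>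
    Nat.beq n (reduceDigits 11 (Nat.mod (Nat.mul (Nat.pow 256 k) (spreadDigits 11 a)) packMod)) ||
    Nat.beq n (reduceDigits 11 (Nat.mod (Nat.mul 2
      (Nat.mul (Nat.pow 256 k) (spreadDigits 11 a))) packMod))

/-- For `n` packing a vector `x` of coordinate sum 0 and `r` packing its reversal `g¹⁰ x*`: if
`x x*` is the idempotent, then `x` is a listed element. The second test looks at one coefficient
only; it saves most of the work of the third one. The number in the latter packs `g¹⁰ idem`. -/
def normOneTest (n r : ℕ) : Bool :=
  !(Nat.beq (Nat.mod n 3) 0) ||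
  (!(Nat.beq (Nat.mod (Nat.mod (Nat.mod (Nat.mul n r) packMod) 256) 3) 1) ||
  (!(Nat.beq (reduceDigits 11 (Nat.mod (Nat.mul n r) packMod)) 2422592524796374542254337) ||
   isUnitMultiple n))

/-- Runs `normOneTest` over all ways to append `k` further digits; `w` is the place value of the
next digit in the reversed number. -/
def normOneSearch (k n r w : ℕ) : Bool :=
  Nat.rec (motive := fun _ => ℕ → ℕ → ℕ → Bool) (fun n r _ => normOneTest n r)
    (fun _ ih n r w => ih (Nat.mul 256 n) r (Nat.mul 256 w) &&
      (ih (Nat.add (Nat.mul 256 n) 1) (Nat.add r w) (Nat.mul 256 w) &&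
        ih (Nat.add (Nat.mul 256 n) 2) (Nat.add r (Nat.mul 2 w)) (Nat.mul 256 w))) k n r w

theorem normOneSearch_eq_true : normOneSearch 11 0 0 1 = true := by decide +kernel

theorem normOneTest_of_search (k : ℕ) : ∀ (n r w : ℕ), normOneSearch k n r w = true →
    ∀ g : ℕ → ℕ, (∀ i, g i ≤ 2) → normOneTest (256 ^ k * n + pack k g)
      (r + w * pack k fun i => g (k - 1 - i)) = true := by
  induction k with
  | zero =>
    intro n r w h g _
    simpa [pack] using (show normOneTest n r = true from h)
  | succ k ih =>
    intro n r w h g hg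
    have h' : (normOneSearch k (256 * n) r (256 * w) && (normOneSearch k (256 * n + 1) (r + w)
      (256 * w) && normOneSearch k (256 * n + 2) (r + 2 * w) (256 * w))) = true := h
    simp only [Bool.and_eq_true] at h'
    have e1 : pack (k + 1) g = pack k g + g k * 256 ^ k := Finset.sum_range_succ ..
    have e2 : (pack (k + 1) fun i => g (k + 1 - 1 - i)) =
        g k + 256 * pack k fun i => g (k - 1 - i) := by
      rw [pack_succ]
      congr 2
      refine Finset.sum_congr rfl fun i _ => ?_
      dsimp only
      rw [show k + 1 - 1 - (i + 1) = k - 1 - i by omega]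
    rw [e1, e2]
    have hk := hg k
    interval_cases hgk : g k
    · convert ih _ _ _ h'.1 g hg using 2 <;> ring
    · convert ih _ _ _ h'.2.1 g hg using 2 <;> ring
    · convert ih _ _ _ h'.2.2 g hg using 2 <;> ring

theorem exists_eq_of_isUnitMultiple {n : ℕ} {x : Circ} (hx : Packs n 2 x)
    (h : isUnitMultiple n = true) : ∃ (s : (ZMod 3)ˣ) (k : ZMod 11) (i : ℕ), i < 11 ∧
      x = (s : ZMod 3) • (shift k * ofTernary (normOneCodes.getD i 0)) := by
  obtain ⟨a, ha, h1⟩ := List.any_eq_true.mp h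
  obtain ⟨k, hk, h2⟩ := List.any_eq_true.mp h1
  obtain ⟨i, hi, rfl⟩ := List.getElem_of_mem ha
  have hk' : ((k : ZMod 11)).val = k := ZMod.val_cast_of_lt (List.mem_range.mp hk)
  have hp : Packs (256 ^ k * spreadDigits 11 normOneCodes[i]) 44
      (shift (k : ZMod 11) * ofTernary normOneCodes[i]) := by
    have := (Packs.shift (k : ZMod 11)).mul (packs_spreadDigits normOneCodes[i])
    rw [hk'] at this
    exact this.mono (by norm_num)
  have hx' := hx.mono (show 2 ≤ 254 by norm_num)
  have e : normOneCodes.getD i 0 = normOneCodes[i] := List.getD_eq_getElem _ _ hi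
  rcases Bool.or_eq_true_iff.mp h2 with h3 | h3
  · refine ⟨1, k, i, hi, ?_⟩
    rw [e, Units.val_one, one_smul]
    rw [Nat.eq_of_beq_eq_true h3] at hx'
    exact hx'.unique ((hp.mono (by norm_num)).reduce.mono (by norm_num))
  · refine ⟨-1, k, i, hi, ?_⟩
    rw [e]
    rw [Nat.eq_of_beq_eq_true h3] at hx'
    have h4 := hp.add hp
    rw [← two_mul] at h4
    rw [hx'.unique ((h4.mono (by norm_num)).reduce.mono (by norm_num))]
    ext j
    simp only [add_apply, smul_apply, Units.val_neg, Units.val_one]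
    generalize (shift (k : ZMod 11) * ofTernary normOneCodes[i]) j = y
    revert y
    decide

theorem packs_pack {g : ℕ → ℕ} {x : Circ} (hg : ∀ i, g i ≤ 2)
    (h : ∀ i < 11, (g i : ZMod 3) = x (i : ZMod 11)) : Packs (pack 11 g) 2 x := by
  refine ⟨fun i => g i.val, fun i => hg _, fun i => ?_, ?_⟩
  · rw [h _ i.val_lt, ZMod.natCast_zmod_val]
  · rw [sum_zmod_eq_sum_range]
    rw [pack]
    refine congrArg (· % packMod) (Finset.sum_congr rfl fun i hi => ?_)
    dsimp only
    rw [ZMod.val_cast_of_lt (Finset.mem_range.mp hi)]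

theorem exists_eq_normOneCode {κ : Circ} (h0 : aug κ = 0) (h : κ * star κ = idem) :
    ∃ (s : (ZMod 3)ˣ) (k : ZMod 11) (i : ℕ), i < 11 ∧
      κ = (s : ZMod 3) • (shift k * ofTernary (normOneCodes.getD i 0)) := by
  let g : ℕ → ℕ := fun i => (κ (i : ZMod 11)).val
  have hg : ∀ i, g i ≤ 2 := fun i => Nat.le_of_lt_succ (ZMod.val_lt _)
  have hp : Packs (pack 11 g) 2 κ := packs_pack hg fun i _ => ZMod.natCast_zmod_val _
  have hr : Packs (pack 11 fun i => g (10 - i)) 2 (shift 10 * star κ) :=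
    packs_pack (fun i => hg _) fun i hi => by
      rw [ZMod.natCast_zmod_val, shift_mul_apply, star_apply, neg_sub]
      push_cast [show i ≤ 10 by omega]
      rfl
  have ht := normOneTest_of_search 11 0 0 1 normOneSearch_eq_true g hg
  rw [mul_zero, zero_add, zero_add, one_mul] at ht
  change normOneTest (pack 11 g) (pack 11 fun i => g (10 - i)) = true at ht
  have hm : Packs (pack 11 g * pack 11 fun i => g (10 - i)) 44 (shift 10 * idem) := by
    have := hp.mul hr
    rw [mul_left_comm κ, h] at this
    exact this
  have htarget : reduceDigits 11 ((pack 11 g * pack 11 fun i => g (10 - i)) % packMod) =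
      2422592524796374542254337 := by
    have e : shift 10 * idem = ofTernary 147622 := by decide +kernel
    rw [(hm.mono (by norm_num)).reduceDigits_eq, e,
      ← ((packs_spreadDigits 147622).mono (by norm_num)).reduceDigits_eq]
    decide +kernel
  have h3 : pack 11 g % 3 = 0 := by
    have := hp.natCast_eq_aug
    rwa [h0, ZMod.natCast_eq_zero_iff, Nat.dvd_iff_mod_eq_zero] at this
  have h4 : (pack 11 g * pack 11 fun i => g (10 - i)) % packMod % 256 % 3 = 1 := by
    rw [reduceDigits_succ] at htarget
    omega
  rw [normOneTest] at ht
  apply exists_eq_of_isUnitMultiple hp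
  have e1 : Nat.beq (Nat.mod (pack 11 g) 3) 0 = true := Nat.beq_eq.mpr h3
  have e2 : Nat.beq (Nat.mod (Nat.mod (Nat.mod (Nat.mul (pack 11 g)
      (pack 11 fun i => g (10 - i))) packMod) 256) 3) 1 = true := Nat.beq_eq.mpr h4
  have e3 : Nat.beq (reduceDigits 11 (Nat.mod (Nat.mul (pack 11 g)
      (pack 11 fun i => g (10 - i))) packMod)) 2422592524796374542254337 = true := Nat.beq_eq.mpr htarget
  simpa only [e1, e2, e3, Bool.not_true, Bool.false_or] using ht

/-! ### The norms up to symmetry -/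

/-- Representatives of the possible norms `n ≠ 0, -idem` of the first entry of the code, up to the
automorphisms `g ↦ gʳ` for the squares `r` and up to `n ↦ -idem - n`, as ternary numbers. -/
def normCodes : List ℕ := [
  59053, 118106, 78746, 137796, 98436, 157489, 65642, 124692, 85332, 144385, 45972, 105025, 164078,
  131281, 91921, 150974, 81012, 140065, 100705, 159758, 87601, 146654, 107294, 166344, 88574]

/-- The squares modulo 11. -/
def squareUnits : List (ZMod 11)ˣ :=
  [1, ⟨3, 4, by decide, by decide⟩, ⟨9, 5, by decide, by decide⟩, ⟨5, 9, by decide, by decide⟩,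
    ⟨4, 3, by decide, by decide⟩]

/-- The symmetric vector of coordinate sum 0 with given coefficients at `1, …, 5`. -/
def symmetricVector (c : Fin 5 → ZMod 3) : Circ :=
  ⟨![c 0 + c 1 + c 2 + c 3 + c 4, c 0, c 1, c 2, c 3, c 4, c 4, c 3, c 2, c 1, c 0]⟩

theorem symmetricVector_cases : ∀ c : Fin 5 → ZMod 3, symmetricVector c = 0 ∨
    symmetricVector c = -idem ∨ ∃ r ∈ squareUnits, ∃ a ∈ normCodes,
      mult r (symmetricVector c) = ofTernary a ∨
        mult r (-idem - symmetricVector c) = ofTernary a := by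
  decide +kernel

theorem exists_normCode {n : Circ} (h0 : aug n = 0) (hs : star n = n) : n = 0 ∨ n = -idem ∨
    ∃ (r : (ZMod 11)ˣ) (a : ℕ), a < 25 ∧ (mult r n = ofTernary (normCodes.getD a 0) ∨
      mult r (-idem - n) = ofTernary (normCodes.getD a 0)) := by
  have hs' : ∀ i, n (-i) = n i := fun i => congrArg (fun x : Circ => x i) hs
  have e : n = symmetricVector ![n 1, n 2, n 3, n 4, n 5] := by
    have h6 : n 6 = n 5 := hs' 5
    have h7 : n 7 = n 4 := hs' 4
    have h8 : n 8 = n 3 := hs' 3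
    have h9 : n 9 = n 2 := hs' 2
    have h10 : n 10 = n 1 := hs' 1
    have hsum : n 0 + n 1 + n 2 + n 3 + n 4 + n 5 + n 6 + n 7 + n 8 + n 9 + n 10 = 0 := by
      rw [← h0, aug]
      have h (f : Fin 11 → ZMod 3) : f 0 + f 1 + f 2 + f 3 + f 4 + f 5 + f 6 + f 7 + f 8 + f 9 +
          f 10 = ∑ i, f i := by
        simp only [Fin.sum_univ_succ, Fin.sum_univ_zero, add_zero, ← add_assoc]
        rfl
      exact h n.coeff
    have h00 : n 0 = n 1 + n 2 + n 3 + n 4 + n 5 := by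
      rw [h6, h7, h8, h9, h10] at hsum
      have h3 : (3 : ZMod 3) = 0 := by decide
      linear_combination hsum - (n 1 + n 2 + n 3 + n 4 + n 5) * h3
    ext i
    fin_cases i
    exacts [h00, rfl, rfl, rfl, rfl, rfl, h6, h7, h8, h9, h10]
  rcases symmetricVector_cases ![n 1, n 2, n 3, n 4, n 5] with h | h | ⟨r, _, a, ha, h⟩
  · exact .inl (e.trans h)
  · exact .inr (.inl (e.trans h))
  · obtain ⟨k, hk, rfl⟩ := List.getElem_of_mem ha
    rw [← e] at h
    refine .inr (.inr ⟨r, k, hk, ?_⟩)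
    rwa [List.getD_eq_getElem _ _ hk]

/-! ### Light words -/

/-- The number of nonzero ones among the last four coordinates of a word whose blocks have the
given coordinate sums. -/
def rightCount (a b c d : ℕ) : ℕ :=
  Nat.add (Nat.add (Nat.div (Nat.add (Nat.mod (a + b + c + d) 3) 1) 2)
      (Nat.div (Nat.add (Nat.mod (a + b + 2 * c + 2 * d) 3) 1) 2))
    (Nat.add (Nat.div (Nat.add (Nat.mod (a + 2 * b + c + 2 * d) 3) 1) 2)
      (Nat.div (Nat.add (Nat.mod (a + 2 * b + 2 * c + d) 3) 1) 2))

theorem hammingNorm_right_eq (a : Fin 4 → ℕ) :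
    hammingNorm (-∑ i, (a i : ZMod 3) • fixedRight i) = rightCount (a 0) (a 1) (a 2) (a 3) := by
  have key : ∀ m : ℕ, (m % 3 + 1) / 2 = if (m : ZMod 3) ≠ 0 then 1 else 0 := by
    intro m
    by_cases h : m % 3 = 0
    · rw [if_neg (by rwa [not_not, ZMod.natCast_eq_zero_iff, Nat.dvd_iff_mod_eq_zero]), h]
    · rw [if_pos (by rwa [ne_eq, ZMod.natCast_eq_zero_iff, Nat.dvd_iff_mod_eq_zero])]
      omega
  have h2 : (2 : ZMod 3) = -1 := by decide
  change _ = (((a 0 + a 1 + a 2 + a 3) % 3 + 1) / 2 +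
    ((a 0 + a 1 + 2 * a 2 + 2 * a 3) % 3 + 1) / 2) +
    (((a 0 + 2 * a 1 + a 2 + 2 * a 3) % 3 + 1) / 2 + ((a 0 + 2 * a 1 + 2 * a 2 + a 3) % 3 + 1) / 2)
  simp only [key]
  rw [hammingNorm, Finset.card_filter, Fin.sum_univ_four, add_assoc]
  have e : ∀ j, (-∑ i, (a i : ZMod 3) • fixedRight i) j =
      -(a 0 * fixedRight 0 j + a 1 * fixedRight 1 j + a 2 * fixedRight 2 j +
        a 3 * fixedRight 3 j) := by
    intro j
    simp [Fin.sum_univ_four]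
  simp only [e, ne_eq, neg_eq_zero]
  push_cast
  rw [h2]
  simp only [fixedRight, Matrix.of_apply, Matrix.cons_val, mul_one, neg_one_mul, mul_neg,
    ← add_assoc]

/-- The packed all-ones vector. -/
def packJ : ℕ := 1213666705181745367548161

/-- The weight of the word with blocks packed by the given numbers, completed by the last four
coordinates that are forced on it. -/
def packedWeight (p q x y : ℕ) : ℕ :=
  Nat.add (Nat.add (countDigits 11 (Nat.mod p packMod)) (countDigits 11 (Nat.mod q packMod)))
    (Nat.add (Nat.add (countDigits 11 (Nat.mod x packMod)) (countDigits 11 (Nat.mod y packMod)))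
      (rightCount p q x y))

theorem NormalCode.le_packedWeight {C : Submodule (ZMod 3) (Fin 48 → ZMod 3)} (hC : NormalCode C)
    {b : Fin 4 → Circ} {r : Fin 4 → ZMod 3} (h : word b r ∈ C) (hb : b ≠ 0) {p q x y : ℕ}
    (h0 : Packs p 254 (b 0)) (h1 : Packs q 254 (b 1)) (h2 : Packs x 254 (b 2))
    (h3 : Packs y 254 (b 3)) : 15 ≤ packedWeight p q x y := by
  have hw := hC.weight _ h fun h0 => hb (word_eq_zero.mp h0).1
  have hr : r = -∑ i, ((![p, q, x, y] i : ℕ) : ZMod 3) • fixedRight i := by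
    rw [hC.right_eq h]
    simp [Fin.sum_univ_four, h0.natCast_eq_aug, h1.natCast_eq_aug, h2.natCast_eq_aug,
      h3.natCast_eq_aug]
  rw [hammingNorm_word, hr, hammingNorm_right_eq, Fin.sum_univ_four, ← h0.countDigits_eq,
    ← h1.countDigits_eq, ← h2.countDigits_eq, ← h3.countDigits_eq] at hw
  change _ ≤ (_ + _ : ℕ) + ((_ + _) + _)
  simp only [add_assoc] at hw ⊢
  exact hw

/-- Whether the multiple of the first row `(1, 0, U, V)` encoded by `t`, changed by multiples of the
all-ones vector in the last two blocks, has weight less than 15. The multiplier is given by the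
lowest 11 ternary digits of `t` (`177147 = 3¹¹`), the changes by the next two. -/
def firstRowLight (U V t : ℕ) : Bool :=
  let v := spreadDigits 11 (Nat.mod t 177147)
  let s := Nat.div t 177147
  !(Nat.beq v 0) && Nat.ble (packedWeight v 0 (Nat.add (Nat.mul U v) (Nat.mul (Nat.mod s 3) packJ))
    (Nat.add (Nat.mul V v) (Nat.mul (Nat.mod (Nat.div s 3) 3) packJ))) 14

/-- Whether the combination of the rows `(1, 0, U, V)` and `(0, 1, W, Z)` encoded by `t`, changed by
multiples of the all-ones vector in the last two blocks, has weight less than 15. Each multiplier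
takes 11 ternary digits of `t` (`31381059609 = 3²²`), the changes the next two. -/
def twoRowsLight (U V W Z t : ℕ) : Bool :=
  let v := spreadDigits 11 (Nat.mod t 177147)
  let w := spreadDigits 11 (Nat.mod (Nat.div t 177147) 177147)
  let s := Nat.div t 31381059609
  (!(Nat.beq v 0) || !(Nat.beq w 0)) && Nat.ble (packedWeight v w
    (Nat.add (Nat.add (Nat.mul U v) (Nat.mul W w)) (Nat.mul (Nat.mod s 3) packJ))
    (Nat.add (Nat.add (Nat.mul V v) (Nat.mul Z w)) (Nat.mul (Nat.mod (Nat.div s 3) 3) packJ))) 14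

theorem ofTernary_ne_zero {t : ℕ} (h : spreadDigits 11 t ≠ 0) : ofTernary t ≠ 0 := by
  intro h0
  have h1 := packs_spreadDigits t
  rw [h0] at h1
  have e : spreadDigits 11 t = pack 11 fun i => t / 3 ^ i % 3 := spreadDigits_eq_pack ..
  apply h
  rw [e, pack]
  refine Finset.sum_eq_zero fun i hi => ?_
  have h2 := congrArg (fun x : Circ => x (i : ZMod 11)) h0
  have h3 : ((t / 3 ^ i % 3 : ℕ) : ZMod 3) = 0 := by
    simpa [ofTernary, ZMod.val_cast_of_lt (Finset.mem_range.mp hi)] using h2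
  rw [ZMod.natCast_eq_zero_iff] at h3
  have : t / 3 ^ i % 3 = 0 := by omega
  rw [this, zero_mul]

theorem packs_smul_packJ (s : ℕ) : Packs (s % 3 * packJ) 2 (((s % 3 : ℕ) : ZMod 3) • J) := by
  refine ⟨fun _ => s % 3, fun _ => Nat.le_of_lt_succ (Nat.mod_lt _ (by norm_num)),
    fun _ => by simp, ?_⟩
  rw [← Finset.mul_sum]
  refine Nat.ModEq.mul_left _ ?_
  have h : packJ = ∑ i : ZMod 11, 256 ^ i.val := by decide +kernel
  rw [h]

namespace NormalCode

variable {C : Submodule (ZMod 3) (Fin 48 → ZMod 3)} (hC : NormalCode C)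
include hC

/-- The words of the code spanned by the two rows and the fixed code. -/
theorem combination_mem {u v w z : Circ} (h1 : HasFirstRow C u v) (h2 : HasSecondRow C w z)
    (a b : Circ) (s t : ZMod 3) : ∃ r, word ![a, b, u * a + w * b + s • J,
      v * a + z * b + t • J] r ∈ C := by
  have h := C.add_mem (C.add_mem (hC.mul_mem h1.mem a) (hC.mul_mem h2.mem b))
    (C.add_mem (C.smul_mem s (hC.fixed_mem 2)) (C.smul_mem t (hC.fixed_mem 3)))
  rw [word_smul, word_smul, word_add, word_add, word_add] at h
  refine ⟨_, (congrArg (· ∈ C) ((word_inj (r := _) (r' := _)).mpr ⟨funext fun p => ?_, rfl⟩)).mp h⟩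
  fin_cases p <;> simp [mul_comm a, mul_comm b]

theorem not_firstRowLight {u v w z : Circ} (h1 : HasFirstRow C u v) (h2 : HasSecondRow C w z)
    {U V : ℕ} (hU : Packs U 2 u) (hV : Packs V 2 v) (t : ℕ) : firstRowLight U V t = false := by
  by_contra h
  rw [Bool.not_eq_false, firstRowLight] at h
  simp only [Bool.and_eq_true, Bool.not_eq_true', Nat.ble_eq] at h
  have hv := Nat.ne_of_beq_eq_false h.1
  have p1 := packs_spreadDigits (Nat.mod t 177147)
  obtain ⟨r, hr⟩ := hC.combination_mem h1 h2 (ofTernary (Nat.mod t 177147)) 0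
    ((Nat.div t 177147 % 3 : ℕ) : ZMod 3) ((Nat.div t 177147 / 3 % 3 : ℕ) : ZMod 3)
  have := hC.le_packedWeight hr (fun h0 => ofTernary_ne_zero hv (congrFun h0 0))
    (p1.mono (by norm_num)) (Packs.zero.mono (by norm_num))
    (by
      simp only [Matrix.cons_val, mul_zero, add_zero]
      exact ((hU.mul p1).add (packs_smul_packJ _)).mono (by norm_num))
    (by
      simp only [Matrix.cons_val, mul_zero, add_zero]
      exact ((hV.mul p1).add (packs_smul_packJ _)).mono (by norm_num))
  exact absurd (this.trans h.2) (by norm_num)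

theorem not_twoRowsLight {u v w z : Circ} (h1 : HasFirstRow C u v) (h2 : HasSecondRow C w z)
    {U V W Z : ℕ} (hU : Packs U 2 u) (hV : Packs V 2 v) (hW : Packs W 2 w) (hZ : Packs Z 2 z)
    (t : ℕ) : twoRowsLight U V W Z t = false := by
  by_contra h
  rw [Bool.not_eq_false, twoRowsLight] at h
  simp only [Bool.and_eq_true, Bool.or_eq_true, Bool.not_eq_true', Nat.ble_eq] at h
  have p1 := packs_spreadDigits (Nat.mod t 177147)
  have p2 := packs_spreadDigits (Nat.mod (Nat.div t 177147) 177147)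
  obtain ⟨r, hr⟩ := hC.combination_mem h1 h2 (ofTernary (Nat.mod t 177147))
    (ofTernary (Nat.mod (Nat.div t 177147) 177147))
    ((Nat.div t 31381059609 % 3 : ℕ) : ZMod 3) ((Nat.div t 31381059609 / 3 % 3 : ℕ) : ZMod 3)
  have := hC.le_packedWeight hr (fun h0 => h.1.elim
      (fun hv => ofTernary_ne_zero (Nat.ne_of_beq_eq_false hv) (congrFun h0 0))
      (fun hw => ofTernary_ne_zero (Nat.ne_of_beq_eq_false hw) (congrFun h0 1)))
    (p1.mono (by norm_num)) (p2.mono (by norm_num))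
    (((hU.mul p1).add (hW.mul p2)).add (packs_smul_packJ _) |>.mono (by norm_num))
    (((hV.mul p1).add (hZ.mul p2)).add (packs_smul_packJ _) |>.mono (by norm_num))
  exact absurd (this.trans h.2) (by norm_num)

end NormalCode

/-! ### The search through the generator matrices -/

/-- Test words for the first row, in the encoding of `firstRowLight`. -/
def firstRowTests : List ℕ := [
  118827, 118341, 124659, 120285, 61479, 137781, 65853, 60021, 67797, 78975, 80919, 59859, 65691,
  61317, 78813, 61965, 79461, 85293, 122742, 131976, 1541835, 236196, 129060, 133434, 123444,
  164268, 102816, 142182, 66339, 121770, 122724, 100116, 120474, 139266, 415530, 63936, 73656,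
  99954, 133650, 63612, 72738, 121986, 132192, 151146, 159894, 238383, 122580, 158220, 1358856,
  151632, 1023516, 76572, 99900, 129762, 133488, 142236, 157788, 413586, 1010394, 1364688, 123282,
  129276, 134136, 159678, 656343, 73710, 98928, 111618, 120852, 131544, 158274, 833247, 61074,
  102870, 120798, 125226, 126144, 139320, 153090, 164754, 419904, 846369, 474822, 63990, 1004562,
  1554957, 1123632, 1161540, 276291, 654156, 308448, 669951, 76626, 1146717, 111780, 492885,
  413343, 592677, 610173, 1141614, 1537461, 947700, 277749, 1185597, 1304937, 77274, 433539,
  112266, 119394, 131490, 132030, 150984, 157734, 1045629, 160380, 414072, 591219, 417960, 418446,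
  774279, 426708, 428652, 1319490, 654642, 1043442, 335340, 64962, 65124, 72684, 475335, 121824,
  129114, 1549368, 512271, 236439, 1124118, 597051, 255879, 1536003, 1377810, 1299888, 592191,
  417744, 594945, 241299, 1127034, 1305720, 249399, 427194, 787401, 1318842, 787563, 1319004,
  1496637, 789507, 630099, 1162026, 454896, 632043, 990711, 296055, 473202, 650511, 296946, 474606,
  1183410, 298161, 475308, 1538190, 479034, 1187784, 658287, 485757, 310554, 315171, 494262,
  675783, 334692, 689148, 689634, 1222533, 1226907, 1301103, 949671, 772578, 782244, 963009,
  624024, 807516, 1340145, 998001, 123228, 833814, 1365255, 479709, 1189971, 1369089, 486081,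
  138294, 1025055, 1379349, 1027971, 1397817, 158436, 1576854, 590490, 1121931, 1122660, 1535517,
  1006020, 768609, 945756, 1477197, 237735, 414882, 946485, 947214, 1478655, 1301994, 594891,
  772038, 240813, 595593, 951588, 1483029, 953532, 426546, 603693, 249561, 604341, 1135782, 251505,
  965196, 1515834, 453438, 630585, 1004643, 1181790, 473364, 827658, 1181952, 1536246, 296784,
  473931, 651078, 1182681, 651753, 1360341, 297513, 297675, 652455, 1183896, 299646, 476793,
  653940, 1185381, 476847, 1539891, 477495, 1187622, 1364931, 485595, 662742, 839889, 308610,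
  662904, 1194345, 1200744, 1200906, 315657, 498636, 1207224, 512001, 512487, 866781, 1398222,
  518319, 1478250, 238950, 240840, 772281, 418041, 595674, 243081, 598023, 421389, 1484271, 422820,
  1132947, 247374, 250290, 428895, 606528, 1137969, 785160, 1316601, 433836, 966168, 1144044,
  437481, 260496, 440316, 1516563, 277830, 1164213, 988551, 988605, 1520046, 1351647, 1528794,
  473445, 1006533, 1006587, 831312, 1362753, 831330, 477279, 1185921, 300429, 1009017, 301104,
  478251, 1542402, 834732, 126360, 481869, 1014795, 1549152, 1372221, 1019169, 310635, 1550664,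
  842724, 667278, 1198719, 847908, 1202931, 1026432, 850770, 1382211, 142398, 1382913, 1560060,
  335124, 867024, 1398465, 1579743, 1050489, 525609]

/-- Test words for both rows, in the encoding of `twoRowsLight`. -/
def twoRowsTests : List ℕ := [
  21308126895, 21049846569, 22082967873, 20963753127, 10603842273, 11636963577, 10890820413,
  24407490807, 11665661391, 125653437648, 156991450536, 126686558952, 125538646392, 177826063500,
  15109399071, 219677042250, 129011081886, 251177676084, 125524474632, 251050130244, 251062884828,
  251091582642, 26775060462, 219925756638, 251048713068, 254535320322, 261508889124, 157163637420,
  251049067362, 221991999246, 219670664958, 135984650688, 156934054908, 240588182718, 21609453942,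
  220442317290, 219668539194, 23302624968, 252210797388, 156905711388, 251053318890, 156908545740,
  163878925896, 219667830606, 10470056922, 219696174126, 251435956410, 28037764278, 125567344206,
  251134649046, 156906419976, 157335824304, 158067619290, 10470037482, 23379152472, 223154437860,
  132501054933, 33601068, 21743377074, 125911717974, 147607206309, 220055073948, 132497866530,
  157292778312, 20922425388, 223155855036, 223168609620, 125527505814, 6973866234, 17662212,
  10546584426, 21740188428, 125611453809, 251823377142, 156905536428, 219669077196, 156906971100,
  3487965624, 2338992126, 1163462130, 1248492690, 10819075878, 157680198072, 253459152297,
  125533863666, 156910140792, 251048892402, 52731000, 29367036, 251078296617, 6973864290,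
  6975281466, 775136952, 789308712, 8135950554, 5261922, 6978476430, 2086398, 251823731193,
  66335056110, 271978808265, 156948404058, 158067638244, 10463660190, 138824928, 3572996670,
  3745189386, 251080422381, 147219844869, 156906952146, 167365712484, 387893124, 6974218584,
  24407609148, 1004562, 1191078108, 3487966110, 30412422, 1248479568, 2367694314, 20921362506,
  178988265918, 241750385136, 251049953097, 157297560552, 127849883301, 125524653966, 160392143682,
  125525366928, 117431454888, 132447150, 775136466, 22083088158, 219753569754, 181312788852,
  125537052069, 251086799673, 156948580962, 219798210798, 62894507076, 97716115719, 69778793790,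
  41927565303, 170852494698, 233614613916, 258022111284, 146445023574, 188329522716, 14076277767,
  226642110183, 125911722591, 125525905173, 251049107457, 12784996422, 20935175598, 2339009622,
  156991529349, 125529159915, 21408569244, 198746710857, 125524828926, 63149598756, 31390861743,
  12813633, 31640993307, 126385231905, 32285099799, 160406490402, 271969244514, 251306835930,
  94143834927, 251101680021, 125741125413, 126213045021, 157681083807, 226693657773, 226642108725,
  177829252875, 219968863137, 220829810679, 220054995297, 94146426522, 62776527174, 32543380125,
  31386255921, 94148375139, 29819745, 94230925641, 125656626294, 258693669, 188677025838,
  220069245708, 189061434828, 220834520748, 65101050108, 274293765261, 125913666591, 258151776327]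

/-- The digit in base 1024 at position `j` of the entry `(n, i)` is a test word, counted from 1, for
the first row with index `(n, i, j)`; it is 0 if there is none. -/
def firstRowTable : List (List ℕ) := [
  [0x30880008403278a6180220841e, 0x551101b0105500809008040242e, 0xa050650841400844008140841e,
   0x5c02c0b07c7c170091f01f02400, 0x5502c0b01055008180080412423, 0x7a02c0100008020011e82229801,
   0x30890a0840316400180220841e, 0xa42c010846719c010280002401, 0x302c0b0000302018028140c481,
   0x130884904c08008d20082204c1e, 0x322c1b04c03020090280002481],
  [0x840655946c200600a02c460280b, 0x7020c06320480181e0f03c09800, 0x3ec020087b0081b3200200802,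
   0x10040100404004030100100401, 0x841b4060003b01815054150ecc1, 0x1a00000068c71285a02c7011c0b,
   0x1a20c1b02409568080800811d21, 0x6441024090004131c461b419, 0x300c0300c0f00c0303c0e03803,
   0xb400002008c20081836c0200802, 0x300c0300c0f00c0303c0e03803],
  [0x3b040500340f140100500d04050, 0x1c0704c13158101d8760406f, 0x4401c0709414094440502511025,
   0x490902404c13014240904912405, 0x1d0d4ab00c030d43500c4907502, 0x1d0a0cb074280a03507428074cb,
   0x1d0a10500c030a04400c2807468, 0x110cc6f394140145b0501100005, 0x2008060080f0080c008a100806,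
   0x2008060080f0085b0080d00806, 0x110fc3f04c0f0440c030110ec3f],
  [0x2f0081104402008d40607806079, 0x41008b62f802008010c0010c030, 0x1b0087d06c0200899040990c010,
   0x70087d01c020080701c0701c07, 0x500805014020080501405014f0, 0x3008b32e402008010c00100c30,
   0x2f0082f0bc02008012f80116910, 0x10040100401004010040100401, 0x30080601802008010180100c06,
   0x10040100401004010040100401, 0x30082f0bc02008014cc0100ca3],
  [0xf030040107c0240c0e00b0300c, 0x10b8040102e3d0615180b11461, 0xf170040100d0240d0340b1140d,
   0x10080c00002024030e00b03003, 0x10080003402024030340b11403, 0x1008002a802024160000b11416,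
   0x108c0401023024160e0aa57416, 0xfe0b8040102e024fc0e0470c400, 0xa004010352f400154bd22c00,
   0xfd08c0401023118000e00b0c4b4, 0x1008f300002024160e00b00016],
  [0x1e10c0502c1e0143d2ec050142f, 0x132d83a20c37100bf0dc1000011, 0x2b0ac2b0ac2b0ac02008300ac11,
   0x2d0b42d0b42d0b402008100b42f, 0x71800702c0749c02008104a007, 0xa310803108031a4691a41000c11,
   0xcd02405318cd014020080501411, 0x342103a2c400050342ec100f411, 0x1300405004520140f03c0501411,
   0x700407004070500f03c1015807, 0x70240710c07078bf0dc3007807],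
  [0x20080a008022bcaf5400200803, 0xd0180a0500c0c4140c40701803, 0xd001471000c0dc370c8ef0dc03,
   0x18020150140c0d808044150540e, 0x2b020132e00c0d8080c81304c03, 0x2008a400802304082900200803,
   0xd0f43d4440c0d9530f43400003, 0xd0500a0502d0d8140c8ba02803, 0xd018130140c1b8080c81301803,
   0x20081d008020b81d0b8020080e, 0xd0540a0ec1b0403b0c8070280e],
  [0xf04c1401405004eb0143b0a00f, 0x1d0285b0292b0790c0740a2800a, 0x162840001405004000143b00016,
   0x300c0300c03004031948100c03, 0x828808280ca0791d0201d0201d, 0x44b01400004004042602531404,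
   0xf04c140d491004070540701c0f, 0x404d1a5500400404090d300004, 0x60004a4dc6c1bd39018060a006,
   0x160010600000004070f00701c16, 0x6150000d4ca1bc6a0180631406],
  [0x1004c10178a204c1304c643b46a, 0x30100600c0300c030180300c04, 0x7268053a41701405014b701c00,
   0x1572b40007040000110451610000, 0x7148070b4170903f01c2401c2d, 0x141b01416c5b420110446405014,
   0x70000507066014050153501c78, 0x330ac050702b014050142509456, 0x30100600c0300c030180300c04,
   0x3103806018060c431018060c40e, 0x10000100d0170d15600136000fa],
  [0x20080601801008060180600806, 0x90180601801018060180602c06, 0x9054730240105400200092e00d,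
   0x20080601801008060180600806, 0x695b17c010800b02c1a02c0d, 0x580543517c0105454270350a429,
   0x260542615c010542815c4a10428, 0x20080701c010080b02c1a00829, 0xba0540c17c010540b02c0002c73,
   0x90800c02401064192000900152, 0x20082602401008190140900805],
  [0xbc4b8bc0002a15c1d0b02a0b000, 0x1c0000715c574ec0701c07, 0x580153a05c9c0140501400,
   0x1dc00014f205c260140501477, 0x40100414404010000102a0b051, 0x12048001642a05c001ac2a53134,
   0x590001c16407000291f40701c07, 0x120498580002a4941d0b02a0b000, 0x120481c2e486000000b1400b077,
   0x150340d0000d000000540d03400, 0xc0f00000048030000300c03000],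
  [0x4e0385f0200e0902413c0e12c08, 0x2168020940a0280f03c4c03c2e, 0x200c0200c0a00c0103c0300408,
   0xc0683611c1a068360680c0681a, 0x200c0200c0a00c0103c0300408, 0x411084c06c0a0281b0004217042,
   0x20380201004010040100e01004, 0x320340d0641911819064190c819, 0x800384c0940a0284d13c0e0940e,
   0x4e0c45a02042060670004206008, 0x213802020230900f03cab03c08],
  [0x3300c1e0040e028010cc0e07865, 0x718c7501004028040cc0401c08, 0x700c0500404028010140401c08,
   0xf00c050044b028010140018008, 0x7008e200402028010000201c08, 0x3300c1e0040e194010cc0e07808,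
   0x700c0500404028010140401c08, 0x80500402028010140226c08, 0x5218c050100402804014041d408,
   0x10040100402028010040200408, 0x700cc6004000280103c4d01c08],
  [0x10040000436258011a03611445, 0x34020c3214080f05a048080e008, 0x5314400000113e05139c3609c53,
   0x100403004c4000011000300034, 0xf502c2c2b870174ae049122c812, 0x100432004970c8010e0000e053,
   0x14432424dd040511740009ce6, 0xb02c0a74107f1b4090482a2c812, 0x721040a1003c0280a0293d11412,
   0x10040a00404010010100801004, 0x1004030040053c011000300034],
  [0x1213829120120044e004290a40f, 0x120980600812390062180216086, 0x120280605c1212806128151284a,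
   0x40280405c0448c040003c16039, 0x25360030242402403250290a403, 0x120984c0981200426004151300f,
   0x121500612012150061501c02054, 0x2509803098243580302c0b3a803, 0x1223806008121ac062c4020a46b,
   0x601803018060240302c0601803, 0x4238040ec04000044b41502039],
  [0x60403e4c03a018150541b0e810, 0x30100c0101600d4d0f40c0580d, 0x60103e0105e0185e0f41127c88,
   0x30400e2742a00c370f41b00010, 0x60103e010b70183714c8827c10, 0xb33540c0441c1381c4fc0c0701c,
   0x60100c01000018000000c0000d, 0x337c0e0440000c370f4110b018, 0x645c3e0443a0181d074110e818,
   0x4c0400d260173c54b05c1705c0d, 0x30100c0101600c375700c0580d],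
  [0x1f0144406c0500817000171101f, 0x3900050104920085003c0f06022, 0x59178741040a010170580a0280a,
   0x39000502540a010505280a0280a, 0x34f13100c0300c0300c0300c03, 0x1f0fc071241c00807070000601f,
   0x81d0740201c01008020161a091, 0x31794800c0300c0300c0300c03, 0x210fc0006c3f008ec03c0f1a039,
   0x150140706c0501007070170601f, 0x80fc000203f010080213225439],
  [0xa09c0a0500a038850040a00472, 0x3c0b01325866038040040e00404, 0x80201302027020850040e00472,
   0x802013020f600c000000324c72, 0xa4340a0500a00d492340300000, 0x21ec1305066038020040e00402,
   0x15268970502a038040040e00404, 0x21001336834364024047824c02, 0x7c1f07c1f00c1f004030041f,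
   0x2100e00503418002234e13e402, 0x21ec1305066038020040e00402],
  [0x270982706826068120483a0003a, 0x14338c012080f000120482503c73, 0xff0084f00804400040100201002,
   0x3008010080400c040100201002, 0x501405068210141a0840008421, 0x5040135c0f324120487303c24,
   0x190644f2080432404010820100a, 0xc22504f06804068040100801142, 0x3008010080400c040100201002,
   0x19064270a40009c12048870a487, 0x70640701c2201c220642208800],
  [0xad174200042d1c4201c4011fc2d, 0x2b17420004531c4201c40114c2b, 0x20080222402008020082a00806,
   0x2c0340d02c0d2a40d0b0a902c0d, 0x2b0003507d1c26c115541f1fc06, 0x1291741007c2d5142830c1f00006,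
   0x13e45410004000d8110000100006, 0x430245600443000330000102c3a, 0x1000551000110c80143c06,
   0xc0240c44c2a0a80c450090300c, 0x2008020b002008020088900806],
  [0x1b0041b070cc080180600108001, 0x171881b27817118000880208862, 0x1b0040d0140d0148a0140100001,
   0x8a0040703007000180300101c01, 0xe00404010040100e0100101001, 0xe0042f18c6333c0e0c00133801,
   0xe00404010040100e0100101001, 0x188210707a084180600211c62, 0xf82119c6b084000000211c3e,
   0xf800560e811800088020883e, 0x170041b33017080180600108001],
  [0x232b016058f70100000c0400d38, 0x2311801005072300100c5200c01, 0x2e3b8010044717c0100c5200c01,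
   0x230440100410010010100401001, 0x21b8020085c008c000802008c0, 0x6c05c46478051200547c1701405,
   0x2e0440100410010010100401001, 0x2337016058b50114400c0400c00, 0x6a01d1811c1c0700701c3c46407,
   0xd0348f1a8b51592a1e43323c00, 0xc2b06c2940c23000294521d92f],
  [0x10040300c0100c010040300c03, 0x10040300c0100c010040300c03, 0x1004de0bc0113401004260684d,
   0xc0344b0bc201344f080060184d, 0x300c391c0430e40f10d0306830, 0x300c390bc430e40f10c194386d,
   0xb02c0b02c0b02c0b02c0b02c0b, 0x20080201004008040100200804, 0x90240902409024090240902409,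
   0xc0344b12c201344f0800601830, 0x10044b12c011e401004190a430],
  [0x64030013100c004270900902c00, 0x7e4900100c030042700c0902c03, 0x7e0300108c0c0049d0580902c23,
   0x12229c0100c030042700c0902c03, 0xd1900100025004270340902d4e, 0xd2a00108c16004920340902c23,
   0xe0300100c030042700c0907803, 0x7e030011140c00490184093404e, 0xd2a00113061004900347502c38,
   0xd0380100c030042700c1e02c03, 0x4010040b80401004010040102e],
  [0x10240901c0c024690240904009, 0x10340501c100400b1200a04010, 0x1034050280a1b80b0440a02809,
   0x10440501c0c020110441112009, 0x10340502c0b0200b0440b02cd1, 0x10200801c0c020080206e04009,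
   0x10f80c01c0c0300b0300a0400c, 0x10343101c0701c0b01c0a01c07, 0x1014051080c020050140501409,
   0x103405034330200d0440d03409, 0x10040100401004010040100401]]

/-- For the first rows that pass all tests: the digit in base 256 at position `m` is a test word,
counted from 1, for the pair of rows with index `(n, i, j, m)`; it is 0 if there is none. The keys
are the numbers `121 n + 11 i + j`. -/
def twoRowsTable : List (ℕ × ℕ) := [
  (8, 0x56203704654724043e0203963b1f047b1f6e042b0203),
  (33, 0x8f24523552742b104e1d2f940e27281a10281c0d0d1a),
  (62, 0x73021f0b04032b0a63830441023b1004030c1f284204),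
  (70, 0x7f7b043b3765030247049b963a041c37530302100440),
  (79, 0x60043b12023e043203160e2d041637023c0470031611),
  (95, 0x6f524b1faf13220d210d5e1a345c12122c525d25365c),
  (112, 0x584c46381f1c5f5220114a1a1311903e528b0a220a2c),
  (132, 0x34451201220445300a030336434201200433307b0303),
  (153, 0x4601272503244a0403183d4601221303301804034d32),
  (172, 0x361b010b852e030304241a972501399a3d0303042656),
  (184, 0x64300304410301636859118e3003046603013d1f0e12),
  (185, 0xba0d03043d03031f262b040d3503041203033d261e04),
  (203, 0x3660040326641c21036c01416604032625316c033d01),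
  (208, 0x727b04031a3004130334031d140403400d041b030a03),
  (229, 0x4903111c01037a380a04118103100d01032218260422),
  (263, 0x1f2705290a0512140e060624770532b1051f440a0606),
  (320, 0x291a0a064a2a050506321c11b62f06410b0505060a1f),
  (524, 0x131b0d021f1b444101160e7627260213240a11011453),
  (536, 0xb2602162001250a1113143e0d023025016d43334332),
  (542, 0x13332f24260b2c025a01304216800a261349020e0119),
  (547, 0x2f15181e0d400605060a0539160a196696060506aa05),
  (561, 0x5a1db30aa0306b261c01029a106b0e431e5026120102),
  (572, 0x9301041c06445b1128050245010413062b3f0c180502),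
  (576, 0x34051b04010c02063214137605270401140206200e9b),
  (582, 0xc6050d1b062649061b051100051b1106260a0630051c),
  (587, 0x590c0b600d0d0201263041772b0d0c272e0201141650),
  (595, 0xa3010292b361a010c021c602b0d80160e2601110254),
  (601, 0x1a31261f0b0506433e060535a026100c05061f7c0605),
  (617, 0xb0e2104a9021a0a040709111a0a0427020e1b040709),
  (688, 0x294a042615040709021d110e15040a13040709023114),
  (757, 0x5b3d330325120a0415042e611d11032e220b0428043b),
  (793, 0x511903253d0c37040a0424932b03157f2537040d0412),
  (870, 0x43021010c0242f0b38102f36023e120c1246560c1e31),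
  (873, 0x38034601460a012f08020ca2030b011522013108020c),
  (877, 0xc24310108621f100b105b74165f010818193d1b100e),
  (909, 0x120108161642034d3b0709b001082a6e0e037d3b0709),
  (925, 0x14192f080137070942ab03c44a0e08013707090e6703),
  (944, 0x73121b01092e160307156abb0b320109641203073d32),
  (952, 0xb772017a030818021e70016728011b030818020d5301),
  (953, 0x436e1010022b13142d7d794c0e191e020c1a1f1b1c1a),
  (955, 0x100801181e2b182c326129bd08013a1b155b1d1e2c25),
  (965, 0x340701102409295d2703149c0701510c09290e34030a),
  (990, 0x120abe69031a1d08295303750d211d031d3e083a6403),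
  (1001, 0x56080107092d704a0703228c08010709371d10070314),
  (1006, 0x7808080e072209117503167708081a072009755c030a),
  (1009, 0x1f08035a24583127160362580803400b281fbf160320),
  (1043, 0xb03499d1119037916083a4003292113130353140814),
  (1079, 0x5a092f08082722030a8d075609150808352803180a07),
  (1081, 0xa316503080e250344ab11611f6903081c3403192118),
  (1087, 0x56070901080719033b220a6d070901080710033b1e13),
  (1115, 0xbc050e017e1c1c06130408380527010b389b06120408),
  (1143, 0x9e01082d0408099f4c0a3c110108130408092e1d3336),
  (1179, 0xb53f010a0621080411059d3913011e060d0804930511),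
  (1189, 0x540432080155390a0829070a04500801182816083a07),
  (1210, 0xa55005071a5c0709093506805805078c180709095b06),
  (1217, 0x2d84051501171212120e065814051501175d380b2306),
  (1228, 0x744113102d051b130106231e4c0d3a120547c3010623),
  (1230, 0x410e1c1e3c05561723064e910f54941e056c17230629),
  (1231, 0x8515192a0d050b1801060d731725166305402301068d),
  (1232, 0x682d2823410117050684612a0b5c1b3401120506140b),
  (1241, 0x991624110c01800506175873390d6a23011505061710),
  (1242, 0x551433100f171d050623783a3371250f17160506120e),
  (1251, 0x8a053901731a23068f781747050b010a1e0b06111117),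
  (1253, 0x27050e0121131c06b523120b05410150160e060b1d14),
  (1258, 0x1809073c070627099905b25709075e070651092105),
  (1269, 0x503823056a06200117a713940e2305920629010a0b74),
  (1273, 0xd170f0b070c090136110b7c170f16072d0901102491),
  (1281, 0x4b83011906980c1c180517490e0113060a10772f0517),
  (1285, 0x1118012c068e3c0b1a05221d49016b061515170d0510),
  (1287, 0x58012906690e05171ca61035012a061a190511230e0b),
  (1294, 0xb139090657070571920709444909064c07054e200709),
  (1302, 0x2d830617340d5a1105011499ae0617131a156f050116),
  (1303, 0xa09780f23217f190e01074509100f1315432b680107),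
  (1309, 0x44200f232e1001075f092e55c20f1b1440010711090d),
  (1313, 0x9e64340b0923014f070a6c12510a170923010c070d0b),
  (1314, 0x101e3c1a090f013f07191733b9270e090b010a072017),
  (1316, 0x326b172a1e5b010712090d474a170d18390107120923),
  (1320, 0x4d0d0c233a0b1707570901550a1e23980b1707420901),
  (1324, 0xaa0716594909154c170b011307231f5909340d0c4701),
  (1327, 0x6b0c170f1f6924070c0901470e170f72193c07540901),
  (1328, 0xa07150a860915540f0a010c0734163f09231d0c3f01),
  (1389, 0xa8056945272826042b01030b05530d462c0d042c0103),
  (1433, 0x66286016061a03012f04101bb80e1d063c03013c0430),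
  (1487, 0xc02010209020d030710453402010209020e03070b16),
  (1499, 0xb4032f01043702a401103b8b030c010437028701163b),
  (1539, 0xad0401250301371e3b5e024004011d0301370b126702),
  (1568, 0xb0702010209130c0203182d0702010209521102031d),
  (1581, 0x6129021a0b02840c0234245033020b0f022112020a2c),
  (1602, 0x6602ac623d22020103210f590213291251020103380f),
  (1603, 0xc0339710f559f0102027a3603134e0f359f01020216),
  (1607, 0x89010f0f0a0217020d1b56a5010f0f38020d02122c19),
  (1611, 0x1202122f39020f02633d2c2d02181963020f025f1c18),
  (1630, 0x5b0f1d0221020a0d022814610f14021202201a020e91),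
  (1641, 0x200f1e4203020b0281014da30f642c03024c0257011e),
  (1649, 0x9d4b888802030f0c2c0102390d271102030f1c3f0102),
  (1684, 0x65110f0f011d25100202207d600f0f010e401502020e),
  (1689, 0x125a2b0e023a111a02020f85440b2002570d5902020f),
  (1730, 0xb0851037a151c010c08024f0811034d2f1c010f0802),
  (1809, 0xe540370080f02080e011d5e320322080f020828010a),
  (1849, 0x3a1d05824b242d011d08063f0a0511200d6701890806),
  (1882, 0x710338112d18246f8e20144e030e68291e0d6d450b18),
  (1884, 0x45012135061419151b05084001364e06201820970508),
  (1885, 0x43054a1d010b08060c0a114505828101540806141921),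
  (1887, 0xb2451e6a0332180a205515ac27621b037614180c9511),
  (1898, 0xb3a75d060a2205080e01958a271a061d880508140195),
  (1939, 0x8f3c491403484b112153017d146d250348221a311b01),
  (1956, 0x4e4801111b071503031d33144801660e076503032e1e),
  (1978, 0x751804038652039c0c24842a0a04035452032e154770),
  (1993, 0x4603149c0c0e01153a162e4603106c14110153483144),
  (2032, 0x9710190148031513090342241055013203132c090312),
  (2054, 0x512e0304101328383c2e030d47030424150b253e2d03),
  (2093, 0x4959022a1321150417153f1620025f33141404170b2a),
  (2094, 0x790402760b02041c2f034b790402143b020421160342),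
  (2101, 0x46217602040b4d0302210446372f0204164303022a04),
  (2102, 0x77112a025c231c0b210412191c5f02200b5d15120415),
  (2155, 0x431218220b2701182a1401000d120b240e01200b0d01),
  (2179, 0x5f034f0f225a1c04012b070d03130f515e3504010a07),
  (2194, 0x8d291b0401210101622c0411413e04010b0101141904),
  (2224, 0x4b0f012a0a0f07041e0a227e0f01132d0f07040c241f),
  (2243, 0xc101040c0d3a0465150101240104390d1c040c290101),
  (2283, 0x63270f41030109103504270e140f3e0301090c690413),
  (2288, 0x444b1a010fa80c4c0f04094fa30d010f1f132e0f0409),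
  (2352, 0x1f141308116704210416318c0a28080a87043304481a),
  (2355, 0x151d081b0c041348601e044a1508221504150d872b04),
  (2366, 0xe390801010502481006b40e1908010105024818061b),
  (2368, 0x8b6b1c041c05020b1b068912ae11040a05023a0e0662),
  (2371, 0x19822910010e281b02174a130ba4170123204e020c47),
  (2379, 0x4f1a04040a086aad401daf5e1804042b0811a21f193f),
  (2381, 0x75150404253268110882194d25040421284f0c08405d),
  (2392, 0x3f12041f900c74050681021114041b361e4205061f02),
  (2396, 0x10010108572a0a05064802100101080a0e5705061e02),
  (2397, 0xc0123115502510d174c1d1e01131a14027823174f2c),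
  (2435, 0xd02130701203110015d1c580222070172311001190c),
  (2443, 0x6f980147140101a1210c2e0ab0010a35010162241522),
  (2458, 0xa92d59014d19312801920112831801c50c130e011001),
  (2507, 0xd01092502011028250c1861010919020116385c0c18),
  (2511, 0xa021f0f023e2a721001013602140f020c0c33100101),
  (2512, 0x19022c1011260c070101016e0219210e267c07010101),
  (2518, 0x1d057c8a02016e0630014468050a0c02011a0615014e),
  (2523, 0xb02509006264b010105286f021f1a060b5001010545),
  (2527, 0x10020f13021101013f1910a6020f22020b01010d7e1b),
  (2529, 0x12253c20020101013009855719120e0201010130091b),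
  (2545, 0x4f07143e040933020101165e072a2704090c02010171),
  (2618, 0x3504351c09017e0107022236041b1209012a01070212),
  (2640, 0x42200c01020c25010302442a2e1b01022d0d01030231),
  (2655, 0x3502011816031e0214016a1e02012120030c021601a1),
  (2783, 0x6d02194f9e0203290322010b021a790b02030d036701),
  (2834, 0x7f363f100203014d022b030b0e9a8602030129022203)]

/-- The indices `(n, i, j, m)` of the generator matrices that pass all tests. -/
def remainingIndices : List (ℕ × ℕ × ℕ × ℕ) := [(4, 8, 10, 10), (10, 4, 4, 21), (17, 8, 10, 10)]

/-- The product of `κ` and `n x + y`. -/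
def packedEntry (κ n x y : ℕ) : ℕ :=
  reduceDigits 11 (Nat.mod (Nat.mul κ
    (reduceDigits 11 (Nat.mod (Nat.add (Nat.mul n x) y) packMod))) packMod)

/-- The packed form of the sign and the element of norm 1 with index `m`. -/
def packedUnit (m : ℕ) : ℕ :=
  cond (Nat.ble 11 m) (Nat.mul 2 (spreadDigits 11 (normOneCodes.getD (Nat.sub m 11) 0)))
    (spreadDigits 11 (normOneCodes.getD m 0))

/-- Whether the pair of rows with index `(n, i, j, m)` has a light combination, as found in the table
entry `a`, or is listed in `remainingIndices`. The first row is `(1, 0, U, V)`, and `U'`, `V'` pack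
the images of its entries under the involution, so that the second row is `(0, 1, κ V', -κ U')`. -/
def twoRowsCheck (U V U' V' n i j a m : ℕ) : Bool :=
  let t := Nat.mod (Nat.div a (Nat.pow 256 m)) 256
  let κ := packedUnit m
  cond (Nat.beq t 0)
    (remainingIndices.any fun s =>
      Nat.beq s.1 n && (Nat.beq s.2.1 i && (Nat.beq s.2.2.1 j && Nat.beq s.2.2.2 m)))
    (twoRowsLight U V (reduceDigits 11 (Nat.mod (Nat.mul κ V') packMod))
      (reduceDigits 11 (Nat.mod (Nat.mul 2 (Nat.mul κ U')) packMod))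
      (twoRowsTests.getD (Nat.sub t 1) 0))

/-- The entry of an association list. -/
def assocGet (k : ℕ) (l : List (ℕ × ℕ)) : ℕ :=
  l.foldr (fun p r => cond (Nat.beq p.1 k) p.2 r) 0

/-- Whether the first row with index `(n, i, j)` has a light multiple, or else `twoRowsCheck` holds for
each of the 22 second rows that go with it. The ternary numbers 68536, 20038 and 88574 encode the
idempotents `idemN`, `idemQ` and `idem`; the former two are exchanged by the involution. -/
def firstRowCheck (n i j : ℕ) : Bool :=
  let t := Nat.mod (Nat.div ((firstRowTable.getD n []).getD i 0) (Nat.pow 1024 j)) 1024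
  let N := spreadDigits 11 (normCodes.getD n 0)
  let N' := reduceDigits 11 (Nat.mod (Nat.mul 2 (Nat.add (spreadDigits 11 88574) N)) packMod)
  let U := packedEntry (spreadDigits 11 (normOneCodes.getD i 0)) N
    (spreadDigits 11 68536) (spreadDigits 11 20038)
  let V := packedEntry (spreadDigits 11 (normOneCodes.getD j 0)) N'
    (spreadDigits 11 68536) (spreadDigits 11 20038)
  cond (Nat.beq t 0)
    ((List.range 22).all fun m => twoRowsCheck U V
      (packedEntry (spreadDigits 11 (normOneStarCodes.getD i 0)) N
        (spreadDigits 11 20038) (spreadDigits 11 68536))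
      (packedEntry (spreadDigits 11 (normOneStarCodes.getD j 0)) N'
        (spreadDigits 11 20038) (spreadDigits 11 68536)) n i j
      (assocGet (Nat.add (Nat.mul 121 n) (Nat.add (Nat.mul 11 i) j)) twoRowsTable) m)
    (firstRowLight U V (firstRowTests.getD (Nat.sub t 1) 0))

/-- Every generator matrix other than the three remaining ones spans a word of weight less than 15:
the kernel evaluates the weights of the tabulated words. -/
theorem firstRowCheck_eq_true : ((List.range 25).all fun n => (List.range 11).all fun i =>
    (List.range 11).all fun j => firstRowCheck n i j) = true := by
  decide +kernel

/-- The sign and the element of norm 1 with index `m`. -/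
def unitOf (m : ℕ) : Circ :=
  if 11 ≤ m then -ofTernary (normOneCodes.getD (m - 11) 0) else ofTernary (normOneCodes.getD m 0)

/-- The first row with index `(n, i, j)` is `(1, 0, firstEntry n i, secondEntry n j)`. -/
def firstEntry (n i : ℕ) : Circ :=
  ofTernary (normOneCodes.getD i 0) * (ofTernary (normCodes.getD n 0) * idemN + idemQ)

/-- See `firstEntry`. -/
def secondEntry (n j : ℕ) : Circ :=
  ofTernary (normOneCodes.getD j 0) * ((-idem - ofTernary (normCodes.getD n 0)) * idemN + idemQ)

theorem two_mul_eq_neg (x : Circ) : 2 * x = -x := by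
  have h : (3 : Circ) = 0 := CharP.cast_eq_zero Circ 3
  linear_combination h * x

theorem Packs.nat_add {n n' k k' : ℕ} {x y : Circ} (h : Packs n k x) (h' : Packs n' k' y) :
    Packs (Nat.add n n') (k + k') (x + y) := h.add h'

theorem Packs.nat_mul {n n' k k' : ℕ} {x y : Circ} (h : Packs n k x) (h' : Packs n' k' y) :
    Packs (Nat.mul n n') (11 * (k * k')) (x * y) := h.mul h'

theorem Packs.nat_reduce {n k : ℕ} {x : Circ} (h : Packs n k x) (hk : k ≤ 254) :
    Packs (reduceDigits 11 (Nat.mod n packMod)) 2 x := (h.mono hk).reduce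

theorem Packs.neg {n k : ℕ} {x : Circ} (h : Packs n k x) : Packs (Nat.mul 2 n) (k + k) (-x) := by
  rw [← two_mul_eq_neg, two_mul]
  have := h.add h
  rw [← two_mul] at this
  exact this

theorem packs_packedUnit (m : ℕ) : Packs (packedUnit m) 4 (unitOf m) := by
  rw [packedUnit, unitOf]
  by_cases h : 11 ≤ m
  · rw [if_pos h, Nat.ble_eq_true_of_le h, cond_true, Nat.sub_eq]
    exact (packs_spreadDigits _).neg
  · rw [if_neg h, Bool.eq_false_iff.mpr fun h' => h (Nat.le_of_ble_eq_true h'), cond_false]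
    exact (packs_spreadDigits _).mono (by norm_num)

theorem packs_packedEntry {K n x y : ℕ} {κ N a b : Circ} (hK : Packs K 2 κ) (hn : Packs n 2 N)
    (hx : Packs x 2 a) (hy : Packs y 2 b) : Packs (packedEntry K n x y) 2 (κ * (N * a + b)) :=
  (hK.nat_mul (((hn.nat_mul hx).nat_add hy).nat_reduce (by norm_num))).nat_reduce (by norm_num)

theorem star_ofTernary_normOneCode : ∀ i < 11,
    star (ofTernary (normOneCodes.getD i 0)) = ofTernary (normOneStarCodes.getD i 0) := by
  decide +kernel

theorem star_ofTernary_normCode : ∀ n < 25,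
    star (ofTernary (normCodes.getD n 0)) = ofTernary (normCodes.getD n 0) := by
  decide +kernel

namespace NormalCode

variable {C : Submodule (ZMod 3) (Fin 48 → ZMod 3)} (hC : NormalCode C)
include hC

/-- The light words found by `firstRowCheck` do not lie in an extremal code. -/
theorem index_mem_remainingIndices {n i j m : ℕ} (hn : n < 25) (hi : i < 11) (hj : j < 11)
    (hm : m < 22) (h1 : HasFirstRow C (firstEntry n i) (secondEntry n j))
    (h2 : HasSecondRow C (unitOf m * star (secondEntry n j))
      (-(unitOf m * star (firstEntry n i)))) : (n, i, j, m) ∈ remainingIndices := by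
  have h := firstRowCheck_eq_true
  simp only [List.all_eq_true, List.mem_range] at h
  specialize h n hn i hi j hj
  rw [firstRowCheck] at h
  have eN : ofTernary 68536 = idemN := by decide +kernel
  have eQ : ofTernary 20038 = idemQ := by decide +kernel
  have eI : ofTernary 88574 = idem := by decide +kernel
  have pN := packs_spreadDigits (normCodes.getD n 0)
  have pN' : Packs (reduceDigits 11 (Nat.mod (Nat.mul 2 (Nat.add (spreadDigits 11 88574)
      (spreadDigits 11 (normCodes.getD n 0)))) packMod)) 2
      (-idem - ofTernary (normCodes.getD n 0)) := by
    rw [← neg_add', ← eI]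
    exact ((packs_spreadDigits _).nat_add pN).neg.nat_reduce (by norm_num)
  have a1 := packs_spreadDigits 68536
  have a2 := packs_spreadDigits 20038
  rw [eN] at a1
  rw [eQ] at a2
  have pU := packs_packedEntry (packs_spreadDigits (normOneCodes.getD i 0)) pN a1 a2
  have pV := packs_packedEntry (packs_spreadDigits (normOneCodes.getD j 0)) pN' a1 a2
  have pU' := packs_packedEntry (packs_spreadDigits (normOneStarCodes.getD i 0)) pN a2 a1
  have pV' := packs_packedEntry (packs_spreadDigits (normOneStarCodes.getD j 0)) pN' a2 a1
  have eU : ofTernary (normOneStarCodes.getD i 0) * (ofTernary (normCodes.getD n 0) * idemQ + idemN)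
      = star (firstEntry n i) := by
    rw [firstEntry, star_mul, star_ofTernary_normOneCode i hi, star_add, star_mul, star_idemN,
      star_idemQ, star_ofTernary_normCode n hn]
  have eV : ofTernary (normOneStarCodes.getD j 0) *
      ((-idem - ofTernary (normCodes.getD n 0)) * idemQ + idemN) = star (secondEntry n j) := by
    rw [secondEntry, star_mul, star_ofTernary_normOneCode j hj, star_add, star_mul, star_idemN,
      star_idemQ, star_sub, star_neg, star_ofTernary_normCode n hn,
      show star idem = idem by decide]
  rw [eU] at pU'
  rw [eV] at pV'
  rw [hC.not_firstRowLight h1 h2 pU pV] at h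
  generalize Nat.beq _ 0 = t at h
  cases t
  · exact absurd h (by simp)
  rw [cond_true, List.all_eq_true] at h
  specialize h m (List.mem_range.mpr hm)
  rw [twoRowsCheck] at h
  rw [hC.not_twoRowsLight h1 h2 pU pV
    (((packs_packedUnit m).nat_mul pV').nat_reduce (by norm_num))
    (((packs_packedUnit m).nat_mul pU').neg.nat_reduce (by norm_num))] at h
  generalize Nat.beq _ 0 = t at h
  cases t
  · exact absurd h (by simp)
  rw [cond_true, List.any_eq_true] at h
  obtain ⟨s, hs, e⟩ := h
  simp only [Bool.and_eq_true, Nat.beq_eq] at e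
  obtain ⟨rfl, rfl, rfl, rfl⟩ := e
  exact hs

end NormalCode

/-- `C` is equivalent to a code in normal form with one of the remaining generator matrices. -/
theorem NormalCode.exists_remainingIndex {C : Submodule (ZMod 3) (Fin 48 → ZMod 3)}
    (hC : NormalCode C) : EquivNormal C fun D => ∃ n i j m, (n, i, j, m) ∈ remainingIndices ∧
      HasFirstRow D (firstEntry n i) (secondEntry n j) ∧
      HasSecondRow D (unitOf m * star (secondEntry n j)) (-(unitOf m * star (firstEntry n i))) := by
  have s1 : EquivNormal C fun D => ∃ u v n, n < 25 ∧ HasFirstRow D u v ∧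
      u * star u = ofTernary (normCodes.getD n 0) := by
    obtain ⟨u, v, h⟩ := hC.exists_firstRow
    have hn := hC.norm_add_norm h
    rcases exists_normCode (n := u * star u) (by rw [aug_mul, h.aug_left, zero_mul])
        (by rw [star_mul, star_star, mul_comm]) with h0 | h0 | ⟨r, a, ha, e⟩
    · have := hC.first_norm_cancel h aug_idem (by rw [h0, zero_mul])
      exact absurd this (by decide)
    · rw [h0] at hn
      have := hC.second_norm_cancel h aug_idem (by rw [add_eq_left.mp hn, zero_mul])
      exact absurd this (by decide)
    · refine (h.map_mult hC r).bind fun D hD hr => ?_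
      rcases e with e | e
      · exact ⟨D, ⟨1, one_mem _, Submodule.map_id D⟩, hD, _, _, a, ha, hr, by
          rw [← e, mult_mul, mult_star]⟩
      · refine (hr.map_swap hD).bind fun E hE hs => ?_
        exact ⟨E, ⟨1, one_mem _, Submodule.map_id E⟩, hE, _, _, a, ha, hs, by
          rw [← e, ← hn, add_sub_cancel_left, mult_mul, mult_star]⟩
  refine s1.bind fun C hC ⟨u, v, n, hn, h, e⟩ => ?_
  obtain ⟨κ, μ, k1, k2, m1, m2, rfl, rfl⟩ := hC.exists_first_eq h e
  obtain ⟨s, k, i, hi, rfl⟩ := exists_eq_normOneCode k1 k2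
  obtain ⟨s', k', j, hj, rfl⟩ := exists_eq_normOneCode m1 m2
  have cancel : ∀ (s : (ZMod 3)ˣ) (k : ZMod 11) (x y : Circ),
      (s : ZMod 3) • (shift (-k) * ((s : ZMod 3) • (shift k * x) * y)) = x * y := by
    intro s k x y
    have hs : (s : ZMod 3) * s = 1 := by revert s; decide
    rw [smul_mul_assoc, mul_smul_comm, smul_smul, hs, one_smul, mul_assoc, ← mul_assoc,
      shift_mul_shift, neg_add_cancel, shift_zero, one_mul]
  refine (h.map_left hC s (-k)).bind fun C hC h => ?_
  rw [cancel] at h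
  refine (h.map_right hC s' (-k')).bind fun C hC h => ?_
  rw [cancel] at h
  change HasFirstRow C (firstEntry n i) (secondEntry n j) at h
  obtain ⟨w, z, h'⟩ := hC.exists_secondRow
  obtain ⟨κ, k1, k2, rfl, rfl⟩ := hC.exists_second_eq h h'
  obtain ⟨s, k, m, hm, rfl⟩ := exists_eq_normOneCode k1 k2
  refine (h'.map_shift hC h (-k)).bind fun C hC ⟨h, h'⟩ => ?_
  rw [mul_neg, ← mul_assoc, ← mul_assoc, mul_smul_comm, ← mul_assoc, shift_mul_shift,
    neg_add_cancel, shift_zero, one_mul] at h'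
  have hs : ∀ s : (ZMod 3)ˣ, s = 1 ∨ s = -1 := by decide
  obtain ⟨m', hm', e⟩ : ∃ m' < 22, (s : ZMod 3) • ofTernary (normOneCodes.getD m 0) = unitOf m' := by
    rcases hs s with rfl | rfl
    · exact ⟨m, by omega, by rw [unitOf, if_neg (by omega), Units.val_one, one_smul]⟩
    · exact ⟨m + 11, by omega, by
        rw [unitOf, if_pos (by omega), Nat.add_sub_cancel, Units.val_neg, Units.val_one, neg_smul,
          one_smul]⟩
  rw [e] at h'
  exact ⟨C, ⟨1, one_mem _, Submodule.map_id C⟩, hC, n, i, j, m',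
    hC.index_mem_remainingIndices hn hi hj hm' h h', h, h'⟩

/-! ### Recognizing the Pless code -/

/-- An ordering of the coordinates of the Pless code. The four blocks consist of the
powers `2ⁱ` and of the elements `-2ⁱ` of `𝔽₂₃`, on the left and on the right; the last four
coordinates are `∞` and `0` on the left and on the right. -/
def plessOrder : List (Fin 48) := [
  2, 3, 5, 9, 17, 10, 19, 14, 4, 7, 13, 23, 22, 20, 16, 8, 15, 6, 11, 21, 18, 12, 26, 27,
  29, 33, 41, 34, 43, 38, 28, 31, 37, 47, 46, 44, 40, 32, 39, 30, 35, 45, 42, 36, 0, 1, 24, 25]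

/-- The inverse of `plessOrder`. -/
def plessPosition : List (Fin 48) := [
  44, 45, 0, 1, 8, 2, 17, 9, 15, 3, 5, 18, 21, 10, 7, 16, 14, 4, 20, 6, 13, 19, 12, 11,
  46, 47, 22, 23, 30, 24, 39, 31, 37, 25, 27, 40, 43, 32, 29, 38, 36, 26, 42, 28, 35, 41, 34, 33]

/-- The permutation given by `plessOrder`. -/
def plessPerm : Equiv.Perm (Fin 48) where
  toFun k := plessOrder.getD k.val 0
  invFun k := plessPosition.getD k.val 0
  left_inv := by decide +kernel
  right_inv := by decide +kernel

/-- The permutation `x ↦ 2 x` of the projective line over `𝔽₂₃`, indexed as in `plessMatrix`. -/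
def doubling : Equiv.Perm (Fin 24) where
  toFun k := if k.val = 0 then 0 else Fin.ofNat 24 (2 * (k.val - 1) % 23 + 1)
  invFun k := if k.val = 0 then 0 else Fin.ofNat 24 (12 * (k.val - 1) % 23 + 1)
  left_inv := by decide
  right_inv := by decide

theorem plessMatrix_doubling (i j : Fin 24) :
    plessMatrix 23 (doubling i) (doubling j) = plessMatrix 23 i j := by
  have h : ∀ x : Fin 24 × Fin 24,
      plessMatrix 23 (doubling x.1) (doubling x.2) = plessMatrix 23 x.1 x.2 := by decide +kernel
  exact h (i, j)

theorem mem_P48_iff {w : Fin 48 → ZMod 3} : w ∈ P48 ↔ ∀ j : Fin 24,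
    ∑ i : Fin 24, w (Fin.castAdd 24 i) * plessMatrix 23 i j = w (Fin.natAdd 24 j) := by
  have hspan : w ∈ P48 ↔ ∃ c : Fin 24 → ZMod 3, ∑ i, c i • (Fin.append
      ((1 : Matrix (Fin 24) (Fin 24) (ZMod 3)) i) (plessMatrix 23 i) : Fin 48 → ZMod 3) = w :=
    Submodule.mem_span_range_iff_exists_fun _
  have hl : ∀ (c : Fin 24 → ZMod 3) (j : Fin 24), (∑ i, c i • (Fin.append
      ((1 : Matrix (Fin 24) (Fin 24) (ZMod 3)) i) (plessMatrix 23 i) : Fin 48 → ZMod 3))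
        (Fin.castAdd 24 j) = c j := by
    intro c j
    simp [Finset.sum_apply, Fin.append_left, Matrix.one_apply]
  have hr : ∀ (c : Fin 24 → ZMod 3) (j : Fin 24), (∑ i, c i • (Fin.append
      ((1 : Matrix (Fin 24) (Fin 24) (ZMod 3)) i) (plessMatrix 23 i) : Fin 48 → ZMod 3))
        (Fin.natAdd 24 j) = ∑ i, c i * plessMatrix 23 i j := by
    intro c j
    rw [Finset.sum_apply]
    exact Finset.sum_congr rfl fun i _ => congrArg (c i * ·) (Fin.append_right _ _ j)
  rw [hspan]
  constructor
  · rintro ⟨c, rfl⟩ j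
    rw [hr]
    simp only [hl]
  · intro h
    refine ⟨fun i => w (Fin.castAdd 24 i), funext fun k => ?_⟩
    refine Fin.addCases (m := 24) (n := 24) (fun j => hl _ j) (fun j => ?_) k
    rw [hr, h]

theorem finrank_P48_le : Module.finrank (ZMod 3) P48 ≤ 24 := by
  have := finrank_range_le_card (R := ZMod 3) fun i : Fin (23 + 1) =>
    Fin.append ((1 : Matrix (Fin (23 + 1)) (Fin (23 + 1)) (ZMod 3)) i) (plessMatrix 23 i)
  rwa [Fintype.card_fin] at this

/-- The words that belong to the Pless code after reordering. -/
def orderedPless : Submodule (ZMod 3) (Fin 48 → ZMod 3) :=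
  P48.comap (monomialMap 1 plessPerm :
    (Fin 48 → ZMod 3) ≃ₗ[ZMod 3] (Fin 48 → ZMod 3)).toLinearMap

theorem mem_orderedPless_iff {w : Fin 48 → ZMod 3} :
    w ∈ orderedPless ↔ ∀ j : Fin 24, ∑ i : Fin 24, w (plessPosition.getD i.val 0) *
      plessMatrix 23 i j = w (plessPosition.getD (24 + j.val) 0) := by
  have e : ∀ k, (monomialMap 1 plessPerm : (Fin 48 → ZMod 3) ≃ₗ[ZMod 3] (Fin 48 → ZMod 3)) w k =
      w (plessPosition.getD k.val 0) := by
    intro k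
    rw [monomialMap_apply]
    simp only [Pi.one_apply, Units.val_one, one_mul]
    rfl
  rw [orderedPless, Submodule.mem_comap, LinearEquiv.coe_coe, mem_P48_iff]
  simp only [e]
  rfl

theorem blockCycle_symm_inl : ∀ (p : Fin 4) (i : ZMod 11),
    blockCycle.symm (coordEquiv (.inl (p, i))) = coordEquiv (.inl (p, i - 1)) := by
  decide +kernel

theorem blockCycle_symm_inr : ∀ j : Fin 4,
    blockCycle.symm (coordEquiv (.inr j)) = coordEquiv (.inr j) := by
  decide +kernel

theorem word_shift_mul (b : Fin 4 → Circ) (r : Fin 4 → ZMod 3) :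
    word (fun p => shift 1 * b p) r = word b r ∘ blockCycle.symm := by
  refine ((eq_word_iff _ _ _).mpr ⟨fun p i => ?_, fun j => ?_⟩).symm
  · rw [Function.comp_apply, blockCycle_symm_inl, word_inl, shift_mul_apply]
  · rw [Function.comp_apply, blockCycle_symm_inr, word_inr]

theorem shift_mem_orderedPless (b : Fin 4 → Circ) (r : Fin 4 → ZMod 3)
    (h : word b r ∈ orderedPless) : word (fun p => shift 1 * b p) r ∈ orderedPless := by
  rw [mem_orderedPless_iff] at h ⊢
  have e1 : ∀ i : Fin 24, blockCycle.symm (plessPosition.getD (doubling i).val 0) =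
      plessPosition.getD i.val 0 := by decide +kernel
  have e2 : ∀ j : Fin 24, blockCycle.symm (plessPosition.getD (24 + (doubling j).val) 0) =
      plessPosition.getD (24 + j.val) 0 := by decide +kernel
  rw [word_shift_mul]
  intro j
  obtain ⟨j, rfl⟩ := doubling.surjective j
  rw [Function.comp_apply, e2, ← h j, ← Equiv.sum_comp doubling]
  refine Finset.sum_congr rfl fun i _ => ?_
  rw [Function.comp_apply, e1]
  exact congrArg _ (plessMatrix_doubling i j)

/-- The combination of the two rows and of the last two rows of the fixed code. -/
theorem word_combination_mem {E : Submodule (ZMod 3) (Fin 48 → ZMod 3)} {u v w z : Circ}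
    (hE : ∀ b r (a : Circ), word b r ∈ E → word (fun p => a * b p) (aug a • r) ∈ E)
    (e1 : word ![1, 0, u, v] (-fixedRight 0) ∈ E) (e2 : word ![0, 1, w, z] (-fixedRight 1) ∈ E)
    (e3 : word (Pi.single 2 J) (fixedRight 2) ∈ E) (e4 : word (Pi.single 3 J) (fixedRight 3) ∈ E)
    (a b : Circ) (s t : ZMod 3) :
    word ![a, b, a * u + b * w + s • J, a * v + b * z + t • J]
      (aug a • -fixedRight 0 + aug b • -fixedRight 1 + s • fixedRight 2 + t • fixedRight 3) ∈ E := by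
  have h := E.add_mem (E.add_mem (E.add_mem (hE _ _ a e1) (hE _ _ b e2))
    (E.smul_mem s e3)) (E.smul_mem t e4)
  rw [word_smul, word_smul, word_add, word_add, word_add] at h
  refine (congrArg (· ∈ E) (word_inj.mpr ⟨funext fun p => ?_, rfl⟩)).mp h
  fin_cases p <;> simp

/-- A code in normal form is spanned, over the circulant ring, by its first two rows and by the
fixed code. -/
theorem NormalCode.le_of_rows_mem {D T : Submodule (ZMod 3) (Fin 48 → ZMod 3)} (hD : NormalCode D)
    {u v w z : Circ} (h1 : HasFirstRow D u v) (h2 : HasSecondRow D w z)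
    (hT : ∀ b r (a : Circ), word b r ∈ T → word (fun p => a * b p) (aug a • r) ∈ T)
    (t1 : word ![1, 0, u, v] (-fixedRight 0) ∈ T) (t2 : word ![0, 1, w, z] (-fixedRight 1) ∈ T)
    (t3 : word (Pi.single 2 J) (fixedRight 2) ∈ T)
    (t4 : word (Pi.single 3 J) (fixedRight 3) ∈ T) : D ≤ T := by
  intro c hc
  obtain ⟨b, r, rfl⟩ := exists_eq_word c
  have d3 := hD.fixed_mem 2
  have d4 := hD.fixed_mem 3
  have hD' := fun b r a (h : word b r ∈ D) => hD.mul_mem h a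
  -- Subtracting multiples of the rows leaves a word supported in the last two blocks, on which
  -- the group acts trivially because two blocks carry no nonzero word.
  have h0 := D.sub_mem hc (word_combination_mem hD' h1.mem h2.mem d3 d4 (b 0) (b 1) 0 0)
  rw [word_sub] at h0
  obtain ⟨B, hB⟩ : ∃ B, B = b - ![b 0, b 1, b 0 * u + b 1 * w + (0 : ZMod 3) • J,
    b 0 * v + b 1 * z + (0 : ZMod 3) • J] := ⟨_, rfl⟩
  rw [← hB] at h0
  have B0 : B 0 = 0 := (congrFun hB 0).trans (sub_self _)
  have B1 : B 1 = 0 := (congrFun hB 1).trans (sub_self _)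
  have B2 : B 2 = b 2 - (b 0 * u + b 1 * w + (0 : ZMod 3) • J) := congrFun hB 2
  have B3 : B 3 = b 3 - (b 0 * v + b 1 * z + (0 : ZMod 3) • J) := congrFun hB 3
  have h3 := hD.mul_mem h0 (shift 1 - 1)
  rw [aug_sub, aug_shift, aug_one, sub_self, zero_smul] at h3
  have h4 := hD.two_blocks (p := 2) (q := 3) (by decide) h3 fun i hi hi' => by
    have : i = 0 ∨ i = 1 := by omega
    rcases this with rfl | rfl
    · rw [B0, mul_zero]
    · rw [B1, mul_zero]
  have key : ∀ x y : Circ, (shift 1 - 1) * (x - (y + (0 : ZMod 3) • J)) = 0 →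
      ∃ s : ZMod 3, x - y = s • J := by
    intro x y hx
    rw [zero_smul, add_zero] at hx
    exact ⟨_, eq_smul_J_of_shift (by rwa [sub_mul (shift 1), one_mul, sub_eq_zero] at hx)⟩
  obtain ⟨s, hs⟩ := key (b 2) (b 0 * u + b 1 * w) (by
    rw [← B2]; exact congrFun h4 2)
  obtain ⟨t, ht⟩ := key (b 3) (b 0 * v + b 1 * z) (by
    rw [← B3]; exact congrFun h4 3)
  have h5 := D.sub_mem hc (word_combination_mem hD' h1.mem h2.mem d3 d4 (b 0) (b 1) s t)
  have hb : b = ![b 0, b 1, b 0 * u + b 1 * w + s • J, b 0 * v + b 1 * z + t • J] := by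
    funext p
    fin_cases p
    · rfl
    · rfl
    · exact eq_add_of_sub_eq' hs
    · exact eq_add_of_sub_eq' ht
  rw [word_sub, ← hb, sub_self] at h5
  have h6 := sub_eq_zero.mp (hD.right_eq_zero h5)
  have h7 := word_combination_mem hT t1 t2 t3 t4 (b 0) (b 1) s t
  rwa [← hb, ← h6] at h7

theorem NormalCode.codeEquivalent_P48 {D : Submodule (ZMod 3) (Fin 48 → ZMod 3)}
    (hD : NormalCode D) {u v w z : Circ} (h1 : HasFirstRow D u v) (h2 : HasSecondRow D w z)
    (m : (ZMod 11)ˣ) (c : Fin 4 → ZMod 11) (ε δ : Fin 4 → (ZMod 3)ˣ) (f g : Equiv.Perm (Fin 4))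
    (t1 : blockMonomial m c ε δ f g (word ![1, 0, u, v] (-fixedRight 0)) ∈ orderedPless)
    (t2 : blockMonomial m c ε δ f g (word ![0, 1, w, z] (-fixedRight 1)) ∈ orderedPless)
    (t3 : blockMonomial m c ε δ f g (word (Pi.single 2 J) (fixedRight 2)) ∈ orderedPless)
    (t4 : blockMonomial m c ε δ f g (word (Pi.single 3 J) (fixedRight 3)) ∈ orderedPless) :
    CodeEquivalent D P48 := by
  have hle := hD.le_of_rows_mem (T := orderedPless.comap (blockMonomial m c ε δ f g).toLinearMap)
    h1 h2 (fun b r a h => by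
      rw [Submodule.mem_comap, LinearEquiv.coe_coe, blockMonomial_word] at h ⊢
      have := word_mul_mem shift_mem_orderedPless h (mult m a)
      rw [aug_mult] at this
      refine (congrArg (· ∈ orderedPless) (word_inj.mpr ⟨funext fun p => ?_, funext fun j => ?_⟩)).mp
        this
      · rw [mult_mul, mul_smul_comm, mul_left_comm]
      · simp only [Pi.smul_apply, smul_eq_mul]
        ring) t1 t2 t3 t4
  refine ⟨monomialMap 1 plessPerm * blockMonomial m c ε δ f g,
    Subgroup.mul_mem _ (monomialMap_mem _ _) (blockMonomial_mem ..), ?_⟩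
  refine Submodule.eq_of_le_of_finrank_le ?_ ?_
  · rintro _ ⟨x, hx, rfl⟩
    exact hle hx
  · rw [LinearEquiv.finrank_map_eq]
    have := finrank_of_eq_dualCode hD.selfDual
    have := finrank_P48_le
    omega

theorem entries_of_norm_index_four : firstEntry 4 8 = ofTernary 46907 ∧
    secondEntry 4 10 = ofTernary 139482 ∧
    unitOf 10 * star (secondEntry 4 10) = ofTernary 1230 ∧
    -(unitOf 10 * star (firstEntry 4 8)) = ofTernary 61057 := by
  decide +kernel

theorem entries_of_norm_index_ten : firstEntry 10 4 = ofTernary 81660 ∧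
    secondEntry 10 4 = ofTernary 171709 ∧
    unitOf 21 * star (secondEntry 10 4) = ofTernary 111335 ∧
    -(unitOf 21 * star (firstEntry 10 4)) = ofTernary 79068 := by
  decide +kernel

theorem entries_of_norm_index_seventeen : firstEntry 17 8 = ofTernary 130794 ∧
    secondEntry 17 10 = ofTernary 6097 ∧
    unitOf 10 * star (secondEntry 17 10) = ofTernary 99793 ∧
    -(unitOf 10 * star (firstEntry 17 8)) = ofTernary 67449 := by
  decide +kernel

/-- A code in normal form is equivalent to the Pless code. The monomial maps in the three cases
match the block structures that the remaining generator matrices and the Pless code have. -/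
theorem NormalCode.codeEquivalent_P48_of_remainingIndex
    {D : Submodule (ZMod 3) (Fin 48 → ZMod 3)} (hD : NormalCode D) {n i j m : ℕ}
    (h : (n, i, j, m) ∈ remainingIndices) (h1 : HasFirstRow D (firstEntry n i) (secondEntry n j))
    (h2 : HasSecondRow D (unitOf m * star (secondEntry n j))
      (-(unitOf m * star (firstEntry n i)))) : CodeEquivalent D P48 := by
  simp only [remainingIndices, List.mem_cons, List.not_mem_nil, or_false, Prod.mk.injEq] at h
  rcases h with ⟨rfl, rfl, rfl, rfl⟩ | ⟨rfl, rfl, rfl, rfl⟩ | ⟨rfl, rfl, rfl, rfl⟩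
  · obtain ⟨e1, e2, e3, e4⟩ := entries_of_norm_index_four
    rw [e3, e4] at h2
    rw [e1, e2] at h1
    refine hD.codeEquivalent_P48 h1 h2 1 ![0, 6, 8, 9] ![1, -1, -1, -1]
      ![1, -1, -1, -1] (Equiv.swap 1 3) 1 ?_ ?_ ?_ ?_ <;>
    · rw [mem_orderedPless_iff]
      decide +kernel
  · obtain ⟨e1, e2, e3, e4⟩ := entries_of_norm_index_ten
    rw [e3, e4] at h2
    rw [e1, e2] at h1
    refine hD.codeEquivalent_P48 h1 h2 ⟨3, 4, by decide, by decide⟩ ![0, 0, 10, 1] ![1, 1, -1, 1]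
      ![-1, -1, 1, -1] (Equiv.swap 2 3) (Equiv.swap 0 1 * Equiv.swap 1 2) ?_ ?_ ?_ ?_ <;>
    · rw [mem_orderedPless_iff]
      decide +kernel
  · obtain ⟨e1, e2, e3, e4⟩ := entries_of_norm_index_seventeen
    rw [e3, e4] at h2
    rw [e1, e2] at h1
    refine hD.codeEquivalent_P48 h1 h2 1 ![0, 1, 10, 2] ![1, -1, -1, -1]
      ![1, -1, -1, -1] (Equiv.swap 1 2 * Equiv.swap 2 3) (Equiv.swap 1 2) ?_ ?_ ?_ ?_ <;>
    · rw [mem_orderedPless_iff]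
      decide +kernel

theorem NormalCode.codeEquivalent_pless {C : Submodule (ZMod 3) (Fin 48 → ZMod 3)}
    (hC : NormalCode C) : CodeEquivalent C P48 := by
  obtain ⟨D, h1, hD, n, i, j, m, h, h2, h3⟩ := hC.exists_remainingIndex
  exact h1.trans (hD.codeEquivalent_P48_of_remainingIndex h h2 h3)

/-! ### Monomial automorphisms of order 11 -/

theorem monomialMap_pow {F : Type*} [Field F] {n : ℕ} (α : Fin n → Fˣ) (π : Equiv.Perm (Fin n))
    (k : ℕ) : ∃ β : Fin n → Fˣ, monomialMap α π ^ k = monomialMap β (π ^ k) := by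
  induction k with
  | zero => exact ⟨1, by ext v i; simp [monomialMap_apply]⟩
  | succ k ih =>
    obtain ⟨β, hβ⟩ := ih
    refine ⟨fun i => β i * α ((π ^ k)⁻¹ i), LinearEquiv.ext fun v => funext fun i => ?_⟩
    rw [pow_succ, hβ, LinearEquiv.mul_apply, monomialMap_apply, monomialMap_apply,
      monomialMap_apply, Units.val_mul, mul_assoc, pow_succ, mul_inv_rev]
    rfl

theorem perm_eq_one_of_monomialMap_eq_one {F : Type*} [Field F] {n : ℕ} {α : Fin n → Fˣ}
    {π : Equiv.Perm (Fin n)} (h : monomialMap α π = 1) : π = 1 := by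
  ext i
  have h1 := congrFun (congrArg (fun f : (Fin n → F) ≃ₗ[F] (Fin n → F) => f (Pi.single i 1)) h)
    (π i)
  rw [monomialMap_apply, show π⁻¹ (π i) = i from π.symm_apply_apply i, Pi.single_eq_same,
    mul_one] at h1
  change _ = (Pi.single i 1 : Fin n → F) (π i) at h1
  by_contra h0
  rw [Pi.single_eq_of_ne (fun e : π i = i => h0 (congrArg Fin.val e))] at h1
  exact (α (π i)).ne_zero h1

theorem orderOf_perm_eq {α : Fin 48 → (ZMod 3)ˣ} {π : Equiv.Perm (Fin 48)}
    (h : orderOf (monomialMap α π) = 11) : orderOf π = 11 := by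
  have : Fact (Nat.Prime 11) := ⟨by norm_num⟩
  refine orderOf_eq_prime ?_ ?_
  · obtain ⟨β, hβ⟩ := monomialMap_pow α π 11
    rw [← h, pow_orderOf_eq_one, h] at hβ
    exact perm_eq_one_of_monomialMap_eq_one hβ.symm
  · rintro rfl
    have h2 : monomialMap α (1 : Equiv.Perm (Fin 48)) ^ 2 = 1 := by
      have : ∀ a : (ZMod 3)ˣ, (a : ZMod 3) * a = 1 := by decide
      refine LinearEquiv.ext fun v => funext fun i => ?_
      rw [pow_two, LinearEquiv.mul_apply, monomialMap_apply, monomialMap_apply, ← mul_assoc]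
      simp [this]
    have := orderOf_dvd_of_pow_eq_one h2
    rw [h] at this
    omega

/-- A monomial map of order 11 over `𝔽₃` fixes a vector with nonzero coordinates, the product of the
images of the all-ones vector under its powers. -/
theorem exists_fixed_units {α : Fin 48 → (ZMod 3)ˣ} {π : Equiv.Perm (Fin 48)}
    (h : monomialMap α π ^ 11 = 1) :
    ∃ x : Fin 48 → (ZMod 3)ˣ, ∀ i, α i * x (π⁻¹ i) = x i := by
  choose β hβ using fun k => monomialMap_pow α π k
  have hrec : ∀ k i, β (k + 1) i = α i * β k (π⁻¹ i) := by
    intro k i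
    have h1 := congrFun (congrArg (fun f : (Fin 48 → ZMod 3) ≃ₗ[ZMod 3] (Fin 48 → ZMod 3) => f 1)
      ((hβ (k + 1)).symm.trans ((pow_succ' _ k).trans (congrArg _ (hβ k))))) i
    ext
    simpa [monomialMap_apply] using h1
  have h11 : ∀ i, β 11 i = β 0 i := by
    intro i
    have h1 := congrFun (congrArg (fun f : (Fin 48 → ZMod 3) ≃ₗ[ZMod 3] (Fin 48 → ZMod 3) => f 1)
      ((hβ 11).symm.trans (h.trans ((pow_zero _).symm.trans (hβ 0))))) i
    ext
    simpa [monomialMap_apply] using h1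
  refine ⟨fun i => ∏ k ∈ Finset.range 11, β k i, fun i => ?_⟩
  have ha : ∀ a : (ZMod 3)ˣ, a ^ 11 = a := by decide
  calc α i * ∏ k ∈ Finset.range 11, β k (π⁻¹ i)
      = ∏ k ∈ Finset.range 11, β (k + 1) i := by
        simp only [hrec]
        rw [Finset.prod_mul_distrib, Finset.prod_const, Finset.card_range, ha]
    _ = ∏ k ∈ Finset.range 11, β k i := by
        have := (Finset.prod_range_succ (fun k => β k i) 11).symm.trans
          (Finset.prod_range_succ' (fun k => β k i) 11)
        rw [h11] at this
        exact (mul_right_cancel this).symm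

/-- The permutation with `t` cycles of length 11 on the first `11 t` coordinates. -/
def cyclePerm (t : Fin 5) : Equiv.Perm (Fin 48) where
  toFun i := if i.val < 11 * t.val then blockCycle i else i
  invFun i := if i.val < 11 * t.val then blockCycle.symm i else i
  left_inv := by revert t; decide +kernel
  right_inv := by revert t; decide +kernel

theorem cyclePerm_four : cyclePerm 4 = blockCycle := by decide +kernel

theorem exists_conj_cyclePerm {π : Equiv.Perm (Fin 48)} (h : orderOf π = 11) :
    ∃ (t : Fin 5) (ρ : Equiv.Perm (Fin 48)), t ≠ 0 ∧ ρ * π * ρ⁻¹ = cyclePerm t := by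
  have : Fact (Nat.Prime 11) := ⟨by norm_num⟩
  obtain ⟨n, hn⟩ := Equiv.Perm.cycleType_prime_order (σ := π) (by rw [h]; norm_num)
  rw [h] at hn
  have hn4 : n < 4 := by
    have h1 := Equiv.Perm.sum_cycleType π
    rw [hn, Multiset.sum_replicate, smul_eq_mul] at h1
    have := Finset.card_le_univ π.support
    rw [Fintype.card_fin] at this
    omega
  obtain ⟨t, ht0, htn⟩ : ∃ t : Fin 5, t ≠ 0 ∧ t.val = n + 1 :=
    ⟨⟨n + 1, by omega⟩, fun e => by simpa using congrArg Fin.val e, rfl⟩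
  have c1 : ∀ t : Fin 5, cyclePerm t ^ 11 = 1 := by decide +kernel
  have c2 : ∀ t : Fin 5, t ≠ 0 → cyclePerm t ≠ 1 := by decide +kernel
  have c3 : ∀ t : Fin 5, (cyclePerm t).support.card = 11 * t.val := by decide +kernel
  have ht : orderOf (cyclePerm t) = 11 := orderOf_eq_prime (c1 t) (c2 t ht0)
  obtain ⟨k, hk⟩ := Equiv.Perm.cycleType_prime_order (σ := cyclePerm t) (by rw [ht]; norm_num)
  rw [ht] at hk
  have hkn : k = n := by
    have h1 := Equiv.Perm.sum_cycleType (cyclePerm t)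
    rw [hk, Multiset.sum_replicate, smul_eq_mul, c3] at h1
    omega
  subst hkn
  obtain ⟨ρ, hρ⟩ := isConj_iff.mp (Equiv.Perm.isConj_iff_cycleType_eq.mpr (hn.trans hk.symm))
  exact ⟨t, ρ, ht0, hρ⟩

/-- Every monomial map of order 11 is conjugate to a permutation of the coordinates. -/
theorem exists_conj_monomialMap {σ : (Fin 48 → ZMod 3) ≃ₗ[ZMod 3] (Fin 48 → ZMod 3)}
    (hσ : σ ∈ monomialGroup (ZMod 3) 48) (h : orderOf σ = 11) :
    ∃ (t : Fin 5) (τ : (Fin 48 → ZMod 3) ≃ₗ[ZMod 3] (Fin 48 → ZMod 3)), t ≠ 0 ∧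
      τ ∈ monomialGroup (ZMod 3) 48 ∧ τ * σ * τ⁻¹ = monomialMap 1 (cyclePerm t) := by
  obtain ⟨α, π, rfl⟩ := exists_eq_monomialMap hσ
  obtain ⟨x, hx⟩ := exists_fixed_units (α := α) (π := π) (by rw [← h, pow_orderOf_eq_one])
  obtain ⟨t, ρ, ht, hρ⟩ := exists_conj_cyclePerm (orderOf_perm_eq h)
  refine ⟨t, monomialMap (fun i => (x (ρ⁻¹ i))⁻¹) ρ, ht, monomialMap_mem _ _, ?_⟩
  rw [mul_inv_eq_iff_eq_mul]
  refine LinearEquiv.ext fun v => funext fun i => ?_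
  rw [LinearEquiv.mul_apply, LinearEquiv.mul_apply]
  simp only [monomialMap_apply, ← hρ]
  have e : ρ⁻¹ ((ρ * π * ρ⁻¹)⁻¹ i) = π⁻¹ (ρ⁻¹ i) := by
    simp [mul_inv_rev]
  rw [e, ← mul_assoc, Pi.one_apply, Units.val_one, one_mul, ← Units.val_mul]
  congr 2
  rw [← hx (ρ⁻¹ i), mul_inv]
  generalize α (ρ⁻¹ i) = a
  generalize x (π⁻¹ (ρ⁻¹ i)) = b
  revert a b
  decide

/-! ### The number of cycles -/

theorem finrank_le_card_of_eq_zero {F : Type*} [Field F] {n : ℕ} (W : Submodule F (Fin n → F))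
    (S : Finset (Fin n)) (h : ∀ w ∈ W, (∀ i ∈ S, w i = 0) → w = 0) :
    Module.finrank F W ≤ S.card := by
  let f : W →ₗ[F] (S → F) := (LinearMap.funLeft F F Subtype.val).comp W.subtype
  have hf : Function.Injective f := by
    rw [injective_iff_map_eq_zero]
    intro w hw
    exact Subtype.ext (h w w.2 fun i hi => congrFun hw ⟨i, hi⟩)
  have := LinearMap.finrank_le_finrank_of_injective hf
  rwa [Module.finrank_fintype_fun_eq_card, Fintype.card_coe] at this

theorem hammingNorm_le_card {F : Type*} [Zero F] [DecidableEq F] {n : ℕ} {w : Fin n → F}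
    (S : Finset (Fin n)) (h : ∀ i ∉ S, w i = 0) : hammingNorm w ≤ S.card :=
  Finset.card_le_card fun i hi => by
    by_contra hiS
    exact (Finset.mem_filter.mp hi).2 (h i hiS)

theorem finrank_map_add_finrank_inf_ker {F V W : Type*} [Field F] [AddCommGroup V] [Module F V]
    [AddCommGroup W] [Module F W] [FiniteDimensional F V] (D : Submodule F V) (f : V →ₗ[F] W) :
    Module.finrank F (D.map f) + Module.finrank F (D ⊓ f.ker : Submodule F V) =
      Module.finrank F D := by
  have h := LinearMap.finrank_range_add_finrank_ker (f.domRestrict D)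
  rw [LinearMap.range_domRestrict] at h
  rw [← h]
  congr 1
  rw [LinearMap.ker_domRestrict]
  exact (LinearEquiv.finrank_eq (Submodule.comapSubtypeEquivOfLe inf_le_left)).symm.trans
    (by rw [Submodule.comap_inf, Submodule.comap_subtype_self, top_inf_eq])

/-- The vectors fixed by a coordinate permutation with `t` cycles are constant on the cycles. -/
theorem apply_eq_of_cyclePerm_fixed {t : Fin 5} {w : Fin 48 → ZMod 3}
    (hw : monomialMap 1 (cyclePerm t) w = w) (i : Fin 48) (hi : i.val < 11 * t.val) :
    w i = w (Fin.ofNat 48 (11 * (i.val / 11))) := by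
  have h1 : ∀ j, w ((cyclePerm t).symm j) = w j := by
    intro j
    have := congrFun hw j
    rwa [monomialMap_apply, Pi.one_apply, Units.val_one, one_mul] at this
  have h2 : ∀ (k : ℕ) j, w (((cyclePerm t).symm ^ k) j) = w j := by
    intro k
    induction k with
    | zero => intro j; rfl
    | succ k ih => intro j; rw [pow_succ, Equiv.Perm.mul_apply, ih, h1]
  have h3 : ∀ (t : Fin 5) (i : Fin 48), i.val < 11 * t.val →
      ((cyclePerm t).symm ^ (i.val % 11)) i = Fin.ofNat 48 (11 * (i.val / 11)) := by
    decide +kernel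
  rw [← h3 t i hi, h2]

/-- A count of dimensions in `24 = dim (T - 1) D + dim ker (T - 1)` excludes fewer than four cycles.
A word is zero once it vanishes outside 14 coordinates. The image of `T - 1` is supported on the
`11 t` moved coordinates, so its dimension is at most `11 t - 14`; the fixed words are determined by
`t` moved and `34 - 11 t` fixed coordinates. For `t = 2, 3` the sum is at most 23. -/
theorem eq_four_of_map_cyclePerm {D : Submodule (ZMod 3) (Fin 48 → ZMod 3)} (hD : D = dualCode D)
    (hw : ∀ c ∈ D, c ≠ 0 → 15 ≤ hammingNorm c) {t : Fin 5} (ht : t ≠ 0)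
    (hT : ∀ c ∈ D, monomialMap 1 (cyclePerm t) c ∈ D) : t = 4 := by
  by_contra ht4
  have h0 : ∀ (S : Finset (Fin 48)), S.card < 15 → ∀ c ∈ D, (∀ i ∉ S, c i = 0) → c = 0 := by
    intro S hS c hc hcS
    by_contra hc0
    have := hw c hc hc0
    have := hammingNorm_le_card S hcS
    omega
  set f : (Fin 48 → ZMod 3) →ₗ[ZMod 3] (Fin 48 → ZMod 3) :=
    (monomialMap 1 (cyclePerm t)).toLinearMap - LinearMap.id with hf
  have hfa : ∀ c i, f c i = c ((cyclePerm t).symm i) - c i := by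
    intro c i
    rw [hf, LinearMap.sub_apply, Pi.sub_apply, LinearEquiv.coe_coe, monomialMap_apply,
      Pi.one_apply, Units.val_one, one_mul]
    rfl
  have hfix : ∀ i : Fin 48, ¬ i.val < 11 * t.val → (cyclePerm t).symm i = i := by
    intro i hi
    exact if_neg hi
  have hE : ∀ c ∈ D.map f, c ∈ D ∧ ∀ i : Fin 48, ¬ i.val < 11 * t.val → c i = 0 := by
    rintro _ ⟨c, hc, rfl⟩
    refine ⟨D.sub_mem (hT c hc) hc, fun i hi => ?_⟩
    rw [hfa, hfix i hi, sub_self]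
  have hF : ∀ c ∈ D ⊓ f.ker, c ∈ D ∧ monomialMap 1 (cyclePerm t) c = c := by
    rintro c ⟨hc, hc'⟩
    exact ⟨hc, sub_eq_zero.mp hc'⟩
  have hdim := finrank_map_add_finrank_inf_ker D f
  have hD2 := finrank_of_eq_dualCode hD
  have dF : Module.finrank (ZMod 3) (D ⊓ f.ker : Submodule (ZMod 3) (Fin 48 → ZMod 3)) ≤
      (Finset.univ.filter fun i : Fin 48 => (i.val < 11 * t.val ∧ i.val % 11 = 0) ∨
        (11 * t.val ≤ i.val ∧ i.val < 34)).card := by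
    refine finrank_le_card_of_eq_zero _ _ fun c hc hcS => ?_
    obtain ⟨hcD, hc⟩ := hF c hc
    refine h0 (Finset.univ.filter fun i : Fin 48 => 34 ≤ i.val) (by decide) c hcD fun i hi => ?_
    have hi' : i.val < 34 := by simpa using hi
    by_cases hit : i.val < 11 * t.val
    · rw [apply_eq_of_cyclePerm_fixed hc i hit]
      have e : (Fin.ofNat 48 (11 * (i.val / 11))).val = 11 * (i.val / 11) :=
        Nat.mod_eq_of_lt (by omega)
      refine hcS _ (Finset.mem_filter.mpr ⟨Finset.mem_univ _, .inl ?_⟩)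
      rw [e]
      omega
    · exact hcS _ (Finset.mem_filter.mpr ⟨Finset.mem_univ _, .inr ⟨by omega, hi'⟩⟩)
  have dE : Module.finrank (ZMod 3) (D.map f) ≤
      (Finset.univ.filter fun i : Fin 48 => i.val + 14 < 11 * t.val).card := by
    refine finrank_le_card_of_eq_zero _ _ fun c hc hcS => ?_
    obtain ⟨hcD, hc⟩ := hE c hc
    have hcard : ∀ t : Fin 5, (Finset.univ.filter fun i : Fin 48 =>
      i.val < 11 * t.val ∧ 11 * t.val ≤ i.val + 14).card < 15 := by decide +kernel
    refine h0 (Finset.univ.filter fun i : Fin 48 => i.val < 11 * t.val ∧ 11 * t.val ≤ i.val + 14)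
      (hcard t) c hcD fun i hi => ?_
    by_cases hit : i.val < 11 * t.val
    · refine hcS _ (Finset.mem_filter.mpr ⟨Finset.mem_univ _, ?_⟩)
      by_contra hlt
      exact hi (Finset.mem_filter.mpr ⟨Finset.mem_univ _, hit, by omega⟩)
    · exact hc i hit
  have htc : t = 1 ∨ t = 2 ∨ t = 3 := by omega
  rcases htc with rfl | rfl | rfl
  · -- A code on which a single cycle acts trivially has a word of weight 2 in its dual.
    have hE0 : ∀ c ∈ D, c 0 = c 1 := by
      intro c hc
      obtain ⟨h1, h2⟩ := hE (f c) ⟨c, hc, rfl⟩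
      have h3 := h0 (Finset.univ.filter fun i : Fin 48 => i.val < 11) (by decide) _ h1
        fun i hi => h2 i (by simpa using hi)
      have h4 := congrFun h3 1
      rw [hfa, show (cyclePerm 1).symm 1 = 0 by decide +kernel] at h4
      exact sub_eq_zero.mp h4
    have hy : (Pi.single 0 1 - Pi.single 1 1 : Fin 48 → ZMod 3) ∈ D :=
      mem_of_forall_dotProduct hD fun c hc => by
        rw [dotProduct_sub, dotProduct_single, dotProduct_single, hE0 c hc, sub_self]
    have := h0 {0, 1} (by decide) _ hy fun i hi => by
      simp only [Finset.mem_insert, Finset.mem_singleton, not_or] at hi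
      simp [Pi.single_eq_of_ne hi.1, Pi.single_eq_of_ne hi.2]
    exact absurd (congrFun this 0) (by decide)
  · have c1 : (Finset.univ.filter fun i : Fin 48 => (i.val < 11 * (2 : Fin 5).val ∧ i.val % 11 = 0)
      ∨ (11 * (2 : Fin 5).val ≤ i.val ∧ i.val < 34)).card = 14 := by decide +kernel
    have c2 : (Finset.univ.filter fun i : Fin 48 => i.val + 14 < 11 * (2 : Fin 5).val).card = 8 := by
      decide +kernel
    omega
  · have c1 : (Finset.univ.filter fun i : Fin 48 => (i.val < 11 * (3 : Fin 5).val ∧ i.val % 11 = 0)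
      ∨ (11 * (3 : Fin 5).val ≤ i.val ∧ i.val < 34)).card = 4 := by decide +kernel
    have c2 : (Finset.univ.filter fun i : Fin 48 => i.val + 14 < 11 * (3 : Fin 5).val).card = 19 := by
      decide +kernel
    omega

/-! ### Reduction to the normal form -/

theorem monomialMap_one_apply (π : Equiv.Perm (Fin 48)) (v : Fin 48 → ZMod 3) :
    monomialMap 1 π v = v ∘ π.symm := by
  funext i
  rw [monomialMap_apply, Pi.one_apply, Units.val_one, one_mul]
  rfl

theorem blockCycle_word (b : Fin 4 → Circ) (r : Fin 4 → ZMod 3) :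
    monomialMap 1 blockCycle (word b r) = word (fun p => shift 1 * b p) r := by
  rw [monomialMap_one_apply, word_shift_mul]

theorem blockMonomial_one_mul_blockCycle (c : Fin 4 → ZMod 11) (ε δ : Fin 4 → (ZMod 3)ˣ)
    (f g : Equiv.Perm (Fin 4)) : blockMonomial 1 c ε δ f g * monomialMap 1 blockCycle =
      monomialMap 1 blockCycle * blockMonomial 1 c ε δ f g := by
  refine LinearEquiv.ext fun v => ?_
  obtain ⟨b, r, rfl⟩ := exists_eq_word v
  rw [LinearEquiv.mul_apply, LinearEquiv.mul_apply, blockCycle_word, blockMonomial_word,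
    blockMonomial_word, blockCycle_word, word_inj]
  refine ⟨funext fun p => ?_, rfl⟩
  rw [mult_mul, mult_shift, Units.val_one, one_mul, mul_smul_comm, mul_left_comm]

/-- A `4 × 4` matrix with orthogonal rows of signs becomes `fixedRight` by changing signs of rows
and columns and permuting the columns. -/
theorem exists_eq_fixedRight {h : Fin 4 → Fin 4 → (ZMod 3)ˣ}
    (ho : ∀ i j, i ≠ j → ∑ k, (h i k : ZMod 3) * h j k = 0) :
    ∃ (ε δ : Fin 4 → (ZMod 3)ˣ) (g : Equiv.Perm (Fin 4)),
      ∀ i j, (δ j : ZMod 3) * h i j = ε i * fixedRight i (g j) := by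
  have key : ∀ a b c : Fin 3 → (ZMod 3)ˣ, (1 + a 0 + a 1 + a 2 : ZMod 3) = 0 ∧
      (1 + b 0 + b 1 + b 2 : ZMod 3) = 0 ∧ (1 + c 0 + c 1 + c 2 : ZMod 3) = 0 ∧
      (1 + a 0 * b 0 + a 1 * b 1 + a 2 * b 2 : ZMod 3) = 0 ∧
      (1 + a 0 * c 0 + a 1 * c 1 + a 2 * c 2 : ZMod 3) = 0 ∧
      (1 + b 0 * c 0 + b 1 * c 1 + b 2 * c 2 : ZMod 3) = 0 →
      ∃ g : Equiv.Perm (Fin 4), ∀ j : Fin 4,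
        (![1, a 0, a 1, a 2] j : ZMod 3) = fixedRight 1 (g j) ∧
        (![1, b 0, b 1, b 2] j : ZMod 3) = fixedRight 2 (g j) ∧
        (![1, c 0, c 1, c 2] j : ZMod 3) = fixedRight 3 (g j) := by
    decide +kernel
  have hsq : ∀ a : (ZMod 3)ˣ, (a : ZMod 3) * a = 1 := by decide
  -- The entries after normalizing the first row and the first column.
  let n : Fin 4 → Fin 4 → (ZMod 3)ˣ := fun i j => h i 0 * h 0 0 * (h 0 j * h i j)
  have n0 : ∀ i, (n i 0 : ZMod 3) = 1 := by
    intro i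
    push_cast [n]
    linear_combination (h 0 0 : ZMod 3) * h 0 0 * hsq (h i 0) + hsq (h 0 0)
  have ns : ∀ i, i ≠ 0 → (1 + n i 1 + n i 2 + n i 3 : ZMod 3) = 0 := by
    intro i hi
    have := ho 0 i hi.symm
    rw [Fin.sum_univ_four] at this
    rw [← n0 i]
    push_cast [n]
    linear_combination (h i 0 : ZMod 3) * h 0 0 * this
  have nn : ∀ i j, i ≠ j → (1 + n i 1 * n j 1 + n i 2 * n j 2 + n i 3 * n j 3 : ZMod 3) = 0 := by
    intro i j hij
    have := ho i j hij
    rw [Fin.sum_univ_four] at this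
    have e : (1 : ZMod 3) = n i 0 * n j 0 := by rw [n0, n0, one_mul]
    rw [e]
    have e1 : ∀ k, (n i k * n j k : ZMod 3) = h i 0 * h j 0 * (h i k * h j k) := by
      intro k
      push_cast [n]
      linear_combination (h i 0 : ZMod 3) * h j 0 * (h i k * h j k) * hsq (h 0 0) +
        (h i 0 : ZMod 3) * h j 0 * (h i k * h j k) * h 0 0 * h 0 0 * hsq (h 0 k)
    simp only [e1]
    linear_combination (h i 0 : ZMod 3) * h j 0 * this
  obtain ⟨g, hg⟩ := key (fun k => n 1 k.succ) (fun k => n 2 k.succ) (fun k => n 3 k.succ)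
    ⟨ns 1 (by decide), ns 2 (by decide), ns 3 (by decide), nn 1 2 (by decide), nn 1 3 (by decide),
      nn 2 3 (by decide)⟩
  have hn : ∀ i j, (n i j : ZMod 3) = fixedRight i (g j) := by
    intro i j
    have e : ∀ i j, (n i j : ZMod 3) = (![1, n i 1, n i 2, n i 3] j : (ZMod 3)ˣ) := by
      intro i j
      fin_cases j
      · exact n0 i
      · rfl
      · rfl
      · rfl
    fin_cases i
    · have h1 : (n 0 j : ZMod 3) = 1 := by
        push_cast [n]
        linear_combination (h 0 j : ZMod 3) * h 0 j * hsq (h 0 0) + hsq (h 0 j)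
      have h2 : ∀ k, fixedRight 0 k = 1 := by decide
      exact h1.trans (h2 _).symm
    · exact (e 1 j).trans (hg j).1
    · exact (e 2 j).trans (hg j).2.1
    · exact (e 3 j).trans (hg j).2.2
  refine ⟨fun i => h i 0 * h 0 0, fun j => h 0 j, g, fun i j => ?_⟩
  rw [← hn]
  push_cast [n]
  linear_combination (-(h 0 j : ZMod 3) * h i j) * hsq (h i 0) -
    (h 0 j : ZMod 3) * h i j * h i 0 * h i 0 * hsq (h 0 0)

/-- The fixed code contains, for each of the four blocks, a word that is constant on this block and
vanishes on the other three. Its weight is at least 15, which forces nonzero values on all of the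
last four coordinates; these values form a matrix of signs with orthogonal rows. -/
theorem exists_fixed_rows {D : Submodule (ZMod 3) (Fin 48 → ZMod 3)} (hD : D = dualCode D)
    (hw : ∀ c ∈ D, c ≠ 0 → 15 ≤ hammingNorm c)
    (hT : ∀ b r, word b r ∈ D → word (fun p => shift 1 * b p) r ∈ D) :
    ∃ h : Fin 4 → Fin 4 → (ZMod 3)ˣ, (∀ i, word (Pi.single i J) (fun j => h i j) ∈ D) ∧
      ∀ i j, i ≠ j → ∑ k, (h i k : ZMod 3) * h j k = 0 := by
  have hright : ∀ r, word 0 r ∈ D → r = 0 := by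
    intro r hr
    by_contra h0
    have h1 := hw _ hr fun h2 => h0 (word_eq_zero.mp h2).2
    rw [hammingNorm_word] at h1
    have h2 : hammingNorm r ≤ 4 := by simpa using hammingNorm_le_card_fintype (x := r)
    have h3 : ∀ p : Fin 4, ((0 : Fin 4 → Circ) p).weight = 0 := fun p => by simp [Circ.weight]
    simp only [h3, Finset.sum_const_zero] at h1
    omega
  -- Every vector of length four is the right part of a fixed word: take any word with the negative
  -- right part and sum over the group.
  have hsurj : ∀ y : Fin 4 → ZMod 3, ∃ x : Fin 4 → ZMod 3, word (fun p => x p • J) y ∈ D := by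
    intro y
    obtain ⟨c, hc, hcy⟩ := exists_mem_eqOn hD {k | ∃ j, k = coordEquiv (.inr j)}
      (fun c hc h => by
        obtain ⟨b, r, rfl⟩ := exists_eq_word c
        have hb : b = 0 := by
          funext p
          ext i
          have := h (coordEquiv (.inl (p, i))) (by simp)
          simpa using this
        subst hb
        rw [hright r hc, word_zero]) (word 0 (-y))
    obtain ⟨b, r, rfl⟩ := exists_eq_word c
    have hr : r = -y := by
      funext j
      simpa using hcy (coordEquiv (.inr j)) ⟨j, rfl⟩
    have h1 := word_mul_mem hT hc J
    rw [hr, aug_J, neg_smul, one_smul, neg_neg] at h1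
    refine ⟨fun p => aug (b p), ?_⟩
    simpa only [mul_comm J, mul_J] using h1
  choose X hX using hsurj
  have hinj : Function.Injective X := by
    intro y y' e
    have h1 := D.sub_mem (hX y) (hX y')
    rw [word_sub, e, sub_self] at h1
    exact sub_eq_zero.mp (hright _ h1)
  have hrow : ∀ i : Fin 4, ∃ y, word (Pi.single i J) y ∈ D := by
    intro i
    obtain ⟨y, hy⟩ := Finite.injective_iff_surjective.mp hinj (Pi.single i 1)
    have := hX y
    rw [hy] at this
    refine ⟨y, (congrArg (· ∈ D) (word_inj.mpr ⟨funext fun p => ?_, rfl⟩)).mp this⟩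
    by_cases hp : p = i
    · subst hp
      simp
    · simp [Pi.single_eq_of_ne hp]
  choose y hy using hrow
  have hne : ∀ i j, y i j ≠ 0 := by
    intro i j h0
    have hJ : J ≠ 0 := by decide
    have h1 := hw _ (hy i) fun h => hJ (by simpa using congrFun (word_eq_zero.mp h).1 i)
    rw [hammingNorm_word, Finset.sum_eq_single i
      (fun p _ hp => by simp [Pi.single_eq_of_ne hp, Circ.weight]) (by simp), Pi.single_eq_same,
      show J.weight = 11 by decide] at h1
    have h2 : hammingNorm (y i) ≤ ({j}ᶜ : Finset (Fin 4)).card := hammingNorm_le_card _ fun k hk => by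
      have : k = j := by simpa using hk
      rw [this, h0]
    rw [Finset.card_compl, Finset.card_singleton, Fintype.card_fin] at h2
    omega
  refine ⟨fun i j => Units.mk0 (y i j) (hne i j), hy, fun i j hij => ?_⟩
  have h1 := dotProduct_eq_zero_of_mem hD (hy i) (hy j)
  rw [word_dotProduct_word, Finset.sum_eq_zero, zero_add] at h1
  · exact h1
  · intro p _
    by_cases hp : p = i
    · subst hp
      simp [Pi.single_eq_of_ne hij]
    · simp [Pi.single_eq_of_ne hp]

/-- An extremal code with an automorphism of order 11 has a normal form in which the automorphism is
the permutation `blockCycle`. -/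
theorem exists_normalCode {C : Submodule (ZMod 3) (Fin 48 → ZMod 3)} (hC : C = dualCode C)
    (hw : ∀ c ∈ C, c ≠ 0 → 15 ≤ hammingNorm c)
    {σ : (Fin 48 → ZMod 3) ≃ₗ[ZMod 3] (Fin 48 → ZMod 3)} (hσ : σ ∈ monomialAut C)
    (hord : orderOf σ = 11) : ∃ τ ∈ monomialGroup (ZMod 3) 48,
      τ * σ * τ⁻¹ = monomialMap 1 blockCycle ∧
      NormalCode (C.map (τ : (Fin 48 → ZMod 3) →ₗ[ZMod 3] (Fin 48 → ZMod 3))) := by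
  obtain ⟨t, τ, ht, hτ, e⟩ := exists_conj_monomialMap hσ.1 hord
  set D := C.map (τ : (Fin 48 → ZMod 3) →ₗ[ZMod 3] (Fin 48 → ZMod 3)) with hDC
  have hD : D = dualCode D := by rw [hDC, dualCode_map hτ, ← hC]
  have hDw : ∀ c ∈ D, c ≠ 0 → 15 ≤ hammingNorm c := by
    rintro _ ⟨c, hc, rfl⟩ h0
    rw [LinearEquiv.coe_coe, hammingNorm_monomialMap hτ]
    exact hw c hc fun h1 => h0 (by rw [h1, map_zero])
  have hT : ∀ c ∈ D, monomialMap 1 (cyclePerm t) c ∈ D := by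
    rintro _ ⟨c, hc, rfl⟩
    refine ⟨σ c, ?_, ?_⟩
    · rw [← hσ.2]
      exact ⟨c, hc, rfl⟩
    · have := congrArg (fun f : (Fin 48 → ZMod 3) ≃ₗ[ZMod 3] (Fin 48 → ZMod 3) => f c)
        (mul_inv_eq_iff_eq_mul.mp e)
      exact this
  obtain rfl := eq_four_of_map_cyclePerm hD hDw ht hT
  rw [cyclePerm_four] at e hT
  have hS : ∀ b r, word b r ∈ D → word (fun p => shift 1 * b p) r ∈ D := by
    intro b r h
    rw [← blockCycle_word]
    exact hT _ h
  obtain ⟨h, hrow, hortho⟩ := exists_fixed_rows hD hDw hS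
  obtain ⟨ε, δ, g, hεδ⟩ := exists_eq_fixedRight hortho
  have hB := blockMonomial_mem 1 0 ε δ 1 g
  have hcomm := blockMonomial_one_mul_blockCycle 0 ε δ 1 g
  have hmap : C.map ((blockMonomial 1 0 ε δ 1 g * τ :
      (Fin 48 → ZMod 3) ≃ₗ[ZMod 3] (Fin 48 → ZMod 3)) :
      (Fin 48 → ZMod 3) →ₗ[ZMod 3] (Fin 48 → ZMod 3)) =
      D.map (blockMonomial 1 0 ε δ 1 g : (Fin 48 → ZMod 3) →ₗ[ZMod 3] (Fin 48 → ZMod 3)) := by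
    rw [hDC, ← Submodule.map_comp]
    rfl
  refine ⟨blockMonomial 1 0 ε δ 1 g * τ, mul_mem hB hτ, ?_, ?_⟩
  · calc blockMonomial 1 0 ε δ 1 g * τ * σ * (blockMonomial 1 0 ε δ 1 g * τ)⁻¹
        = blockMonomial 1 0 ε δ 1 g * (τ * σ * τ⁻¹) * (blockMonomial 1 0 ε δ 1 g)⁻¹ := by group
      _ = _ := by rw [e, hcomm, mul_inv_cancel_right]
  · rw [hmap]
    refine ⟨?_, ?_, ?_, ?_⟩
    · rw [dualCode_map hB, ← hD]
    · rintro _ ⟨c, hc, rfl⟩ h0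
      rw [LinearEquiv.coe_coe, hammingNorm_monomialMap hB]
      exact hDw c hc fun h1 => h0 (by rw [h1, map_zero])
    · rintro b r ⟨c, hc, hcb⟩
      refine ⟨monomialMap 1 blockCycle c, hT c hc, ?_⟩
      rw [← blockCycle_word, ← hcb]
      exact congrArg (fun f : (Fin 48 → ZMod 3) ≃ₗ[ZMod 3] (Fin 48 → ZMod 3) => f c) hcomm
    · intro i
      have hsq : ∀ a : (ZMod 3)ˣ, (a : ZMod 3) * a = 1 := by decide
      refine ⟨_, D.smul_mem (ε i : ZMod 3) (hrow i), ?_⟩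
      rw [LinearEquiv.coe_coe, map_smul, blockMonomial_word, word_smul, word_inj]
      refine ⟨funext fun p => ?_, funext fun j => ?_⟩
      · have h1 : ∀ x, mult 1 x = x := fun x => by ext i; simp
        have h2 : (1 : Equiv.Perm (Fin 4)).symm p = p := rfl
        by_cases hp : p = i
        · subst hp
          simp [h1, h2, shift_zero, smul_smul, hsq]
        · simp [h1, h2, shift_zero, Pi.single_eq_of_ne hp]
      · rw [Pi.smul_apply, hεδ, smul_eq_mul, ← mul_assoc, hsq, one_mul]
        exact congrArg (fixedRight i) (g.apply_symm_apply j)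

/-! ### The fixed code -/

theorem fixedGenerator_eq_word (i : Fin 4) :
    fixedGenerator i = word (Pi.single i J) (fixedRight i) := by
  have h1 : ∀ x : Fin 4 × Fin 4 × ZMod 11, fixedGenerator x.1 (coordEquiv (.inl x.2)) =
      (Pi.single (M := fun _ => Circ) x.1 J x.2.1) x.2.2 := by decide +kernel
  have h2 : ∀ x : Fin 4 × Fin 4, fixedGenerator x.1 (coordEquiv (.inr x.2)) =
      fixedRight x.1 x.2 := by decide +kernel
  exact (eq_word_iff _ _ _).mpr ⟨fun p k => h1 (i, p, k), fun j => h2 (i, j)⟩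

theorem NormalCode.fixedCode_eq {D : Submodule (ZMod 3) (Fin 48 → ZMod 3)} (hD : NormalCode D) :
    fixedCode D (monomialMap 1 blockCycle) =
      Submodule.span (ZMod 3) (Set.range fun r => fixedGenerator r) := by
  apply le_antisymm
  · rintro v ⟨hv, hv'⟩
    obtain ⟨b, r, rfl⟩ := exists_eq_word v
    have h1 : word (fun p => shift 1 * b p) r = word b r := by
      rw [← blockCycle_word]
      exact hv'
    have h2 : ∀ p, b p = b p 0 • J := fun p =>
      eq_smul_J_of_shift (congrFun (word_inj.mp h1).1 p)
    have h3 : ∑ i, b i 0 • fixedGenerator i = word b (∑ i, b i 0 • fixedRight i) := by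
      simp only [fixedGenerator_eq_word, word_smul, Fin.sum_univ_four, word_add]
      rw [word_inj]
      refine ⟨funext fun p => ?_, rfl⟩
      rw [h2 p]
      fin_cases p <;> simp
    have h4 : word 0 (r - ∑ i, b i 0 • fixedRight i) ∈ D := by
      have := D.sub_mem hv (D.sum_mem fun i (_ : i ∈ Finset.univ) =>
        D.smul_mem (b i 0) (hD.fixed_mem i))
      simp only [← fixedGenerator_eq_word] at this
      rwa [h3, word_sub, sub_self] at this
    rw [sub_eq_zero.mp (hD.right_eq_zero h4), ← h3]
    exact Submodule.sum_mem _ fun i _ =>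
      Submodule.smul_mem _ _ (Submodule.subset_span ⟨i, rfl⟩)
  · rw [Submodule.span_le]
    rintro _ ⟨i, rfl⟩
    dsimp only
    rw [fixedGenerator_eq_word]
    refine ⟨hD.fixed_mem i, ?_⟩
    change monomialMap 1 blockCycle _ = word _ _
    rw [blockCycle_word, word_inj]
    refine ⟨funext fun p => ?_, rfl⟩
    by_cases hp : p = i
    · subst hp
      rw [Pi.single_eq_same, shift_mul_J]
    · rw [Pi.single_eq_of_ne hp, mul_zero]

theorem finrank_span_fixedGenerator :
    Module.finrank (ZMod 3) (Submodule.span (ZMod 3) (Set.range fun r => fixedGenerator r)) = 4 := by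
  have h : LinearIndependent (ZMod 3) fun r => fixedGenerator r := by
    rw [Fintype.linearIndependent_iff]
    intro c hc i
    have h1 := congrFun hc (coordEquiv (.inl (i, 0)))
    rw [Finset.sum_apply, Finset.sum_eq_single i] at h1
    · simpa [fixedGenerator_eq_word] using h1
    · intro j _ hj
      simp [fixedGenerator_eq_word, Pi.single_eq_of_ne hj.symm]
    · simp
  rw [finrank_span_eq_card h, Fintype.card_fin]

theorem fixedCode_map {F : Type*} [Field F] {n : ℕ} (C : Submodule F (Fin n → F))
    (σ τ : (Fin n → F) ≃ₗ[F] (Fin n → F)) :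
    fixedCode (C.map (τ : (Fin n → F) →ₗ[F] (Fin n → F))) (τ * σ * τ⁻¹) =
      (fixedCode C σ).map (τ : (Fin n → F) →ₗ[F] (Fin n → F)) := by
  have e : ∀ c, (τ * σ * τ⁻¹) (τ c) = τ (σ c) := fun c =>
    congrArg (fun x => τ (σ x)) (τ.symm_apply_apply c)
  ext v
  constructor
  · rintro ⟨⟨c, hc, rfl⟩, h⟩
    exact ⟨c, ⟨hc, τ.injective ((e c).symm.trans h)⟩, rfl⟩
  · rintro ⟨c, ⟨hc, h⟩, rfl⟩
    exact ⟨⟨c, hc, rfl⟩, (e c).trans (congrArg τ h)⟩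

/-! ### Components of linear maps -/

section

variable {F V : Type*} [Field F] [AddCommGroup V] [Module F V]

theorem aeval_apply_mem {D : Submodule F V} {A : Module.End F V} (hA : ∀ v ∈ D, A v ∈ D)
    (p : F[X]) {v : V} (hv : v ∈ D) : aeval A p v ∈ D := by
  induction p using Polynomial.induction_on' with
  | add p q hp hq => rw [map_add]; exact D.add_mem hp hq
  | monomial k a =>
    rw [aeval_monomial, Module.End.mul_apply, Module.algebraMap_end_apply]
    refine D.smul_mem _ ?_
    induction k with
    | zero => exact hv
    | succ k ih => rw [pow_succ', Module.End.mul_apply]; exact hA _ ih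

theorem aeval_apply_of_semiconj {W : Type*} [AddCommGroup W] [Module F W] {A : Module.End F V}
    {B : Module.End F W} {τ : V →ₗ[F] W} (h : ∀ v, B (τ v) = τ (A v)) (p : F[X]) (v : V) :
    aeval B p (τ v) = τ (aeval A p v) := by
  induction p using Polynomial.induction_on' with
  | add p q hp hq => simp only [map_add, LinearMap.add_apply, hp, hq]
  | monomial k a =>
    simp only [aeval_monomial, Module.End.mul_apply, Module.algebraMap_end_apply, map_smul]
    congr 1
    induction k with
    | zero => rfl
    | succ k ih => rw [pow_succ', pow_succ', Module.End.mul_apply, Module.End.mul_apply, ih, h]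

/-- The image of `e`, where `e` acts as the identity on the kernel of `q` and `q e = 0`. -/
theorem map_aeval_eq_inf_ker {D : Submodule F V} {A : Module.End F V} (hA : ∀ v ∈ D, A v ∈ D)
    {e q r : F[X]} (h1 : aeval A (q * e) = 0) (h2 : 1 = e + r * q) :
    D.map (aeval A e) = D ⊓ (aeval A q).ker := by
  ext v
  constructor
  · rintro ⟨w, hw, rfl⟩
    refine ⟨aeval_apply_mem hA _ hw, ?_⟩
    change aeval A q (aeval A e w) = 0
    rw [← Module.End.mul_apply, ← map_mul, h1, LinearMap.zero_apply]
  · rintro ⟨hv, hv'⟩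
    refine ⟨v, hv, ?_⟩
    have h3 := congrArg (fun p => aeval A p v) h2
    simp only [map_one, Module.End.one_apply, map_add, map_mul, LinearMap.add_apply,
      Module.End.mul_apply, LinearMap.mem_ker.mp hv', map_zero, add_zero] at h3
    exact h3.symm

/-- A space of dimension `d · deg g` on which `σ` satisfies the irreducible polynomial `g` has
dimension `d` over `F[X]/(g)`. -/
theorem hasEigenDimension_of_finrank {F : Type*} [Field F] {n : ℕ} {M : Submodule F (Fin n → F)}
    {σ : (Fin n → F) ≃ₗ[F] (Fin n → F)} {g : F[X]} {d : ℕ} (hg : Irreducible g)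
    (hσ : ∀ v ∈ M, σ v ∈ M)
    (hM : ∀ v ∈ M, aeval (σ : (Fin n → F) →ₗ[F] (Fin n → F)) g v = 0)
    (hd : Module.finrank F M = d * g.natDegree) : HasEigenDimension M σ g d := by
  let a : Module.End F M := (σ : (Fin n → F) →ₗ[F] (Fin n → F)).restrict hσ
  have ha : aeval a g = 0 := by
    ext v : 2
    have := aeval_apply_of_semiconj (A := a) (B := (σ : (Fin n → F) →ₗ[F] (Fin n → F)))
      (τ := M.subtype) (fun _ => rfl) g v
    exact this.symm.trans (hM v v.2)
  let ρ : AdjoinRoot g →+* Module.End F M :=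
    Ideal.Quotient.lift (Ideal.span {g}) (aeval a).toRingHom fun p hp => by
      obtain ⟨q, rfl⟩ := Ideal.mem_span_singleton.mp hp
      change aeval a (g * q) = 0
      rw [map_mul, ha, zero_mul]
  have hρ : ∀ p : F[X], ρ (AdjoinRoot.mk g p) = aeval a p := fun p => rfl
  have : Fact (Irreducible g) := ⟨hg⟩
  let _ : Module (AdjoinRoot g) M := Module.compHom M ρ
  have hsmul : ∀ (x : AdjoinRoot g) (m : M), x • m = ρ x m := fun _ _ => rfl
  have hst : IsScalarTower F (AdjoinRoot g) M := by
    refine ⟨fun r x m => ?_⟩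
    have h1 : r • x = AdjoinRoot.mk g (C r) * x := by
      rw [AdjoinRoot.mk_C, Algebra.smul_def]
      rfl
    rw [hsmul, hsmul, h1, map_mul, hρ, aeval_C, Module.End.mul_apply, Module.algebraMap_end_apply]
  have hfin : Module.Finite (AdjoinRoot g) M := Module.Finite.of_restrictScalars_finite F _ _
  have hK : Module.finrank F (AdjoinRoot g) = g.natDegree := finrank_quotient_span_eq_natDegree
  have hdim : Module.finrank (AdjoinRoot g) M = d := by
    have h1 := Module.finrank_mul_finrank F (AdjoinRoot g) M
    rw [hK, hd, mul_comm] at h1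
    exact Nat.eq_of_mul_eq_mul_right (Irreducible.natDegree_pos hg) h1
  let φ : (Fin d → AdjoinRoot g) ≃ₗ[AdjoinRoot g] M :=
    LinearEquiv.ofFinrankEq _ _ (by rw [Module.finrank_fin_fun, hdim])
  refine ⟨φ.restrictScalars F, fun x => ?_⟩
  have h1 : φ (AdjoinRoot.root g • x) = a (φ x) := by
    rw [map_smul, hsmul, ← AdjoinRoot.mk_X, hρ, aeval_X]
  exact congrArg Subtype.val h1

/-! ### The factors of the cyclotomic polynomial -/

theorem mul_eq_cyclotomic_eleven {g h : (ZMod 3)[X]} (hgh : X ^ 11 - 1 = (X - 1) * g * h) :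
    g * h = cyclotomic 11 (ZMod 3) := by
  have : Fact (Nat.Prime 11) := ⟨by norm_num⟩
  have h1 : (X - 1 : (ZMod 3)[X]) ≠ 0 := by simpa using X_sub_C_ne_zero (1 : ZMod 3)
  apply mul_left_cancel₀ h1
  rw [← mul_assoc, ← hgh, ← cyclotomic_prime_mul_X_sub_one, mul_comm]

theorem cyclotomic_eleven_eq : cyclotomic 11 (ZMod 3) =
    (X ^ 5 + X ^ 4 - X ^ 3 + X ^ 2 - 1) * (X ^ 5 - X ^ 3 + X ^ 2 - X - 1) := by
  have : Fact (Nat.Prime 11) := ⟨by norm_num⟩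
  have h3 : (3 : (ZMod 3)[X]) = 0 := by
    have := CharP.cast_eq_zero (ZMod 3)[X] 3
    exact_mod_cast this
  rw [cyclotomic_prime]
  simp only [Finset.sum_range_succ, Finset.sum_range_zero]
  linear_combination (X ^ 8 + X ^ 2 + 2 * X ^ 5) * h3

/-- The two factors of the cyclotomic polynomial are reciprocal to each other, up to units. -/
theorem exists_aeval_pow_ten_mul {g h : (ZMod 3)[X]} (hg : Irreducible g)
    (hgh : g * h = cyclotomic 11 (ZMod 3)) {R : Type*} [Ring R] [Algebra (ZMod 3) R] {A : R}
    (hA : A ^ 11 = 1) : ∃ c : ZMod 3, aeval (A ^ 10) h * A ^ 5 = c • aeval A g := by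
  have hdeg := natDegree_of_dvd_cyclotomic_eleven hg ⟨h, hgh.symm⟩
  have key : ∀ p q : (ZMod 3)[X], cyclotomic 11 (ZMod 3) = p * q → p.natDegree = 5 →
      aeval (A ^ 10) q * A ^ 5 = -aeval A p → g ∣ p →
      ∃ c : ZMod 3, aeval (A ^ 10) h * A ^ 5 = c • aeval A g := by
    rintro p q hpq hp hq ⟨k, rfl⟩
    have hgk : g * k ≠ 0 := fun h0 => by simp [h0] at hp
    have hk : k.natDegree = 0 := by
      rw [natDegree_mul hg.ne_zero (right_ne_zero_of_mul hgk), hdeg] at hp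
      omega
    obtain ⟨u, rfl⟩ := natDegree_eq_zero.mp hk
    have hh : h = C u * q := mul_left_cancel₀ hg.ne_zero (by rw [hgh, hpq, mul_assoc])
    refine ⟨-(u * u), ?_⟩
    rw [hh, map_mul, aeval_C, mul_assoc, hq, map_mul, aeval_C, Algebra.algebraMap_eq_smul_one,
      mul_smul_comm, mul_one, smul_one_mul, smul_neg, smul_smul, neg_smul]
  have red : ∀ n, A ^ n = A ^ (n % 11) := fun n => pow_eq_pow_mod n hA
  have e1 : aeval (A ^ 10) (X ^ 5 - X ^ 3 + X ^ 2 - X - 1 : (ZMod 3)[X]) * A ^ 5 =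
      -aeval A (X ^ 5 + X ^ 4 - X ^ 3 + X ^ 2 - 1 : (ZMod 3)[X]) := by
    simp only [map_add, map_sub, map_pow, aeval_X, map_one, ← pow_mul, sub_mul, add_mul, one_mul,
      ← pow_add]
    rw [red (10 * 5 + 5), red (10 * 3 + 5), red (10 * 2 + 5), red (10 + 5)]
    norm_num
    abel
  have e2 : aeval (A ^ 10) (X ^ 5 + X ^ 4 - X ^ 3 + X ^ 2 - 1 : (ZMod 3)[X]) * A ^ 5 =
      -aeval A (X ^ 5 - X ^ 3 + X ^ 2 - X - 1 : (ZMod 3)[X]) := by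
    simp only [map_add, map_sub, map_pow, aeval_X, map_one, ← pow_mul, sub_mul, add_mul, one_mul,
      ← pow_add]
    rw [red (10 * 5 + 5), red (10 * 4 + 5), red (10 * 3 + 5), red (10 * 2 + 5)]
    norm_num
    abel
  have hdvd : g ∣ (X ^ 5 + X ^ 4 - X ^ 3 + X ^ 2 - 1) * (X ^ 5 - X ^ 3 + X ^ 2 - X - 1) := by
    rw [← cyclotomic_eleven_eq]
    exact ⟨h, hgh.symm⟩
  rcases hg.prime.dvd_or_dvd hdvd with h1 | h1
  · exact key _ _ cyclotomic_eleven_eq (by compute_degree!) e1 h1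
  · exact key _ _ (cyclotomic_eleven_eq.trans (mul_comm _ _)) (by compute_degree!) e2 h1

/-! ### Orthogonality of the components -/

section

variable {n : ℕ} {A : Module.End (ZMod 3) (Fin n → ZMod 3)}

theorem aeval_dotProduct (hA : A ^ 11 = 1) (hiso : ∀ u v, A u ⬝ᵥ A v = u ⬝ᵥ v) (p : (ZMod 3)[X])
    (u v : Fin n → ZMod 3) : aeval A p u ⬝ᵥ v = u ⬝ᵥ aeval (A ^ 10) p v := by
  have h1 : ∀ u v, A u ⬝ᵥ v = u ⬝ᵥ (A ^ 10) v := by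
    intro u v
    rw [← hiso u, ← Module.End.mul_apply, ← pow_succ', hA, Module.End.one_apply]
  induction p using Polynomial.induction_on' with
  | add p q hp hq => simp only [map_add, LinearMap.add_apply, add_dotProduct, dotProduct_add, hp, hq]
  | monomial k a =>
    simp only [aeval_monomial, Module.End.mul_apply, Module.algebraMap_end_apply, smul_dotProduct,
      dotProduct_smul]
    congr 1
    induction k generalizing v with
    | zero => rfl
    | succ k ih => rw [pow_succ', pow_succ, Module.End.mul_apply, h1, ih, Module.End.mul_apply]

/-- The kernel of `g(A)` is isotropic for an isometry `A`: on this kernel `h(A)` is invertible, and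
the adjoint of `h(A)` vanishes there since `h` is reciprocal to `g`. -/
theorem dotProduct_eq_zero_of_mem_ker (hA : A ^ 11 = 1) (hiso : ∀ u v, A u ⬝ᵥ A v = u ⬝ᵥ v)
    {g h : (ZMod 3)[X]} (hg : Irreducible g) (hgh : g * h = cyclotomic 11 (ZMod 3))
    {a r : (ZMod 3)[X]} (hr : 1 = a * h + r * g) {u v : Fin n → ZMod 3} (hu : aeval A g u = 0)
    (hv : aeval A g v = 0) : u ⬝ᵥ v = 0 := by
  obtain ⟨c, hc⟩ := exists_aeval_pow_ten_mul hg hgh hA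
  have h1 : u = aeval A h (aeval A a u) := by
    have := congrArg (fun p => aeval A p u) hr
    simp only [map_one, Module.End.one_apply, map_add, map_mul, LinearMap.add_apply,
      Module.End.mul_apply, hu, map_zero, add_zero] at this
    rw [← Module.End.mul_apply, ← map_mul, mul_comm, map_mul]
    exact this
  have h2 : v = (A ^ 5) ((A ^ 6) v) := by
    rw [← Module.End.mul_apply, ← pow_add, hA, Module.End.one_apply]
  have h3 : aeval (A ^ 10) h v = 0 := by
    rw [h2, ← Module.End.mul_apply, hc, LinearMap.smul_apply]
    have h4 := aeval_apply_of_semiconj (A := A) (B := A) (τ := A ^ 6) (fun w => by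
      rw [← Module.End.mul_apply, ← Module.End.mul_apply, ← pow_succ', ← pow_succ]) g v
    rw [h4, hv, map_zero, smul_zero]
  rw [h1, aeval_dotProduct hA hiso, h3, dotProduct_zero]

/-! ### Dimensions of the components -/

theorem blockCycle_pow_word (k : ℕ) (b : Fin 4 → Circ) (r : Fin 4 → ZMod 3) :
    (((monomialMap 1 blockCycle : (Fin 48 → ZMod 3) ≃ₗ[ZMod 3] (Fin 48 → ZMod 3)) :
      (Fin 48 → ZMod 3) →ₗ[ZMod 3] (Fin 48 → ZMod 3)) ^ k) (word b r) =
      word (fun p => shift k * b p) r := by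
  induction k with
  | zero => simp [shift_zero]
  | succ k ih =>
    rw [pow_succ', Module.End.mul_apply, ih, LinearEquiv.coe_coe, blockCycle_word, word_inj]
    refine ⟨funext fun p => ?_, rfl⟩
    rw [← mul_assoc, shift_mul_shift, Nat.cast_succ, add_comm]

/-- A word annihilated by a polynomial of degree 5 satisfies a linear recurrence of order 5 on each
block, and two blocks determine it. -/
theorem NormalCode.finrank_inf_ker_le {D : Submodule (ZMod 3) (Fin 48 → ZMod 3)} (hD : NormalCode D)
    {g : (ZMod 3)[X]} (hg : Irreducible g) (hdeg : g.natDegree = 5) :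
    Module.finrank (ZMod 3) (D ⊓ (aeval ((monomialMap 1 blockCycle :
      (Fin 48 → ZMod 3) ≃ₗ[ZMod 3] (Fin 48 → ZMod 3)) :
      (Fin 48 → ZMod 3) →ₗ[ZMod 3] (Fin 48 → ZMod 3)) g).ker :
      Submodule (ZMod 3) (Fin 48 → ZMod 3)) ≤ 10 := by
  have h1 : g.eval 1 ≠ 0 := by
    intro h0
    have : g.natDegree = 1 := natDegree_eq_of_degree_eq_some (degree_eq_one_of_irreducible_of_root hg h0)
    omega
  refine (finrank_le_card_of_eq_zero _ (Finset.univ.filter fun i : Fin 48 =>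
    i.val < 22 ∧ i.val % 11 < 5) ?_).trans (by decide +kernel)
  rintro w ⟨hw, hw'⟩ h0
  obtain ⟨b, r, rfl⟩ := exists_eq_word w
  have hker : ∑ k ∈ Finset.range 6, g.coeff k • word (fun p => shift k * b p) r = 0 := by
    rw [SetLike.mem_coe, LinearMap.mem_ker, aeval_eq_sum_range, hdeg, LinearMap.sum_apply] at hw'
    simpa only [LinearMap.smul_apply, blockCycle_pow_word] using hw'
  have hr : r = 0 := by
    funext j
    have := congrFun hker (coordEquiv (.inr j))
    simp only [Finset.sum_apply, Pi.smul_apply, word_inr, smul_eq_mul, ← Finset.sum_mul,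
      Pi.zero_apply] at this
    rw [eval_eq_sum_range, hdeg] at h1
    simp only [one_pow, mul_one] at h1
    exact (mul_eq_zero.mp this).resolve_left h1
  subst hr
  have hb : ∀ p : Fin 4, p.val < 2 → b p = 0 := by
    intro p hp
    have key : ∀ (n j : ℕ), j < 5 → b p ((j : ZMod 11) - n) = 0 := by
      intro n
      induction n with
      | zero =>
        intro j hj
        have e : ∀ x : Fin 4 × Fin 5, x.1.val < 2 →
            (coordEquiv (.inl (x.1, ((x.2.val : ℕ) : ZMod 11)))).val < 22 ∧
            (coordEquiv (.inl (x.1, ((x.2.val : ℕ) : ZMod 11)))).val % 11 < 5 := by decide +kernel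
        have := h0 (coordEquiv (.inl (p, (j : ZMod 11))))
          (Finset.mem_filter.mpr ⟨Finset.mem_univ _, e (p, ⟨j, hj⟩) hp⟩)
        simpa using this
      | succ n ih =>
        intro j hj
        rcases j with _ | j
        · have := congrFun hker (coordEquiv (.inl (p, ((4 : ℕ) : ZMod 11) - n)))
          simp only [Finset.sum_apply, Pi.smul_apply, word_inl, smul_eq_mul, Pi.zero_apply,
            shift_mul_apply] at this
          rw [Finset.sum_range_succ, Finset.sum_eq_zero, zero_add] at this
          · have h5 : g.coeff 5 ≠ 0 := by
              rw [← hdeg]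
              exact leadingCoeff_ne_zero.mpr hg.ne_zero
            rw [← (mul_eq_zero.mp this).resolve_left h5]
            congr 1
            push_cast
            ring
          · intro k hk
            have hk5 := Finset.mem_range.mp hk
            have := ih (4 - k) (by omega)
            rw [Nat.cast_sub (by omega)] at this
            rw [sub_right_comm, this, mul_zero]
        · have := ih j (by omega)
          rw [← this]
          congr 1
          push_cast
          ring
    ext i
    have := key (11 - i.val) 0 (by norm_num)
    rw [Nat.cast_sub i.val_lt.le, ZMod.natCast_zmod_val] at this
    have h11 : ((11 : ℕ) : ZMod 11) = 0 := by decide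
    rw [h11] at this
    simpa using this
  have := hD.two_blocks (p := 2) (q := 3) (by decide) hw fun i hi hi' => hb i (by omega)
  rw [this, word_zero]

/-! ### The components of an extremal code -/

section

variable {C : Submodule (ZMod 3) (Fin 48 → ZMod 3)}
  {σ : (Fin 48 → ZMod 3) ≃ₗ[ZMod 3] (Fin 48 → ZMod 3)}

theorem aut_apply_mem (hσ : σ ∈ monomialAut C) {v : Fin 48 → ZMod 3} (hv : v ∈ C) : σ v ∈ C := by
  rw [← hσ.2]
  exact ⟨v, hv, rfl⟩

theorem toLinearMap_pow_eleven (hord : orderOf σ = 11) :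
    (σ : (Fin 48 → ZMod 3) →ₗ[ZMod 3] (Fin 48 → ZMod 3)) ^ 11 = 1 := by
  have h : ∀ (k : ℕ) v, ((σ : (Fin 48 → ZMod 3) →ₗ[ZMod 3] (Fin 48 → ZMod 3)) ^ k) v =
      (σ ^ k) v := by
    intro k
    induction k with
    | zero => intro v; rfl
    | succ k ih =>
      intro v
      rw [pow_succ', pow_succ', Module.End.mul_apply, ih, LinearEquiv.mul_apply]
      rfl
  ext1 v
  have h1 := h 11
  rw [← hord, pow_orderOf_eq_one, hord] at h1
  ext i
  rw [LinearMap.comp_apply, LinearMap.comp_apply, h1]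
  rfl

/-- The component belonging to a factor `g` of the cyclotomic polynomial. The roles of `g` and `h`
are symmetric. -/
theorem component_eq (hord : orderOf σ = 11) {D : Submodule (ZMod 3) (Fin 48 → ZMod 3)}
    (hD : ∀ v ∈ D, σ v ∈ D) {g h a₀ a₁ a₂ : (ZMod 3)[X]} (hgh : X ^ 11 - 1 = (X - 1) * g * h)
    (h1 : 1 = a₀ * (g * h) + (X - 1) * (a₁ * h + a₂ * g)) :
    component D σ (a₁ * h * (X - 1)) =
      D ⊓ (aeval (σ : (Fin 48 → ZMod 3) →ₗ[ZMod 3] (Fin 48 → ZMod 3)) g).ker := by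
  refine map_aeval_eq_inf_ker (r := a₀ * h + (X - 1) * a₂) hD ?_ (by linear_combination h1)
  have e : g * (a₁ * h * (X - 1)) = a₁ * (X ^ 11 - 1) := by rw [hgh]; ring
  rw [e, map_mul, map_sub, map_pow, aeval_X, map_one, toLinearMap_pow_eleven hord, sub_self,
    mul_zero]

theorem component_fixed_eq (hord : orderOf σ = 11) (hσ : σ ∈ monomialAut C)
    {g h a₀ a₁ a₂ : (ZMod 3)[X]} (hgh : X ^ 11 - 1 = (X - 1) * g * h)
    (h1 : 1 = a₀ * (g * h) + (X - 1) * (a₁ * h + a₂ * g)) :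
    component C σ (a₀ * (g * h)) = fixedCode C σ := by
  have h2 := map_aeval_eq_inf_ker (D := C)
    (A := (σ : (Fin 48 → ZMod 3) →ₗ[ZMod 3] (Fin 48 → ZMod 3))) (q := X - 1)
    (e := a₀ * (g * h)) (r := a₁ * h + a₂ * g) (fun v hv => aut_apply_mem hσ hv) (by
      have e : (X - 1) * (a₀ * (g * h)) = a₀ * (X ^ 11 - 1) := by rw [hgh]; ring
      rw [e, map_mul, map_sub, map_pow, aeval_X, map_one, toLinearMap_pow_eleven hord, sub_self,
        mul_zero]) (by rw [mul_comm (a₁ * h + a₂ * g)]; exact h1)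
  rw [component, h2, fixedCode]
  ext v
  simp only [Submodule.mem_inf, LinearMap.mem_ker, map_sub, aeval_X, map_one, LinearMap.sub_apply,
    Module.End.one_apply, sub_eq_zero, LinearMap.mem_eqLocus, LinearMap.id_apply]

/-- A word orthogonal to the other component and lying in `V e₂` lies in `C`, as it is orthogonal to
the fixed code and to `C e₂` as well. -/
theorem component_eq_inf_dualCode (hC : C = dualCode C) (hord : orderOf σ = 11)
    (hσ : σ ∈ monomialAut C) {g h a₀ a₁ a₂ : (ZMod 3)[X]} (hg : Irreducible g)
    (hgh : X ^ 11 - 1 = (X - 1) * g * h)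
    (h1 : 1 = a₀ * (g * h) + (X - 1) * (a₁ * h + a₂ * g)) :
    component C σ (a₁ * h * (X - 1)) =
      component ⊤ σ (a₁ * h * (X - 1)) ⊓ dualCode (component C σ (a₂ * g * (X - 1))) := by
  have hmem : ∀ v ∈ C, σ v ∈ C := fun v hv => aut_apply_mem hσ hv
  have h11 := toLinearMap_pow_eleven hord
  have hiso : ∀ u v, (σ : (Fin 48 → ZMod 3) →ₗ[ZMod 3] (Fin 48 → ZMod 3)) u ⬝ᵥ
      (σ : (Fin 48 → ZMod 3) →ₗ[ZMod 3] (Fin 48 → ZMod 3)) v = u ⬝ᵥ v :=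
    fun u v => dotProduct_monomialMap hσ.1 u v
  have hcyc := mul_eq_cyclotomic_eleven hgh
  have htop := component_eq hord (D := ⊤) (fun _ _ => trivial) hgh h1
  apply le_antisymm
  · refine le_inf (Submodule.map_mono le_top) ?_
    rintro v hv d ⟨c, hc, rfl⟩
    obtain ⟨w, hw, rfl⟩ := hv
    exact dotProduct_eq_zero_of_mem hC (aeval_apply_mem hmem _ hc) (aeval_apply_mem hmem _ hw)
  · rintro v ⟨hv, hv'⟩
    obtain ⟨w, -, hw⟩ := id hv
    have hvg : aeval (σ : (Fin 48 → ZMod 3) →ₗ[ZMod 3] (Fin 48 → ZMod 3)) g v = 0 := by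
      rw [htop] at hv
      exact hv.2
    rw [component_eq hord hmem hgh h1]
    refine ⟨mem_of_forall_dotProduct hC fun c hc => ?_, hvg⟩
    have hc1 : c = aeval (σ : (Fin 48 → ZMod 3) →ₗ[ZMod 3] (Fin 48 → ZMod 3)) (a₀ * (g * h)) c +
        aeval (σ : (Fin 48 → ZMod 3) →ₗ[ZMod 3] (Fin 48 → ZMod 3)) (a₁ * h * (X - 1)) c +
        aeval (σ : (Fin 48 → ZMod 3) →ₗ[ZMod 3] (Fin 48 → ZMod 3)) (a₂ * g * (X - 1)) c := by
      rw [← LinearMap.add_apply, ← LinearMap.add_apply, ← map_add, ← map_add]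
      have e : a₀ * (g * h) + a₁ * h * (X - 1) + a₂ * g * (X - 1) = 1 := by linear_combination -h1
      rw [e, map_one, Module.End.one_apply]
    have hfix : aeval (σ : (Fin 48 → ZMod 3) →ₗ[ZMod 3] (Fin 48 → ZMod 3)) (a₀ * (g * h)) c ⬝ᵥ
        v = 0 := by
      have hu : aeval (σ : (Fin 48 → ZMod 3) →ₗ[ZMod 3] (Fin 48 → ZMod 3)) (a₀ * (g * h)) c ∈
          fixedCode C σ := component_fixed_eq hord hσ hgh h1 ▸ ⟨c, hc, rfl⟩
      generalize aeval (σ : (Fin 48 → ZMod 3) →ₗ[ZMod 3] (Fin 48 → ZMod 3)) (a₀ * (g * h)) c = u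
        at hu
      have hu2 : (σ : (Fin 48 → ZMod 3) →ₗ[ZMod 3] (Fin 48 → ZMod 3)) u = u := hu.2
      rw [← hw, mul_comm, map_mul, map_sub, aeval_X, map_one, Module.End.mul_apply,
        LinearMap.sub_apply, Module.End.one_apply, dotProduct_sub, sub_eq_zero]
      conv_lhs => rw [← hu2]
      exact hiso _ _
    have h2 : aeval (σ : (Fin 48 → ZMod 3) →ₗ[ZMod 3] (Fin 48 → ZMod 3)) (a₁ * h * (X - 1)) c ⬝ᵥ
        v = 0 := by
      refine dotProduct_eq_zero_of_mem_ker (a := a₁ * (X - 1)) (r := a₀ * h + (X - 1) * a₂)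
        h11 hiso hg hcyc (by linear_combination h1) ?_ hvg
      have : aeval (σ : (Fin 48 → ZMod 3) →ₗ[ZMod 3] (Fin 48 → ZMod 3)) (a₁ * h * (X - 1)) c ∈
        component C σ (a₁ * h * (X - 1)) := ⟨c, hc, rfl⟩
      rw [component_eq hord hmem hgh h1] at this
      exact this.2
    rw [hc1, add_dotProduct, add_dotProduct, hfix, h2, hv' _ ⟨c, hc, rfl⟩, add_zero, add_zero]

theorem finrank_component_le (hord : orderOf σ = 11) (hσ : σ ∈ monomialAut C)
    {τ : (Fin 48 → ZMod 3) ≃ₗ[ZMod 3] (Fin 48 → ZMod 3)}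
    (hτ : τ * σ * τ⁻¹ = monomialMap 1 blockCycle)
    (hD : NormalCode (C.map (τ : (Fin 48 → ZMod 3) →ₗ[ZMod 3] (Fin 48 → ZMod 3))))
    {g h a₀ a₁ a₂ : (ZMod 3)[X]} (hg : Irreducible g) (hgh : X ^ 11 - 1 = (X - 1) * g * h)
    (h1 : 1 = a₀ * (g * h) + (X - 1) * (a₁ * h + a₂ * g)) :
    Module.finrank (ZMod 3) (component C σ (a₁ * h * (X - 1))) ≤ 10 := by
  have hdeg := natDegree_of_dvd_cyclotomic_eleven hg ⟨h, (mul_eq_cyclotomic_eleven hgh).symm⟩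
  refine le_trans ?_ (hD.finrank_inf_ker_le hg hdeg)
  rw [component_eq hord (fun v hv => aut_apply_mem hσ hv) hgh h1, ← LinearEquiv.finrank_map_eq τ]
  refine Submodule.finrank_mono ?_
  rintro _ ⟨c, ⟨hc, hc'⟩, rfl⟩
  refine ⟨⟨c, hc, rfl⟩, ?_⟩
  have hsemi : ∀ v, (monomialMap 1 blockCycle :
      (Fin 48 → ZMod 3) ≃ₗ[ZMod 3] (Fin 48 → ZMod 3)).toLinearMap (τ v) = τ (σ v) := fun v =>
    (congrArg (fun f : (Fin 48 → ZMod 3) ≃ₗ[ZMod 3] (Fin 48 → ZMod 3) => f v)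
      (mul_inv_eq_iff_eq_mul.mp hτ)).symm
  have := aeval_apply_of_semiconj (A := (σ : (Fin 48 → ZMod 3) →ₗ[ZMod 3] (Fin 48 → ZMod 3)))
    (B := (monomialMap 1 blockCycle :
      (Fin 48 → ZMod 3) ≃ₗ[ZMod 3] (Fin 48 → ZMod 3)).toLinearMap) (τ := τ.toLinearMap) hsemi g c
  exact this.trans (by rw [LinearMap.mem_ker.mp hc', map_zero])

/-- The dimension `24 = 4 + 10 + 10` forces both bounds to be attained. -/
theorem component_hasEigenDimension (hC : C = dualCode C) (hord : orderOf σ = 11)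
    (hσ : σ ∈ monomialAut C) (hfix : Module.finrank (ZMod 3) (fixedCode C σ) = 4)
    {τ : (Fin 48 → ZMod 3) ≃ₗ[ZMod 3] (Fin 48 → ZMod 3)}
    (hτ : τ * σ * τ⁻¹ = monomialMap 1 blockCycle)
    (hD : NormalCode (C.map (τ : (Fin 48 → ZMod 3) →ₗ[ZMod 3] (Fin 48 → ZMod 3))))
    {g h a₀ a₁ a₂ : (ZMod 3)[X]} (hg : Irreducible g) (hh : Irreducible h)
    (hgh : X ^ 11 - 1 = (X - 1) * g * h)
    (h1 : 1 = a₀ * (g * h) + (X - 1) * (a₁ * h + a₂ * g)) :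
    HasEigenDimension (component C σ (a₁ * h * (X - 1))) σ g 2 := by
  have hmem : ∀ v ∈ C, σ v ∈ C := fun v hv => aut_apply_mem hσ hv
  have hdeg := natDegree_of_dvd_cyclotomic_eleven hg ⟨h, (mul_eq_cyclotomic_eleven hgh).symm⟩
  have hd2 := finrank_component_le hord hσ hτ hD hg hgh h1
  have hd3 := finrank_component_le (a₀ := a₀) (a₁ := a₂) (a₂ := a₁) (g := h) (h := g) hord hσ hτ hD hh
    (by rw [hgh]; ring) (by linear_combination h1)
  have hsup : C ≤ fixedCode C σ ⊔ component C σ (a₁ * h * (X - 1)) ⊔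
      component C σ (a₂ * g * (X - 1)) := by
    intro c hc
    have e : a₀ * (g * h) + a₁ * h * (X - 1) + a₂ * g * (X - 1) = 1 := by linear_combination -h1
    have hc1 : aeval (σ : (Fin 48 → ZMod 3) →ₗ[ZMod 3] (Fin 48 → ZMod 3)) (a₀ * (g * h)) c +
        aeval (σ : (Fin 48 → ZMod 3) →ₗ[ZMod 3] (Fin 48 → ZMod 3)) (a₁ * h * (X - 1)) c +
        aeval (σ : (Fin 48 → ZMod 3) →ₗ[ZMod 3] (Fin 48 → ZMod 3)) (a₂ * g * (X - 1)) c = c := by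
      rw [← LinearMap.add_apply, ← LinearMap.add_apply, ← map_add, ← map_add, e, map_one,
        Module.End.one_apply]
    rw [← hc1, ← component_fixed_eq hord hσ hgh h1]
    exact Submodule.add_mem_sup (Submodule.add_mem_sup ⟨c, hc, rfl⟩ ⟨c, hc, rfl⟩) ⟨c, hc, rfl⟩
  have hle := (Submodule.finrank_mono hsup).trans
    ((Submodule.finrank_add_le_finrank_add_finrank _ _).trans
      (Nat.add_le_add_right (Submodule.finrank_add_le_finrank_add_finrank _ _) _))
  have h24 := finrank_of_eq_dualCode hC
  refine hasEigenDimension_of_finrank hg ?_ ?_ (by omega)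
  · rintro _ ⟨c, hc, rfl⟩
    refine ⟨σ c, hmem c hc, ?_⟩
    exact aeval_apply_of_semiconj (A := (σ : (Fin 48 → ZMod 3) →ₗ[ZMod 3] (Fin 48 → ZMod 3)))
      (B := (σ : (Fin 48 → ZMod 3) →ₗ[ZMod 3] (Fin 48 → ZMod 3))) (τ := σ.toLinearMap)
      (fun _ => rfl) _ c
  · intro v hv
    rw [component_eq hord hmem hgh h1] at hv
    exact hv.2

theorem mainTheorem3
    (C : Submodule (ZMod 3) (Fin 48 → ZMod 3)) (hC : IsExtremalTernary C)
    (σ : (Fin 48 → ZMod 3) ≃ₗ[ZMod 3] (Fin 48 → ZMod 3))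
    (hσ : σ ∈ monomialAut C) (hord : orderOf σ = 11) :
    CodeEquivalent C P48 ∧
    Module.finrank (ZMod 3) (fixedCode C σ) = 4 ∧
    (∃ τ ∈ monomialGroup (ZMod 3) 48,
      (∀ v, (τ * σ * τ⁻¹) v = v ∘ ⇑(blockCycle⁻¹)) ∧
      fixedCode (C.map (τ : (Fin 48 → ZMod 3) →ₗ[ZMod 3] (Fin 48 → ZMod 3))) (τ * σ * τ⁻¹) =
        Submodule.span (ZMod 3) (Set.range fun r => fixedGenerator r)) ∧
    (∀ g h a₀ a₁ a₂ e₁ e₂ e₃ : (ZMod 3)[X], Irreducible g → Irreducible h →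
      X ^ 11 - 1 = (X - 1) * g * h →
      1 = a₀ * (g * h) + (X - 1) * (a₁ * h + a₂ * g) →
      e₁ = a₀ * (g * h) → e₂ = a₁ * h * (X - 1) → e₃ = a₂ * g * (X - 1) →
      component C σ e₁ = fixedCode C σ ∧
      HasEigenDimension (component C σ e₂) σ g 2 ∧
      HasEigenDimension (component C σ e₃) σ h 2 ∧
      component C σ e₂ = component ⊤ σ e₂ ⊓ dualCode (component C σ e₃) ∧
      component C σ e₃ = component ⊤ σ e₃ ⊓ dualCode (component C σ e₂)) := by
  obtain ⟨hdual, hdist⟩ := hC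
  obtain ⟨τ, hτ, hτσ, hD⟩ := exists_normalCode hdual
    (fun c hc h0 => weight_ge_of_minDistance hdist hc h0) hσ hord
  have hfixed : fixedCode (C.map (τ : (Fin 48 → ZMod 3) →ₗ[ZMod 3] (Fin 48 → ZMod 3)))
      (τ * σ * τ⁻¹) = Submodule.span (ZMod 3) (Set.range fun r => fixedGenerator r) := by
    rw [hτσ, hD.fixedCode_eq]
  have hfix : Module.finrank (ZMod 3) (fixedCode C σ) = 4 := by
    rw [← LinearEquiv.finrank_map_eq τ, ← fixedCode_map, hfixed, finrank_span_fixedGenerator]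
  refine ⟨CodeEquivalent.trans ⟨τ, hτ, rfl⟩ hD.codeEquivalent_pless, hfix,
    ⟨τ, hτ, fun v => by rw [hτσ, monomialMap_one_apply]; rfl, hfixed⟩, ?_⟩
  rintro g h a₀ a₁ a₂ _ _ _ hg hh hgh h1 rfl rfl rfl
  have hgh' : X ^ 11 - 1 = (X - 1) * h * g := by rw [hgh]; ring
  have h1' : 1 = a₀ * (h * g) + (X - 1) * (a₂ * g + a₁ * h) := by linear_combination h1
  exact ⟨component_fixed_eq hord hσ hgh h1,
    component_hasEigenDimension hdual hord hσ hfix hτσ hD hg hh hgh h1,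
    component_hasEigenDimension hdual hord hσ hfix hτσ hD hh hg hgh' h1',
    component_eq_inf_dualCode hdual hord hσ hg hgh h1,
    component_eq_inf_dualCode hdual hord hσ hh hgh' h1'⟩

end
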